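/- Let $V$ be a real polynomial of even degree $D\ge 2$ with leading coefficient $\gamma>0$, let $\langle P,Q\rangle_4=\tfrac12\int_{\mathbb R}(PQ'-P'Q)e^{-2V}\,dx$, and call a sequence of monic real polynomials $(P_m)_{m\ge 0}$, $\deg P_m=m$, skew-orthogonal if $\langle P_{2m},P_{2l}\rangle_4=\langle P_{2m+1},P_{2l+1}\rangle_4=0$ for all $m,l\ge 0$ and $\langle P_{2m},P_{2l+1}\rangle_4=0$ for $m\neq l$. Put $\Psi_m=-\frac1{\gamma D}e^{V}(e^{-V}P_m)'$ (a monic polynomial of degree $m+D-1$) and $h_m=\langle P_{2m},P_{2m+1}\rangle_4$. Let $\omega=e^{2\pi i/D}$ and $C_k=\omega^k[0,\infty)$ for $0\le k\le D-1$, where $C_0$ is oriented away from the origin and $C_1,\dots,C_{D-1}$ towards it. Let $\Gamma_k=C_0\cup C_k$ for $1\le k\le D-1$, let $\mathbb T$ be the positively oriented unit circle, $\Sigma=\mathbb T\cup\bigcup_{k=1}^{D-1}\Gamma_k$ and $S=\{0,1,\omega,\dots,\omega^{D-1}\}$. For an oriented contour $\Gamma$ put $C_\Gamma(f)(z)=\frac1{2\pi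 i}\int_\Gamma\frac{f(x)}{x-z}\,dx$. For an integer $n\ge 0$, the odd Riemann–Hilbert problem asks for $B_n:\mathbb C\setminus\Sigma\to\mathcal M_{D+2}(\mathbb C)$ such that 1. $B_n$ is analytic on $\mathbb C\setminus\Sigma$; 2. $B_n$ has continuous boundary values up to $\Sigma\setminus S$ from either side: for every $x\in\Sigma\setminus S$ the limits $B_n^{+}(x)$ and $B_n^{-}(x)$ of $B_n(z)$, as $z\to x$ within the left, respectively the right, side of $\Sigma$, exist, and $B_n^{\pm}$ are continuous on $\Sigma\setminus S$; 3. $B_n$ is bounded in a neighbourhood of $S$; 4. $B_n^+(x)=B_n^-(x)J_n(x)$ for $x\in\Sigma\setminus S$, where $J_n$ is the identity matrix with its first row replaced by $$\bigl(1,\; e^{-2V}\chi_{\mathbb R},\; e^{-V}\chi_{\Gamma_1},\;\dots,\; e^{-V}\chi_{\Gamma_{D-1}},\; x^{-2n-D}\chi_{\mathbb T}\bigr);$$ 5. $B_n(z)=(\mathbb I+\mathcal O(z^{-1}))\,\mathrm{diag}(z^{2n+D},z^{-2n},z^{-1},\dots,z^{-1})$ as $z\to\infty$ in $\mathbb C\setminus\Sigma$.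 Define linear functionals on complex polynomials by $\alpha_i(Q)=\int_{\mathbb R}e^{-2V}x^iQ\,dx$, $\beta_k(Q)=-\frac1{2\pi i}\int_{\Gamma_k}e^{-V}Q\,dx$ for $1\le k\le D-1$, and $\beta_D(Q)=-\frac1{2\pi i}\oint_{\mathbb T}z^{-2n-D}Q(z)\,dz$. **Theorem.** There is exactly one skew-orthogonal sequence $(P_m)$ for which the next-to-leading coefficient of $\Psi_{2m+1}$ is zero for all $m\ge 0$. For this sequence and every $n\ge 0$: (a) For each $j=1,\dots,D$ there is exactly one complex polynomial $R_n^{(j)}$ of degree at most $2n+D-1$ with $\alpha_0(R_n^{(j)})=\dots=\alpha_{2n-1}(R_n^{(j)})=0$ and $\beta_k(R_n^{(j)})=\delta_{kj}$ for $k=1,\dots,D$. For $j\le D-1$, $R_n^{(j)}$ is also the unique polynomial of degree at most $2n+D-2$ with $\alpha_0=\dots=\alpha_{2n-1}=0$ and $\beta_k=\delta_{kj}$ for $k=1,\dots,D-1$. (b) $R_n^{(D)}=-\Psi_{2n}$. (c) The odd Riemann–Hilbert problem has exactly one solution $B_n$. Its rows are of the form $$\bigl(Q,\; C_{\mathbb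 R}(e^{-2V}Q),\; C_{\Gamma_1}(e^{-V}Q),\;\dots,\; C_{\Gamma_{D-1}}(e^{-V}Q),\; C_{\mathbb T}(x^{-2n-D}Q)\bigr),$$ where $Q$ is, from the first row to the last, $$\Psi_{2n+1},\quad -\frac{2\pi i\gamma D}{h_{n-1}}\Psi_{2n-2},\quad R_n^{(1)},\;\dots,\;R_n^{(D)},$$ except that for $n=0$ (where $\Psi_{-2}$ and $h_{-1}$ are not defined) the second row is $(0,1,0,\dots,0)$. -/

import Mathlib

open Polynomial

noncomputable section

namespace OddRHP

/-! ### Skew-orthogonal polynomials of symplectic type -/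

/-- The skew form `⟨P, Q⟩₄ = (1/2) ∫_ℝ (P Q' - P' Q) e^{-2V} dx`. -/
def skewForm (V P Q : ℝ[X]) : ℝ :=
  (1 / 2) * ∫ x : ℝ,
    (P.eval x * (derivative Q).eval x - (derivative P).eval x * Q.eval x) *
      Real.exp (-2 * V.eval x)

/-- A sequence of monic skew-orthogonal polynomials, `deg P_n = n`. -/
structure IsSkewOrthogonal (V : ℝ[X]) (P : ℕ → ℝ[X]) : Prop where
  monic : ∀ n, (P n).Monic
  natDegree_eq : ∀ n, (P n).natDegree = n
  even_even : ∀ n m, skewForm V (P (2 * n)) (P (2 * m)) = 0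
  odd_odd : ∀ n m, skewForm V (P (2 * n + 1)) (P (2 * m + 1)) = 0
  even_odd : ∀ n m, n ≠ m → skewForm V (P (2 * n)) (P (2 * m + 1)) = 0

/-- The dual polynomial `-(1/(γ D)) e^V (e^{-V} P)' = -(1/(γ D)) (P' - V' P)`, where `γ` is the
leading coefficient and `D` the degree of `V` (see `eval_dual`). -/
def dual (V P : ℝ[X]) : ℝ[X] :=
  Polynomial.C (-(1 / (V.leadingCoeff * V.natDegree))) * (derivative P - derivative V * P)

theorem eval_dual (V P : ℝ[X]) (x : ℝ) :
    (dual V P).eval x = -(1 / (V.leadingCoeff * V.natDegree)) *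
      (Real.exp (V.eval x) * deriv (fun y : ℝ => Real.exp (-V.eval y) * P.eval y) x) := by
  have h1 : HasDerivAt (fun y : ℝ => Real.exp (-V.eval y) * P.eval y)
      (Real.exp (-V.eval x) * (-(derivative V).eval x) * P.eval x +
        Real.exp (-V.eval x) * (derivative P).eval x) x :=
    ((V.hasDerivAt x).neg.exp).mul (P.hasDerivAt x)
  have h2 : Real.exp (V.eval x) * Real.exp (-V.eval x) = 1 := by
    rw [← Real.exp_add, add_neg_cancel, Real.exp_zero]
  rw [h1.deriv]
  simp only [dual, eval_mul, eval_C, eval_sub]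
  linear_combination
    -(-(1 / (V.leadingCoeff * V.natDegree)) *
      ((derivative P).eval x - (derivative V).eval x * P.eval x)) * h2

/-- Skew-orthogonal sequences normalised so that the next-to-leading coefficient of every dual
polynomial `Ψ_{2n+1}` vanishes. -/
structure IsNormalizedSkewOrthogonal (V : ℝ[X]) (P : ℕ → ℝ[X]) : Prop
    extends IsSkewOrthogonal V P where
  nextCoeff_dual : ∀ n, (dual V (P (2 * n + 1))).nextCoeff = 0

/-- `Ψ_n`, viewed as a complex polynomial. -/
def Psi (V : ℝ[X]) (P : ℕ → ℝ[X]) (n : ℕ) : ℂ[X] :=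
  (dual V (P n)).map (algebraMap ℝ ℂ)

/-! ### Contours -/

/-- `ω = e^{2πi/D}`. -/
def omega (D : ℕ) : ℂ := Complex.exp (2 * Real.pi * Complex.I / D)

/-- The ray `C_k = e^{2πik/D} [0, ∞)`. -/
def ray (D k : ℕ) : Set ℂ := {z | ∃ t : ℝ, 0 ≤ t ∧ z = omega D ^ k * t}

/-- `Γ_k = C_0 ∪ C_k`. -/
def Gam (D k : ℕ) : Set ℂ := ray D 0 ∪ ray D k

/-- The unit circle `𝕋`. -/
def torus : Set ℂ := {z | ‖z‖ = 1}

/-- The real line in `ℂ`. -/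
def realLine : Set ℂ := {z | z.im = 0}

/-- `Σ = 𝕋 ∪ Γ_1 ∪ ⋯ ∪ Γ_{D-1}`. -/
def Sig (D : ℕ) : Set ℂ := torus ∪ ⋃ j ∈ Finset.Icc 1 (D - 1), Gam D j

/-- `S = {0, 1, ω, …, ω^{D-1}}`, the self-intersection points of `Σ`. -/
def selfInt (D : ℕ) : Set ℂ := {z | z = 0 ∨ ∃ k < D, z = omega D ^ k}

/-- `∫_{Γ_k} f(z) dz`: inwards along `C_k` (for `k ≥ 1`), then outwards along `C_0`. -/
def integralGam (D k : ℕ) (f : ℂ → ℂ) : ℂ :=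
  (∫ t in Set.Ioi (0 : ℝ), f t) -
    ∫ t in Set.Ioi (0 : ℝ), f (omega D ^ k * t) * omega D ^ k

/-- `∫_ℝ f(x) dx`. -/
def integralReal (f : ℂ → ℂ) : ℂ := ∫ t : ℝ, f t

/-- `∮_𝕋 f(z) dz`, positively oriented. -/
def integralTorus (f : ℂ → ℂ) : ℂ := ∮ z in C(0, 1), f z

/-- The Cauchy transform `C_Γ(f)(z) = (1/2πi) ∫_Γ f(x)/(x-z) dx` for the contour `Γ` whose
integration functional is `I`. -/
def cauchy (I : (ℂ → ℂ) → ℂ) (f : ℂ → ℂ) (z : ℂ) : ℂ :=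
  (1 / (2 * Real.pi * Complex.I)) * I (fun x => f x / (x - z))

/-! ### The three kinds of weights -/

/-- `e^{-V}` on `ℂ`. -/
def weightGam (V : ℝ[X]) (z : ℂ) : ℂ := Complex.exp (-aeval z V)

/-- `e^{-2V}` on `ℂ`. -/
def weightReal (V : ℝ[X]) (z : ℂ) : ℂ := Complex.exp (-2 * aeval z V)

/-- `z^{-2n-D}`. -/
def weightTorus (D n : ℕ) (z : ℂ) : ℂ := z ^ (-(2 * n + D : ℤ))

/-! ### The odd Riemann–Hilbert problem

Rows and columns are indexed by `Fin (D + 2)`, starting at `0`. Column `0` is the first column,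
column `1` belongs to `ℝ`, column `k + 1` belongs to `Γ_k` for `1 ≤ k ≤ D - 1`, and column `D + 1`
belongs to `𝕋`. -/

/-- The first row of the jump matrix. -/
def jumpRow (V : ℝ[X]) (D n : ℕ) (x : ℂ) (c : Fin (D + 2)) : ℂ :=
  if (c : ℕ) = 0 then 1
  else if (c : ℕ) = 1 then realLine.indicator (weightReal V) x
  else if (c : ℕ) = D + 1 then torus.indicator (weightTorus D n) x
  else (Gam D ((c : ℕ) - 1)).indicator (weightGam V) x

/-- The jump matrix: the identity with its first row replaced by `jumpRow`. -/
def jumpMatrix (V : ℝ[X]) (D n : ℕ) (x : ℂ) : Matrix (Fin (D + 2)) (Fin (D + 2)) ℂ :=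
  Matrix.of fun i c => if (i : ℕ) = 0 then jumpRow V D n x c else if i = c then 1 else 0

/-- The diagonal matrix `diag(z^{2n+D}, z^{-2n}, z^{-1}, …, z^{-1})`. -/
def normMatrix (D n : ℕ) (z : ℂ) : Matrix (Fin (D + 2)) (Fin (D + 2)) ℂ :=
  Matrix.diagonal fun i =>
    if (i : ℕ) = 0 then z ^ (2 * n + D)
    else if (i : ℕ) = 1 then z ^ (-(2 * n : ℤ))
    else z⁻¹

/-- The points lying to the left of the oriented contour `Σ`, as seen from a point `x ∈ Σ \ S`.
`𝕋` is positively oriented, `C_0` points outwards and `C_k`, `k ≥ 1`, points inwards. -/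
def leftSide (D : ℕ) (x : ℂ) : Set ℂ :=
  {z | (x ∈ torus ∧ ‖z‖ < 1) ∨ (x ∈ ray D 0 ∧ 0 < z.im) ∨
    ∃ k ∈ Finset.Icc 1 (D - 1), x ∈ ray D k ∧ (z / omega D ^ k).im < 0}

/-- The points lying to the right of `Σ`, as seen from a point `x ∈ Σ \ S`. -/
def rightSide (D : ℕ) (x : ℂ) : Set ℂ :=
  {z | (x ∈ torus ∧ 1 < ‖z‖) ∨ (x ∈ ray D 0 ∧ z.im < 0) ∨
    ∃ k ∈ Finset.Icc 1 (D - 1), x ∈ ray D k ∧ 0 < (z / omega D ^ k).im}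

/-- `B` solves the odd Riemann–Hilbert problem. Only the values of `B` on `ℂ \ Σ` matter. -/
structure IsSolution (V : ℝ[X]) (D n : ℕ)
    (B : ℂ → Matrix (Fin (D + 2)) (Fin (D + 2)) ℂ) : Prop where
  /-- `B` is analytic on `ℂ \ Σ`. -/
  analytic : ∀ i c, AnalyticOnNhd ℂ (fun z => B z i c) (Sig D)ᶜ
  /-- `B` has continuous boundary values from the left and from the right up to `Σ \ S`, and
  these are related by the jump matrix. -/
  jump : ∃ Bp Bm : ℂ → Matrix (Fin (D + 2)) (Fin (D + 2)) ℂ,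
    ContinuousOn Bp (Sig D \ selfInt D) ∧ ContinuousOn Bm (Sig D \ selfInt D) ∧
    ∀ x ∈ Sig D \ selfInt D,
      Filter.Tendsto B (nhdsWithin x ((Sig D)ᶜ ∩ leftSide D x)) (nhds (Bp x)) ∧
      Filter.Tendsto B (nhdsWithin x ((Sig D)ᶜ ∩ rightSide D x)) (nhds (Bm x)) ∧
      Bp x = Bm x * jumpMatrix V D n x
  /-- `B` is bounded near `S`. -/
  bounded : ∀ s ∈ selfInt D, ∃ M : ℝ,
    ∀ᶠ z in nhdsWithin s (Sig D)ᶜ, ∀ i c, ‖B z i c‖ ≤ M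
  /-- `B(z) = (I + O(z⁻¹)) diag(z^{2n+D}, z^{-2n}, z^{-1}, …, z^{-1})` as `z → ∞` in `ℂ \ Σ`. -/
  normalization : ∃ E : ℂ → Matrix (Fin (D + 2)) (Fin (D + 2)) ℂ,
    (∀ z ∈ (Sig D)ᶜ, B z = (1 + E z) * normMatrix D n z) ∧
    ∀ i c, (fun z => E z i c) =O[Bornology.cobounded ℂ ⊓ Filter.principal (Sig D)ᶜ]
      fun z => z⁻¹

/-! ### The auxiliary polynomials and the explicit solution -/

/-- `α_j(Q) = ∫_ℝ e^{-2V(x)} x^j Q(x) dx`. -/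
def alpha (V : ℝ[X]) (j : ℕ) (Q : ℂ[X]) : ℂ :=
  integralReal fun x => weightReal V x * x ^ j * Q.eval x

/-- `β_k(Q) = -(1/2πi) ∫_{Γ_k} e^{-V} Q dx` for `1 ≤ k ≤ D - 1`, and
`β_D(Q) = -(1/2πi) ∮_𝕋 z^{-2n-D} Q(z) dz`. -/
def beta (V : ℝ[X]) (D n k : ℕ) (Q : ℂ[X]) : ℂ :=
  -(1 / (2 * Real.pi * Complex.I)) *
    if k = D then integralTorus fun x => weightTorus D n x * Q.eval x
    else integralGam D k fun x => weightGam V x * Q.eval x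

/-- The conditions defining `R = R_n^{(j)}`, `1 ≤ j ≤ D`, in the odd problem: degree at most
`2n + D - 1`, `α_0(R) = ⋯ = α_{2n-1}(R) = 0` and `β_k(R) = δ_{kj}` for `k = 1, …, D`. -/
def IsAux (V : ℝ[X]) (D n j : ℕ) (R : ℂ[X]) : Prop :=
  R.natDegree ≤ 2 * n + D - 1 ∧ (∀ i < 2 * n, alpha V i R = 0) ∧
    ∀ k ∈ Finset.Icc 1 D, beta V D n k R = if k = j then 1 else 0

/-- The conditions defining `R = R_n^{(j)}`, `1 ≤ j ≤ D - 1`, in the even problem: degree at most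
`2n + D - 2`, `α_0(R) = ⋯ = α_{2n-1}(R) = 0` and `β_k(R) = δ_{kj}` for `k = 1, …, D - 1`. -/
def IsEvenAux (V : ℝ[X]) (D n j : ℕ) (R : ℂ[X]) : Prop :=
  R.natDegree ≤ 2 * n + D - 2 ∧ (∀ i < 2 * n, alpha V i R = 0) ∧
    ∀ k ∈ Finset.Icc 1 (D - 1), beta V D n k R = if k = j then 1 else 0

/-- The skew norm `h_n = ⟨P_{2n}, P_{2n+1}⟩₄`. -/
def skewNorm (V : ℝ[X]) (P : ℕ → ℝ[X]) (n : ℕ) : ℝ :=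
  skewForm V (P (2 * n)) (P (2 * n + 1))

/-- The polynomials in the first column: `Ψ_{2n+1}`, `-(2πiγD/h_{n-1}) Ψ_{2n-2}`,
`R^{(1)}, …, R^{(D)}`. (For `n = 0` the second one is not used.) -/
def firstCol (V : ℝ[X]) (D n : ℕ) (P : ℕ → ℝ[X]) (R : ℕ → ℂ[X]) (i : Fin (D + 2)) : ℂ[X] :=
  if (i : ℕ) = 0 then Psi V P (2 * n + 1)
  else if (i : ℕ) = 1 then
    Polynomial.C (-(2 * Real.pi * Complex.I * V.leadingCoeff * D / skewNorm V P (n - 1))) *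
      Psi V P (2 * n - 2)
  else R ((i : ℕ) - 1)

/-- The row `(Q, C_ℝ(e^{-2V} Q), C_{Γ_1}(e^{-V} Q), …, C_{Γ_{D-1}}(e^{-V} Q), C_𝕋(z^{-2n-D} Q))`. -/
def cauchyRow (V : ℝ[X]) (D n : ℕ) (Q : ℂ[X]) (z : ℂ) (c : Fin (D + 2)) : ℂ :=
  if (c : ℕ) = 0 then Q.eval z
  else if (c : ℕ) = 1 then cauchy integralReal (fun x => weightReal V x * Q.eval x) z
  else if (c : ℕ) = D + 1 then cauchy integralTorus (fun x => weightTorus D n x * Q.eval x) z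
  else cauchy (integralGam D ((c : ℕ) - 1)) (fun x => weightGam V x * Q.eval x) z

/-- The explicit solution. For `n = 0`, where `Ψ_{2n-2}` and `h_{n-1}` do not exist, the second
row is `(0, 1, 0, …, 0)`. -/
def explicitSolution (V : ℝ[X]) (D n : ℕ) (P : ℕ → ℝ[X]) (R : ℕ → ℂ[X]) (z : ℂ) :
    Matrix (Fin (D + 2)) (Fin (D + 2)) ℂ :=
  Matrix.of fun i c =>
    if n = 0 ∧ (i : ℕ) = 1 then (if (c : ℕ) = 1 then 1 else 0)
    else cauchyRow V D n (firstCol V D n P R i) z c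

end OddRHP

end

open Polynomial

noncomputable section

namespace OddRHP

open MeasureTheory Set Filter Topology

/-! Each row of a solution is a scalar problem. The jump only adds multiples of the first column to
the others, so the first entry of a row has no jump across `Σ`; it is bounded near `S` and has
polynomial growth, hence it is a polynomial `Q`. The other entries then jump by `Q` times a weight
and decay at infinity, so by Liouville they are the Cauchy transforms of `Q`. Expanded at infinity,
the normalization becomes a statement about the top coefficient of `Q` and the values `α_0, …,
α_{2n-1}, β_1, …, β_D`.

Everything therefore rests on unisolvence (`eq_zero_of_alpha_beta`): these `2n + D` functionals
separate polynomials of degree at most `2n + D - 1`. It gives existence and uniqueness of the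
`R^{(j)}`, and uniqueness for the Riemann–Hilbert problem without any determinant argument
(`eq_zero_of_row`).

For unisolvence, `β_D` reads off the coefficient of `x^{2n+D-1}`. Once that vanishes, `R` is the
dual of some `P` with `deg P < 2n`, plus a remainder of degree at most `D - 2` (`exists_gdual_sub`).
The functionals `β_1, …, β_{D-1}` kill duals, because `e^{-V}` times a dual is an exact derivative,
and they are independent on the remainders (`eq_zero_of_integralGam_eq_zero`). On duals the `α_i`
are, by parts, the pairings `⟨P, x^i⟩₄` up to a constant (`skewForm_eq_moment_dual`), and the skew
form is nondegenerate in even dimension (`eq_zero_of_even_radical`) because `⟨P, xP⟩₄ = (1/2) ∫ P²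
e^{-2V} > 0`. The same facts construct the skew-orthogonal polynomials.

Independence of the `β_k` is a Phragmén–Lindelöf argument. If they all vanish on `R`, a primitive
`E` of `e^{-V} R` can be made to vanish at the ends of all `D` rays. Then `e^V E` has order at most
`D` and is bounded on `3D` equally spaced rays, so it is a constant `c`; thus `R = -c V'`, and the
degree forces `c = 0`.

On the analytic side, `RayDecay.stieltjes_eq` isolates the logarithmic singularity of a transform
over a half-line. This yields the Plemelj jumps, and boundedness at the origin, where the logarithms
of the two rays of `Γ_k` cancel. The real line is `Γ_{D/2}`, and the circle is computed explicitly.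
In the other direction, `exists_entire_extension` removes the contour by Morera's theorem. -/

/-! ### Stieltjes transforms of rapidly decaying entire functions. -/

/-- An entire function which, together with its derivative, decays faster than any power along
the positive half-line. -/
structure RayDecay (g : ℂ → ℂ) : Prop where
  diff : Differentiable ℂ g
  bound : ∀ N : ℕ, ∃ C, ∀ t : ℝ, 0 ≤ t → t ^ N * ‖g t‖ ≤ C
  bound_deriv : ∀ N : ℕ, ∃ C, ∀ t : ℝ, 0 ≤ t → t ^ N * ‖deriv g t‖ ≤ C

theorem RayDecay.id_mul {g : ℂ → ℂ} (hg : RayDecay g) : RayDecay fun t => t * g t where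
  diff := differentiable_id.mul hg.diff
  bound N := by
    obtain ⟨C, hC⟩ := hg.bound (N + 1)
    refine ⟨C, fun t ht => ?_⟩
    have := hC t ht
    rw [norm_mul, Complex.norm_of_nonneg ht]
    calc _ = t ^ (N + 1) * ‖g t‖ := by ring
      _ ≤ C := this
  bound_deriv N := by
    obtain ⟨C, hC⟩ := hg.bound N
    obtain ⟨C', hC'⟩ := hg.bound_deriv (N + 1)
    refine ⟨C + C', fun t ht => ?_⟩
    have h1 : deriv (fun t => t * g t) (t : ℂ) = g t + t * deriv g t := by
      have := ((hasDerivAt_id' (t : ℂ)).fun_mul (hg.diff t).hasDerivAt).deriv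
      simpa using this
    rw [h1]
    have h2 : ‖g t + t * deriv g t‖ ≤ ‖g t‖ + t * ‖deriv g t‖ := by
      refine (norm_add_le _ _).trans ?_
      rw [norm_mul, Complex.norm_of_nonneg ht]
    calc _ ≤ t ^ N * (‖g t‖ + t * ‖deriv g t‖) := by gcongr
      _ = t ^ N * ‖g t‖ + t ^ (N + 1) * ‖deriv g t‖ := by ring
      _ ≤ C + C' := add_le_add (hC t ht) (hC' t ht)

theorem RayDecay.const_mul {g : ℂ → ℂ} (hg : RayDecay g) (c : ℂ) :
    RayDecay fun t => c * g t where
  diff := hg.diff.const_mul c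
  bound N := by
    obtain ⟨C, hC⟩ := hg.bound N
    refine ⟨‖c‖ * C, fun t ht => ?_⟩
    rw [norm_mul, mul_left_comm]
    exact mul_le_mul_of_nonneg_left (hC t ht) (norm_nonneg c)
  bound_deriv N := by
    obtain ⟨C, hC⟩ := hg.bound_deriv N
    refine ⟨‖c‖ * C, fun t ht => ?_⟩
    rw [deriv_const_mul _ (hg.diff t), norm_mul, mul_left_comm]
    exact mul_le_mul_of_nonneg_left (hC t ht) (norm_nonneg c)

theorem RayDecay.continuous_ofReal {g : ℂ → ℂ} (hg : RayDecay g) :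
    Continuous fun t : ℝ => g t :=
  hg.diff.continuous.comp Complex.continuous_ofReal

theorem RayDecay.integrableOn {g : ℂ → ℂ} (hg : RayDecay g) :
    IntegrableOn (fun t : ℝ => g t) (Ioi 0) := by
  obtain ⟨C, hC⟩ := hg.bound 0
  obtain ⟨C', hC'⟩ := hg.bound 2
  refine Integrable.mono' ((integrable_inv_one_add_sq.const_mul (C + C')).integrableOn)
    hg.continuous_ofReal.aestronglyMeasurable ?_
  refine (ae_restrict_iff' measurableSet_Ioi).2 (ae_of_all _ fun t ht => ?_)
  have h0 : 0 ≤ t := le_of_lt ht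
  have h1 := hC t h0
  have h2 := hC' t h0
  rw [pow_zero, one_mul] at h1
  rw [← div_eq_mul_inv, le_div_iff₀ (by positivity)]
  nlinarith

theorem RayDecay.tendsto_zero {g : ℂ → ℂ} (hg : RayDecay g) :
    Tendsto (fun t : ℝ => g t) atTop (𝓝 0) := by
  obtain ⟨C, hC⟩ := hg.bound 1
  refine squeeze_zero_norm' (a := fun t : ℝ => C / t) ?_ (tendsto_const_nhds.div_atTop tendsto_id)
  filter_upwards [eventually_gt_atTop 0] with t ht
  rw [le_div_iff₀ ht]
  have := hC t ht.le
  rw [pow_one] at this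
  linarith

/-- `∫_a^∞ g(t) / (t - w) dt`. -/
def stieltjes (a : ℝ) (g : ℂ → ℂ) (w : ℂ) : ℂ := ∫ t in Ioi a, g t / (t - w)

/-- The hypothesis says that `w` is off the closed half-line; openness of the slit plane gives a
ball around `-w`, and it contains no `-t`. The factor `2` leaves room for a ball of radius `d`
around `w` on which the kernel is still controlled. -/
theorem exists_pos_le_norm_sub {w : ℂ} (hw : -w ∈ Complex.slitPlane) :
    ∃ d > 0, ∀ t : ℝ, 0 ≤ t → 2 * d ≤ ‖(t : ℂ) - w‖ := by
  obtain ⟨ε, hε, h⟩ := Metric.isOpen_iff.1 Complex.isOpen_slitPlane _ hw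
  refine ⟨ε / 2, by positivity, fun t ht => ?_⟩
  by_contra! hlt
  have : (-t : ℂ) ∈ Complex.slitPlane := by
    apply h
    rw [Metric.mem_ball, dist_eq_norm, sub_neg_eq_add, neg_add_eq_sub, norm_sub_rev]
    linarith
  rcases this with h | h <;> simp at h
  linarith

theorem integrableOn_div_sub {a d : ℝ} {g : ℂ → ℂ} {w : ℂ} (hg : Continuous fun t : ℝ => g t)
    (hi : IntegrableOn (fun t : ℝ => g t) (Ioi a)) (hd : 0 < d)
    (h : ∀ t : ℝ, a < t → d ≤ ‖(t : ℂ) - w‖) :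
    IntegrableOn (fun t : ℝ => g t / (t - w)) (Ioi a) := by
  have h1 : ∀ t ∈ Ioi a, (t : ℂ) - w ≠ 0 := fun t ht => norm_pos_iff.1 (hd.trans_le (h t ht))
  refine Integrable.mono' (hi.norm.mul_const d⁻¹) ?_ ?_
  · refine ContinuousOn.aestronglyMeasurable ?_ measurableSet_Ioi
    exact hg.continuousOn.div (Complex.continuous_ofReal.sub continuous_const).continuousOn h1
  · refine (ae_restrict_iff' measurableSet_Ioi).2 (ae_of_all _ fun t ht => ?_)
    rw [norm_div, div_eq_mul_inv]
    gcongr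
    exact h t ht

theorem differentiableAt_stieltjes {a d : ℝ} {g : ℂ → ℂ} {w : ℂ}
    (hg : Continuous fun t : ℝ => g t)
    (hi : IntegrableOn (fun t : ℝ => g t) (Ioi a)) (hd : 0 < d)
    (h : ∀ t : ℝ, a < t → 2 * d ≤ ‖(t : ℂ) - w‖) :
    DifferentiableAt ℂ (stieltjes a g) w := by
  have h1 : ∀ z ∈ Metric.ball w d, ∀ t : ℝ, a < t → d ≤ ‖(t : ℂ) - z‖ := by
    intro z hz t ht
    have := h t ht
    rw [Metric.mem_ball, dist_eq_norm] at hz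
    have h2 : ‖(t : ℂ) - w‖ ≤ ‖(t : ℂ) - z‖ + ‖z - w‖ := norm_sub_le_norm_sub_add_norm_sub _ _ _
    linarith
  have hz : ∀ z ∈ Metric.ball w d, ∀ t ∈ Ioi a, (t : ℂ) - z ≠ 0 := fun z hz t ht =>
    norm_pos_iff.1 (hd.trans_le (h1 z hz t ht))
  have hw := Metric.mem_ball_self (x := w) hd
  have hmeas : ∀ z ∈ Metric.ball w d,
      AEStronglyMeasurable (fun t : ℝ => g t / (t - z)) (volume.restrict (Ioi a)) := fun z hz =>
    (integrableOn_div_sub hg hi hd (h1 z hz)).aestronglyMeasurable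
  refine (hasDerivAt_integral_of_dominated_loc_of_deriv_le (Metric.ball_mem_nhds w hd)
    (bound := fun t : ℝ => ‖g t‖ * (d ^ 2)⁻¹) (F' := fun z (t : ℝ) => g t / (t - z) ^ 2)
    ?_ ?_ ?_ ?_ ?_ ?_).2.differentiableAt
  · filter_upwards [Metric.ball_mem_nhds w hd] with z hz using hmeas z hz
  · exact integrableOn_div_sub hg hi hd (h1 w hw)
  · refine ContinuousOn.aestronglyMeasurable ?_ measurableSet_Ioi
    exact hg.continuousOn.div ((Complex.continuous_ofReal.sub continuous_const).pow 2).continuousOn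
      fun t ht => pow_ne_zero 2 (hz w hw t ht)
  · refine (ae_restrict_iff' measurableSet_Ioi).2 (ae_of_all _ fun t ht z hz => ?_)
    rw [norm_div, div_eq_mul_inv, norm_pow]
    gcongr
    exact h1 z hz t ht
  · exact hi.norm.mul_const _
  · refine (ae_restrict_iff' measurableSet_Ioi).2 (ae_of_all _ fun t ht z hz' => ?_)
    have h3 : (t : ℂ) - z ≠ 0 := hz z hz' t ht
    refine ((hasDerivAt_const z (g t)).fun_div ((hasDerivAt_id' z).const_sub (t : ℂ)) h3).congr_deriv ?_
    simp

theorem RayDecay.differentiableAt_stieltjes {g : ℂ → ℂ} (hg : RayDecay g) {w : ℂ}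
    (hw : -w ∈ Complex.slitPlane) : DifferentiableAt ℂ (stieltjes 0 g) w := by
  obtain ⟨d, hd, h⟩ := exists_pos_le_norm_sub hw
  exact OddRHP.differentiableAt_stieltjes hg.continuous_ofReal hg.integrableOn hd
    fun t ht => h t ht.le

theorem RayDecay.integrableOn_div {g : ℂ → ℂ} (hg : RayDecay g) {w : ℂ}
    (hw : -w ∈ Complex.slitPlane) : IntegrableOn (fun t : ℝ => g t / (t - w)) (Ioi 0) := by
  obtain ⟨d, hd, h⟩ := exists_pos_le_norm_sub hw
  exact integrableOn_div_sub hg.continuous_ofReal hg.integrableOn (d := 2 * d) (by positivity)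
    fun t ht => h t ht.le

/-- From `w / (t - w) = t / (t - w) - 1`. Iterating this identity produces the expansion at infinity
in moments of `g`. -/
theorem RayDecay.mul_stieltjes {g : ℂ → ℂ} (hg : RayDecay g) {w : ℂ}
    (hw : -w ∈ Complex.slitPlane) :
    w * stieltjes 0 g w = stieltjes 0 (fun t => t * g t) w - ∫ t in Ioi (0 : ℝ), g t := by
  obtain ⟨d, hd, h⟩ := exists_pos_le_norm_sub hw
  unfold stieltjes
  rw [← integral_const_mul, ← integral_sub (hg.id_mul.integrableOn_div hw) hg.integrableOn]
  refine setIntegral_congr_fun measurableSet_Ioi fun t ht => ?_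
  have h3 : (t : ℂ) - w ≠ 0 := norm_pos_iff.1 (lt_of_lt_of_le (by positivity) (h t (le_of_lt ht)))
  field_simp
  ring

/-! ### The logarithmic singularity along the half-line. -/

/-- The difference quotient of an entire function, as an average of its derivative. -/
def avgDeriv (g : ℂ → ℂ) (t w : ℂ) : ℂ := ∫ s in (0 : ℝ)..1, deriv g (t + s * (w - t))

theorem mul_avgDeriv {g : ℂ → ℂ} (hg : Differentiable ℂ g) (t w : ℂ) :
    (w - t) * avgDeriv g t w = g w - g t := by
  have hc : Continuous (deriv g) := (hg.contDiff (n := 1)).continuous_deriv le_rfl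
  have h1 : ContinuousOn (fun s : ℝ => deriv g (t + s • (w - t))) (Icc 0 1) :=
    (hc.comp (by fun_prop)).continuousOn
  have := intervalIntegral.integral_unitInterval_deriv_eq_sub (f := g) (f' := deriv g) h1
    (fun s _ => (hg _).hasDerivAt)
  simpa [avgDeriv] using this

theorem continuous_avgDeriv {g : ℂ → ℂ} (hg : Differentiable ℂ g) :
    Continuous fun p : ℂ × ℂ => avgDeriv g p.1 p.2 := by
  have hc : Continuous (deriv g) := (hg.contDiff (n := 1)).continuous_deriv le_rfl
  refine intervalIntegral.continuous_parametric_intervalIntegral_of_continuous' ?_ _ _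
  exact hc.comp (by fun_prop)

/-- The part of `∫_0^∞ g(t) / (t - w) dt` which is continuous in `|w| < T`. -/
def regularPart (g : ℂ → ℂ) (T : ℝ) (w : ℂ) : ℂ :=
  (∫ t in (0 : ℝ)..T, avgDeriv g t w) + stieltjes T g w

/-- The averaged derivative is continuous even where `t = w`, and the tail beyond `T` stays away
from `w`; so there is no discontinuity across the half-line. -/
theorem RayDecay.continuousAt_regularPart {g : ℂ → ℂ} (hg : RayDecay g) {T : ℝ} {w : ℂ}
    (hw : ‖w‖ < T) : ContinuousAt (regularPart g T) w := by
  refine ContinuousAt.add ?_ ?_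
  · refine Continuous.continuousAt ?_
    refine intervalIntegral.continuous_parametric_intervalIntegral_of_continuous' ?_ _ _
    exact (continuous_avgDeriv hg.diff).comp
      (f := fun p : ℂ × ℝ => ((p.2 : ℂ), p.1)) (by fun_prop)
  · refine (OddRHP.differentiableAt_stieltjes (d := (T - ‖w‖) / 2) hg.continuous_ofReal ?_
      (by linarith) ?_).continuousAt
    · exact hg.integrableOn.mono_set (Ioi_subset_Ioi ((norm_nonneg w).trans hw.le))
    · intro t ht
      have h1 : ‖(t : ℂ)‖ ≤ ‖(t : ℂ) - w‖ + ‖w‖ := norm_le_norm_sub_add _ _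
      have h2 : t ≤ ‖(t : ℂ)‖ := by rw [Complex.norm_real]; exact le_abs_self t
      linarith

/-- A value in `(-∞, 0]` would make `t / w` a real number at least `1`, putting `w` on the closed
half-line. -/
theorem one_sub_div_mem_slitPlane {w : ℂ} (hw : -w ∈ Complex.slitPlane) {t : ℝ} (ht : 0 ≤ t) :
    1 - t / w ∈ Complex.slitPlane := by
  by_contra hn
  rw [Complex.mem_slitPlane_iff_not_le_zero, not_not, Complex.le_def] at hn
  have hw0 : w ≠ 0 := by rintro rfl; simp [Complex.mem_slitPlane_iff] at hw
  obtain ⟨h1, h2⟩ := hn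
  simp only [Complex.sub_re, Complex.one_re, Complex.zero_re, Complex.sub_im, Complex.one_im,
    Complex.zero_im, zero_sub, neg_eq_zero] at h1 h2
  obtain ⟨r, hr⟩ : ∃ r : ℝ, (t / w : ℂ) = r := ⟨_, (Complex.ext rfl (by simpa using h2))⟩
  rw [hr, Complex.ofReal_re] at h1
  have hr0 : (r : ℂ) ≠ 0 := by
    rw [Ne, Complex.ofReal_eq_zero]; rintro rfl; norm_num at h1
  have hwr : w = ((t / r : ℝ) : ℂ) := by
    push_cast
    rw [eq_div_iff hr0, ← hr]; field_simp
  rw [hwr] at hw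
  rcases hw with h | h
  · simp only [Complex.neg_re, Complex.ofReal_re, Left.neg_pos_iff] at h
    have : 0 ≤ t / r := div_nonneg ht (by linarith)
    linarith
  · simp only [Complex.neg_im, Complex.ofReal_im, neg_zero, ne_eq, not_true] at h

theorem integral_inv_sub {w : ℂ} (hw : -w ∈ Complex.slitPlane) {T : ℝ} (hT : 0 ≤ T) :
    ∫ t in (0 : ℝ)..T, 1 / ((t : ℂ) - w) = Complex.log (1 - T / w) := by
  have hw0 : w ≠ 0 := by rintro rfl; simp [Complex.mem_slitPlane_iff] at hw
  obtain ⟨d, hd, h⟩ := exists_pos_le_norm_sub hw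
  have hne : ∀ t ∈ Icc 0 T, (t : ℂ) - w ≠ 0 := fun t ht =>
    norm_pos_iff.1 (lt_of_lt_of_le (by positivity) (h t ht.1))
  have key : ∀ t ∈ uIcc 0 T, HasDerivAt (fun t : ℝ => Complex.log (1 - t / w))
      (1 / ((t : ℂ) - w)) t := by
    intro t ht
    rw [uIcc_of_le hT] at ht
    have h1 : HasDerivAt (fun t : ℝ => 1 - (t : ℂ) / w) (-(1 / w)) t :=
      ((Complex.ofRealCLM.hasDerivAt (x := t)).div_const w).const_sub 1
    have h2 := h1.clog_real (one_sub_div_mem_slitPlane hw ht.1)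
    refine h2.congr_deriv ?_
    have := hne t ht
    have h4 : w - t ≠ 0 := by rw [← neg_sub]; exact neg_ne_zero.2 this
    have h3 : (1 : ℂ) - t / w = (w - t) / w := by field_simp
    rw [h3]
    field_simp
    ring
  rw [intervalIntegral.integral_eq_sub_of_hasDerivAt key]
  · simp
  · refine ContinuousOn.intervalIntegrable ?_
    rw [uIcc_of_le hT]
    exact continuousOn_const.div (Complex.continuous_ofReal.sub continuous_const).continuousOn hne

/-- On `[0, T]` write `g t = (g t - g w) + g w`: the first part gives a difference quotient, the
second an explicit integral. All singular behaviour, both across the half-line and at its endpoint,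
sits in the logarithm. -/
theorem RayDecay.stieltjes_eq {g : ℂ → ℂ} (hg : RayDecay g) {T : ℝ} {w : ℂ}
    (hw : -w ∈ Complex.slitPlane) (hT : 0 ≤ T) :
    stieltjes 0 g w = regularPart g T w + g w * Complex.log (1 - T / w) := by
  obtain ⟨d, hd, h⟩ := exists_pos_le_norm_sub hw
  have hne : ∀ t : ℝ, 0 ≤ t → (t : ℂ) - w ≠ 0 := fun t ht =>
    norm_pos_iff.1 (lt_of_lt_of_le (by positivity) (h t ht))
  have hi := hg.integrableOn_div hw
  have h1 : stieltjes 0 g w = (∫ t in (0 : ℝ)..T, g t / (t - w)) + stieltjes T g w := by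
    unfold stieltjes
    rw [intervalIntegral.integral_of_le hT, ← setIntegral_union Ioc_disjoint_Ioi_same
      measurableSet_Ioi (hi.mono_set Ioc_subset_Ioi_self) (hi.mono_set (Ioi_subset_Ioi hT)),
      Ioc_union_Ioi_eq_Ioi hT]
  have hc : ContinuousOn (fun t : ℝ => 1 / ((t : ℂ) - w)) (uIcc 0 T) := by
    rw [uIcc_of_le hT]
    exact continuousOn_const.div (Complex.continuous_ofReal.sub continuous_const).continuousOn
      fun t ht => hne t ht.1
  have hc2 : Continuous fun t : ℝ => avgDeriv g t w :=
    (continuous_avgDeriv hg.diff).comp (f := fun t : ℝ => ((t : ℂ), w)) (by fun_prop)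
  have h2 : (∫ t in (0 : ℝ)..T, g t / (t - w)) =
      (∫ t in (0 : ℝ)..T, avgDeriv g t w) + g w * Complex.log (1 - T / w) := by
    rw [← integral_inv_sub hw hT, ← intervalIntegral.integral_const_mul,
      ← intervalIntegral.integral_add (hc2.intervalIntegrable _ _)
        (hc.intervalIntegrable.const_mul _)]
    refine intervalIntegral.integral_congr fun t ht => ?_
    rw [uIcc_of_le hT] at ht
    have h3 := hne t ht.1
    have h4 := mul_avgDeriv hg.diff t w
    field_simp
    linear_combination h4
  rw [h1, h2, regularPart]
  ring

/-! ### A bound at infinity that is uniform up to the half-line. -/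

theorem norm_log_sub_log_le {a b : ℂ} (h : ‖a‖ = ‖b‖) :
    ‖Complex.log a - Complex.log b‖ ≤ 2 * Real.pi := by
  have h1 : Complex.log a - Complex.log b = ((a.arg - b.arg : ℝ) : ℂ) * Complex.I := by
    rw [Complex.log, Complex.log, h]; push_cast; ring
  rw [h1, norm_mul, Complex.norm_I, mul_one, Complex.norm_real]
  refine (abs_sub _ _).trans ?_
  linarith [Complex.abs_arg_le_pi a, Complex.abs_arg_le_pi b]

/-- The endpoints are equidistant from `w`, so the real parts of the two logarithms cancel and only
a difference of arguments remains. The bound does not degenerate as `Im w → 0`. -/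
theorem norm_integral_inv_sub_symm_le {w : ℂ} (hw : w.im ≠ 0) :
    ‖∫ t in (w.re - 1)..(w.re + 1), 1 / ((t : ℂ) - w)‖ ≤ 2 * Real.pi := by
  have hsl : ∀ t : ℝ, (t : ℂ) - w ∈ Complex.slitPlane := fun t => Or.inr (by simpa using hw)
  have key : ∀ t ∈ uIcc (w.re - 1) (w.re + 1), HasDerivAt (fun t : ℝ => Complex.log (t - w))
      (1 / ((t : ℂ) - w)) t := fun t _ => by
    have h1 : HasDerivAt (fun t : ℝ => (t : ℂ) - w) 1 t :=
      (Complex.ofRealCLM.hasDerivAt (x := t)).sub_const w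
    exact h1.clog_real (hsl t)
  rw [intervalIntegral.integral_eq_sub_of_hasDerivAt key]
  · refine norm_log_sub_log_le ?_
    rw [← sq_eq_sq₀ (norm_nonneg _) (norm_nonneg _), ← Complex.normSq_eq_norm_sq,
      ← Complex.normSq_eq_norm_sq, Complex.normSq_apply, Complex.normSq_apply]
    simp
  · exact (continuous_const.div (Complex.continuous_ofReal.sub continuous_const)
      fun t => Complex.slitPlane_ne_zero (hsl t)).intervalIntegrable _ _

theorem norm_integral_div_le_of_one_le {g : ℂ → ℂ} (hg : RayDecay g) {s : Set ℝ} {w : ℂ}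
    (hs : s ⊆ Ioi 0) (hm : MeasurableSet s) (h : ∀ t ∈ s, 1 ≤ ‖(t : ℂ) - w‖) :
    ‖∫ t in s, g t / (t - w)‖ ≤ ∫ t in Ioi (0 : ℝ), ‖g t‖ := by
  refine (norm_integral_le_of_norm_le (hg.integrableOn.mono_set hs).norm ?_).trans
    (setIntegral_mono_set hg.integrableOn.norm (ae_of_all _ fun t => norm_nonneg _)
      (LE.le.eventuallyLE hs))
  refine (ae_restrict_iff' hm).2 (ae_of_all _ fun t ht => ?_)
  rw [norm_div]
  exact div_le_self (norm_nonneg _) (h t ht)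

/-- The normalization at infinity is uniform up to the contour, so the distance from `w` to the
half-line cannot be used. Near the half-line `g` is replaced by its value at `Re w` on a symmetric
unit window: the error is bounded by the supremum of `g'`, and the remaining kernel integral by
`2π`. -/
theorem RayDecay.exists_norm_stieltjes_le {g : ℂ → ℂ} (hg : RayDecay g) :
    ∃ C, ∀ w : ℂ, -w ∈ Complex.slitPlane → 2 ≤ ‖w‖ → ‖stieltjes 0 g w‖ ≤ C := by
  obtain ⟨M, hM⟩ := hg.bound_deriv 0
  obtain ⟨K, hK⟩ := hg.bound 0
  simp only [pow_zero, one_mul] at hM hK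
  have hM0 : 0 ≤ M := (norm_nonneg _).trans (hM 0 le_rfl)
  have hK0 : 0 ≤ K := (norm_nonneg _).trans (hK 0 le_rfl)
  set G := ∫ t in Ioi (0 : ℝ), ‖g t‖ with hG
  have hG0 : 0 ≤ G := integral_nonneg fun t => norm_nonneg _
  refine ⟨G + (M * 2 + K * (2 * Real.pi)) + G, fun w hw hw2 => ?_⟩
  have hpi := Real.pi_pos
  -- If `Re w < 1` and `‖w‖ ≥ 2`, then `|Im w| ≥ 1` or `Re w ≤ -1`, so `w` is at distance at least
  -- `1` from the half-line. If `Re w ≥ 1`, the window `[Re w - 1, Re w + 1]` stays inside `[0, ∞)`.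
  rcases lt_or_ge w.re 1 with hre | hre
  · have : ‖stieltjes 0 g w‖ ≤ G := by
      refine norm_integral_div_le_of_one_le hg subset_rfl measurableSet_Ioi fun t ht => ?_
      rcases le_or_gt 1 |w.im| with h1 | h1
      · refine h1.trans ?_
        have := Complex.abs_im_le_norm ((t : ℂ) - w)
        simpa using this
      · have h2 : w.re ≤ -1 := by
          by_contra! h3
          have h4 : |w.re| < 1 := abs_lt.2 ⟨h3, hre⟩
          have := Complex.norm_le_abs_re_add_abs_im w
          linarith
        have h3 := Complex.abs_re_le_norm ((t : ℂ) - w)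
        have h4 := le_abs_self ((t : ℂ) - w).re
        simp only [Complex.sub_re, Complex.ofReal_re] at h3 h4
        have : (0 : ℝ) < t := ht
        linarith
    have h5 : 0 ≤ M * 2 + K * (2 * Real.pi) := by positivity
    linarith
  · set u := w.re with hu
    have him : w.im ≠ 0 := by
      rcases hw with h | h
      · rw [Complex.neg_re] at h; linarith
      · simpa using h
    have hfar : ∀ t : ℝ, 1 ≤ |t - u| → 1 ≤ ‖(t : ℂ) - w‖ := fun t ht => by
      have h3 := Complex.abs_re_le_norm ((t : ℂ) - w)
      simp only [Complex.sub_re, Complex.ofReal_re] at h3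
      exact ht.trans h3
    have hi := hg.integrableOn_div hw
    have hsplit : stieltjes 0 g w = (∫ t in Ioc 0 (u - 1), g t / (t - w)) +
        (∫ t in (u - 1)..(u + 1), g t / (t - w)) + ∫ t in Ioi (u + 1), g t / (t - w) := by
      have hle : u - 1 ≤ u + 1 := by linarith
      have h0 : (0 : ℝ) ≤ u - 1 := by linarith
      have h0' : (0 : ℝ) ≤ u + 1 := by linarith
      rw [intervalIntegral.integral_of_le hle, ← setIntegral_union (Ioc_disjoint_Ioc_of_le le_rfl)
        measurableSet_Ioc (hi.mono_set Ioc_subset_Ioi_self)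
        (hi.mono_set (Ioc_subset_Ioi_self.trans (Ioi_subset_Ioi h0))),
        Ioc_union_Ioc_eq_Ioc h0 hle, ← setIntegral_union Ioc_disjoint_Ioi_same
        measurableSet_Ioi (hi.mono_set Ioc_subset_Ioi_self) (hi.mono_set (Ioi_subset_Ioi h0')),
        Ioc_union_Ioi_eq_Ioi h0']
      rfl
    have hne : ∀ t : ℝ, (t : ℂ) - w ≠ 0 := fun t h => him (by
      have := congrArg Complex.im h; simpa using this)
    have hmid : ‖∫ t in (u - 1)..(u + 1), g t / (t - w)‖ ≤ M * 2 + K * (2 * Real.pi) := by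
      have hc1 : Continuous fun t : ℝ => (g t - g u) / ((t : ℂ) - w) :=
        (hg.continuous_ofReal.sub continuous_const).div
          (Complex.continuous_ofReal.sub continuous_const) hne
      have hc2 : Continuous fun t : ℝ => 1 / ((t : ℂ) - w) :=
        continuous_const.div (Complex.continuous_ofReal.sub continuous_const) hne
      have heq : (∫ t in (u - 1)..(u + 1), g t / (t - w)) =
          (∫ t in (u - 1)..(u + 1), (g t - g u) / ((t : ℂ) - w)) +
            g u * ∫ t in (u - 1)..(u + 1), 1 / ((t : ℂ) - w) := by
        rw [← intervalIntegral.integral_const_mul, ← intervalIntegral.integral_add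
          (hc1.intervalIntegrable _ _) ((hc2.intervalIntegrable _ _).const_mul _)]
        refine intervalIntegral.integral_congr fun t _ => ?_
        ring
      rw [heq]
      refine (norm_add_le _ _).trans (add_le_add ?_ ?_)
      · have := intervalIntegral.norm_integral_le_of_norm_le_const (a := u - 1) (b := u + 1)
          (f := fun t : ℝ => (g t - g u) / ((t : ℂ) - w)) (C := M) ?_
        · rwa [show u + 1 - (u - 1) = 2 by ring, abs_of_pos (by norm_num)] at this
        · intro t ht
          rw [uIoc_of_le (by linarith)] at ht
          have h0 : 0 ≤ t := by linarith [ht.1]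
          rw [norm_div, div_le_iff₀ (norm_pos_iff.2 (hne t))]
          have h1 : ‖(t : ℝ) - u‖ ≤ ‖(t : ℂ) - w‖ := by
            have h3 := Complex.abs_re_le_norm ((t : ℂ) - w)
            simpa using h3
          refine le_trans ?_ (mul_le_mul_of_nonneg_left h1 hM0)
          exact (convex_Ici (0 : ℝ)).norm_image_sub_le_of_norm_hasDerivWithin_le
            (f := fun t : ℝ => g t) (f' := fun t : ℝ => deriv g t)
            (fun x _ => ((hg.diff x).hasDerivAt.comp_ofReal).hasDerivWithinAt)
            (fun x hx => hM x hx) (show (u : ℝ) ∈ Ici 0 by rw [mem_Ici]; linarith) h0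
      · rw [norm_mul]
        exact mul_le_mul (hK u (by linarith)) (norm_integral_inv_sub_symm_le him) (norm_nonneg _)
          hK0
    rw [hsplit]
    refine (norm_add_le _ _).trans (add_le_add ((norm_add_le _ _).trans (add_le_add ?_ hmid)) ?_)
    · refine norm_integral_div_le_of_one_le hg Ioc_subset_Ioi_self measurableSet_Ioc
        fun t ht => hfar t ?_
      rw [abs_sub_comm]
      exact le_trans (by linarith [ht.2]) (le_abs_self _)
    · refine norm_integral_div_le_of_one_le hg (Ioi_subset_Ioi (by linarith)) measurableSet_Ioi
        fun t ht => hfar t ?_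
      have : u + 1 < t := ht
      exact le_trans (by linarith) (le_abs_self _)

/-! ### Geometry of the contour -/

theorem isPrimitiveRoot_omega {D : ℕ} (hD : 0 < D) : IsPrimitiveRoot (omega D) D :=
  Complex.isPrimitiveRoot_exp D hD.ne'

theorem norm_omega {D : ℕ} (hD : 0 < D) : ‖omega D‖ = 1 :=
  Complex.norm_eq_one_of_pow_eq_one (isPrimitiveRoot_omega hD).pow_eq_one hD.ne'

theorem norm_omega_pow {D : ℕ} (hD : 0 < D) (k : ℕ) : ‖omega D ^ k‖ = 1 := by
  rw [norm_pow, norm_omega hD, one_pow]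

theorem omega_pow_ne_zero (D k : ℕ) : omega D ^ k ≠ 0 := pow_ne_zero _ (Complex.exp_ne_zero _)

theorem omega_pow_half {D : ℕ} (hD : 0 < D) (he : Even D) : omega D ^ (D / 2) = -1 := by
  obtain ⟨m, rfl⟩ := he
  have hm : (m : ℂ) ≠ 0 := by
    rw [Nat.cast_ne_zero]; omega
  rw [show (m + m) / 2 = m by omega, omega, ← Complex.exp_nat_mul]
  rw [← Complex.exp_pi_mul_I]
  congr 1
  push_cast
  field_simp
  ring

theorem mem_ray_iff {D k : ℕ} {z : ℂ} :
    z ∈ ray D k ↔ 0 ≤ (z / omega D ^ k).re ∧ (z / omega D ^ k).im = 0 := by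
  have h0 := omega_pow_ne_zero D k
  constructor
  · rintro ⟨t, ht, rfl⟩
    rw [mul_div_cancel_left₀ _ h0]
    exact ⟨ht, rfl⟩
  · rintro ⟨h1, h2⟩
    refine ⟨_, h1, ?_⟩
    have : ((z / omega D ^ k).re : ℂ) = z / omega D ^ k := Complex.ext rfl (by simp [h2])
    rw [this]
    field_simp

theorem notMem_ray_iff {D k : ℕ} {z : ℂ} :
    z ∉ ray D k ↔ -(z / omega D ^ k) ∈ Complex.slitPlane := by
  rw [mem_ray_iff, Complex.mem_slitPlane_iff, Complex.neg_re, Complex.neg_im, not_and_or, not_le,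
    Left.neg_pos_iff, neg_ne_zero]

theorem zero_mem_ray (D k : ℕ) : (0 : ℂ) ∈ ray D k := ⟨0, le_rfl, by simp⟩

theorem isClosed_ray (D k : ℕ) : IsClosed (ray D k) := by
  have : ray D k = (fun z : ℂ => (z / omega D ^ k).re) ⁻¹' Ici 0 ∩
      (fun z : ℂ => (z / omega D ^ k).im) ⁻¹' {0} := by
    ext z; exact mem_ray_iff
  rw [this]
  exact (isClosed_Ici.preimage (by fun_prop)).inter (isClosed_singleton.preimage (by fun_prop))

theorem isClosed_torus : IsClosed torus := isClosed_eq continuous_norm continuous_const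

theorem mem_Sig_iff {D : ℕ} (hD : 2 ≤ D) {z : ℂ} :
    z ∈ Sig D ↔ z ∈ torus ∨ ∃ k < D, z ∈ ray D k := by
  simp only [Sig, Gam, mem_union, mem_iUnion, Finset.mem_Icc, exists_prop]
  refine or_congr_right ⟨?_, ?_⟩
  · rintro ⟨k, hk, h | h⟩
    · exact ⟨0, by omega, h⟩
    · exact ⟨k, by omega, h⟩
  · rintro ⟨k, hk, h⟩
    rcases Nat.eq_zero_or_pos k with rfl | hk0
    · exact ⟨1, by omega, Or.inl h⟩
    · exact ⟨k, by omega, Or.inr h⟩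

theorem isClosed_iUnion_ray (D : ℕ) (s : Set ℕ) (hs : s.Finite) :
    IsClosed (⋃ k ∈ s, ray D k) := hs.isClosed_biUnion fun k _ => isClosed_ray D k

theorem Sig_eq {D : ℕ} (hD : 2 ≤ D) : Sig D = torus ∪ ⋃ k ∈ {k | k < D}, ray D k := by
  ext z
  simp [mem_Sig_iff hD]

theorem isClosed_Sig {D : ℕ} (hD : 2 ≤ D) : IsClosed (Sig D) := by
  rw [Sig_eq hD]
  exact isClosed_torus.union (isClosed_iUnion_ray D _ (finite_lt_nat D))

theorem zero_mem_Sig {D : ℕ} (hD : 2 ≤ D) : (0 : ℂ) ∈ Sig D :=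
  (mem_Sig_iff hD).2 (Or.inr ⟨0, by omega, zero_mem_ray D 0⟩)

theorem finite_selfInt (D : ℕ) : (selfInt D).Finite := by
  have : selfInt D ⊆ insert 0 ((fun k => omega D ^ k) '' {k | k < D}) := by
    rintro z (rfl | ⟨k, hk, rfl⟩)
    · exact mem_insert _ _
    · exact mem_insert_of_mem _ ⟨k, hk, rfl⟩
  exact (((finite_lt_nat D).image _).insert 0).subset this

theorem zero_mem_selfInt (D : ℕ) : (0 : ℂ) ∈ selfInt D := Or.inl rfl

theorem selfInt_subset {D : ℕ} (hD : 2 ≤ D) : selfInt D ⊆ Sig D := by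
  rintro z (rfl | ⟨k, hk, rfl⟩)
  · exact zero_mem_Sig hD
  · exact (mem_Sig_iff hD).2 (Or.inl (norm_omega_pow (by omega) k))

theorem ray_inter {D j k : ℕ} {z : ℂ} (hj : j < D) (hk : k < D) (h : j ≠ k) (h1 : z ∈ ray D j)
    (h2 : z ∈ ray D k) : z = 0 := by
  have hD : 0 < D := by omega
  obtain ⟨s, hs, rfl⟩ := h1
  obtain ⟨t, ht, h2⟩ := h2
  have h3 : s = t := by
    have := congrArg norm h2
    rwa [norm_mul, norm_mul, norm_omega_pow hD, norm_omega_pow hD, one_mul, one_mul,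
      Complex.norm_of_nonneg hs, Complex.norm_of_nonneg ht] at this
  subst h3
  by_contra hne
  have hs0 : (s : ℂ) ≠ 0 := right_ne_zero_of_mul hne
  exact h ((isPrimitiveRoot_omega hD).pow_inj hj hk (mul_right_cancel₀ hs0 h2))

theorem torus_inter_ray {D k : ℕ} {z : ℂ} (hk : k < D) (h1 : z ∈ torus) (h2 : z ∈ ray D k) :
    z ∈ selfInt D := by
  obtain ⟨t, ht, rfl⟩ := h2
  have h3 : ‖omega D ^ k * t‖ = 1 := h1
  rw [norm_mul, norm_omega_pow (by omega), one_mul, Complex.norm_of_nonneg ht] at h3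
  exact Or.inr ⟨k, hk, by rw [h3, Complex.ofReal_one, mul_one]⟩

theorem notMem_ray_of_ne {D j k : ℕ} {z : ℂ} (hj : j < D) (hk : k < D) (h : k ≠ j)
    (hz : z ∉ selfInt D) (h1 : z ∈ ray D j) : z ∉ ray D k := fun h2 =>
  hz ((ray_inter hk hj h h2 h1) ▸ zero_mem_selfInt D)

/-- Off `S` the point lies on no other piece of `Σ`, and the finite union of the other pieces is
closed. -/
theorem eventually_mem_ray {D k : ℕ} {x : ℂ} (hD : 2 ≤ D) (hk : k < D) (hx : x ∈ ray D k)
    (hS : x ∉ selfInt D) : ∀ᶠ z in 𝓝 x, z ∈ Sig D → z ∈ ray D k := by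
  have h1 : x ∈ (torus ∪ ⋃ j ∈ {j | j < D ∧ j ≠ k}, ray D j)ᶜ := by
    rintro (h | h)
    · exact hS (torus_inter_ray hk h hx)
    · simp only [mem_ofPred_eq, mem_iUnion, exists_prop] at h
      obtain ⟨j, ⟨hj, hjk⟩, h⟩ := h
      exact notMem_ray_of_ne hk hj hjk hS hx h
  have h2 : IsClosed (torus ∪ ⋃ j ∈ {j | j < D ∧ j ≠ k}, ray D j) :=
    isClosed_torus.union (isClosed_iUnion_ray D _ ((finite_lt_nat D).subset fun j hj => hj.1))
  filter_upwards [h2.isOpen_compl.mem_nhds h1] with z hz hzS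
  rcases (mem_Sig_iff hD).1 hzS with h | ⟨j, hj, h⟩
  · exact absurd (Or.inl h) hz
  · by_cases hjk : j = k
    · exact hjk ▸ h
    · refine absurd (Or.inr ?_) hz
      simp only [mem_iUnion, exists_prop]
      exact ⟨j, ⟨hj, hjk⟩, h⟩

theorem eventually_mem_torus {D : ℕ} {x : ℂ} (hD : 2 ≤ D) (hx : x ∈ torus)
    (hS : x ∉ selfInt D) : ∀ᶠ z in 𝓝 x, z ∈ Sig D → z ∈ torus := by
  have h1 : x ∈ (⋃ j ∈ {j | j < D}, ray D j)ᶜ := by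
    intro h
    simp only [mem_ofPred_eq, mem_iUnion, exists_prop] at h
    obtain ⟨j, hj, h⟩ := h
    exact hS (torus_inter_ray hj hx h)
  filter_upwards [(isClosed_iUnion_ray D _ (finite_lt_nat D)).isOpen_compl.mem_nhds h1] with z hz hzS
  rcases (mem_Sig_iff hD).1 hzS with h | ⟨j, hj, h⟩
  · exact h
  · refine absurd ?_ hz
    simp only [mem_iUnion, exists_prop]
    exact ⟨j, hj, h⟩

/-- Away from `S` only one clause in the definition of the sides can apply; the next two lemmas
treat the rays in the same way. -/
theorem leftSide_of_mem_torus {D : ℕ} {x : ℂ} (hx : x ∈ torus) (hS : x ∉ selfInt D) (hD : 2 ≤ D) :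
    leftSide D x = {z | ‖z‖ < 1} ∧ rightSide D x = {z | 1 < ‖z‖} := by
  have h : ∀ k < D, x ∉ ray D k := fun k hk h => hS (torus_inter_ray hk hx h)
  have h0 := h 0 (by omega)
  have hk : ∀ k ∈ Finset.Icc 1 (D - 1), x ∉ ray D k := fun k hk =>
    h k (by rw [Finset.mem_Icc] at hk; omega)
  constructor <;> ext z <;> simp only [leftSide, rightSide, mem_ofPred_eq, hx, h0, true_and,
    false_and, false_or]
  · exact or_iff_left fun ⟨k, hk', h, _⟩ => hk k hk' h
  · exact or_iff_left fun ⟨k, hk', h, _⟩ => hk k hk' h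

theorem leftSide_of_mem_ray_zero {D : ℕ} {x : ℂ} (hx : x ∈ ray D 0) (hS : x ∉ selfInt D)
    (hD : 2 ≤ D) : leftSide D x = {z | 0 < z.im} ∧ rightSide D x = {z | z.im < 0} := by
  have h0 : x ∉ torus := fun h => hS (torus_inter_ray (by omega) h hx)
  have hk : ∀ k ∈ Finset.Icc 1 (D - 1), x ∉ ray D k := fun k hk => by
    rw [Finset.mem_Icc] at hk
    exact notMem_ray_of_ne (by omega) (by omega) (by omega) hS hx
  constructor <;> ext z <;> simp only [leftSide, rightSide, mem_ofPred_eq, hx, h0, true_and,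
    false_and, false_or]
  · exact or_iff_left fun ⟨k, hk', h, _⟩ => hk k hk' h
  · exact or_iff_left fun ⟨k, hk', h, _⟩ => hk k hk' h

theorem leftSide_of_mem_ray {D k : ℕ} {x : ℂ} (hx : x ∈ ray D k) (hS : x ∉ selfInt D)
    (hk0 : k ≠ 0) (hk : k < D) : leftSide D x = {z | (z / omega D ^ k).im < 0} ∧
      rightSide D x = {z | 0 < (z / omega D ^ k).im} := by
  have h0 : x ∉ torus := fun h => hS (torus_inter_ray hk h hx)
  have h1 : x ∉ ray D 0 := notMem_ray_of_ne hk (by omega) (by omega) hS hx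
  have hj : ∀ j ∈ Finset.Icc 1 (D - 1), x ∈ ray D j → j = k := fun j hj h => by
    rw [Finset.mem_Icc] at hj
    by_contra hne
    exact notMem_ray_of_ne hk (by omega) hne hS hx h
  have hkm : k ∈ Finset.Icc 1 (D - 1) := by rw [Finset.mem_Icc]; omega
  constructor <;> ext z <;> simp only [leftSide, rightSide, mem_ofPred_eq, h0, h1,
    false_and, false_or]
  · refine ⟨?_, fun h => ⟨k, hkm, hx, h⟩⟩
    rintro ⟨j, hj', h, h2⟩
    rwa [← hj j hj' h]
  · refine ⟨?_, fun h => ⟨k, hkm, hx, h⟩⟩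
    rintro ⟨j, hj', h, h2⟩
    rwa [← hj j hj' h]

theorem volume_Sig {D : ℕ} (hD : 2 ≤ D) : volume (Sig D) = 0 := by
  rw [Sig_eq hD]
  refine measure_union_null ?_ ((measure_biUnion_null_iff (finite_lt_nat D).countable).2 ?_)
  · have : torus = Metric.sphere (0 : ℂ) 1 := by ext z; simp [torus]
    rw [this]
    exact Measure.addHaar_sphere _ _ _
  · intro k _
    have h1 : (ray D k) ⊆ (Submodule.span ℝ {omega D ^ k} : Submodule ℝ ℂ) := by
      rintro _ ⟨t, _, rfl⟩
      rw [SetLike.mem_coe, Submodule.mem_span_singleton]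
      exact ⟨t, by rw [Complex.real_smul, mul_comm]⟩
    refine measure_mono_null h1 (Measure.addHaar_submodule _ _ fun h => ?_)
    have h2 := finrank_span_singleton (K := ℝ) (omega_pow_ne_zero D k)
    rw [h, finrank_top, Complex.finrank_real_complex] at h2
    norm_num at h2

/-- A null set has dense complement. Density later transfers estimates known only off `Σ` to
continuous extensions. -/
theorem dense_compl_Sig {D : ℕ} (hD : 2 ≤ D) : Dense (Sig D)ᶜ := by
  refine Measure.dense_of_ae (μ := volume) ?_
  rw [ae_iff]
  simpa using volume_Sig hD

/-- Neighbourhoods of infinity in `ℂ \ Σ`. -/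
abbrev farOff (D : ℕ) : Filter ℂ := Bornology.cobounded ℂ ⊓ 𝓟 (Sig D)ᶜ

theorem farOff_neBot {D : ℕ} (hD : 2 ≤ D) : (farOff D).NeBot := by
  rw [farOff, Filter.inf_principal_neBot_iff]
  intro U hU
  obtain ⟨r, -, hr⟩ := (Filter.hasBasis_cobounded_norm (E := ℂ)).mem_iff.1 hU
  have h1 : IsOpen {z : ℂ | r < ‖z‖} := isOpen_lt continuous_const continuous_norm
  have h2 : {z : ℂ | r < ‖z‖}.Nonempty := by
    refine ⟨((|r| + 1 : ℝ) : ℂ), ?_⟩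
    rw [mem_ofPred_eq, Complex.norm_of_nonneg (by positivity)]
    linarith [le_abs_self r]
  obtain ⟨z, hz, hz'⟩ := (dense_compl_Sig hD).inter_open_nonempty _ h1 h2
  exact ⟨z, hr (show r ≤ ‖z‖ from le_of_lt hz), hz'⟩

/-! ### Scalar jump problems -/

/-- `f` has continuous boundary values on `Σ \ S`, with jump `w` across `Σ`. -/
def HasJump (D : ℕ) (f w : ℂ → ℂ) : Prop :=
  ∃ fp fm : ℂ → ℂ, ContinuousOn fp (Sig D \ selfInt D) ∧ ContinuousOn fm (Sig D \ selfInt D) ∧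
    ∀ x ∈ Sig D \ selfInt D,
      Tendsto f (𝓝[(Sig D)ᶜ ∩ leftSide D x] x) (𝓝 (fp x)) ∧
      Tendsto f (𝓝[(Sig D)ᶜ ∩ rightSide D x] x) (𝓝 (fm x)) ∧ fp x = fm x + w x

/-- `f` is bounded near the self-intersection points of `Σ`. -/
def BoundedNear (D : ℕ) (f : ℂ → ℂ) : Prop :=
  ∀ s ∈ selfInt D, ∃ M : ℝ, ∀ᶠ z in 𝓝[(Sig D)ᶜ] s, ‖f z‖ ≤ M

theorem HasJump.congr {D : ℕ} {f g w v : ℂ → ℂ} (hf : HasJump D f w) (h : EqOn f g (Sig D)ᶜ)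
    (hw : EqOn w v (Sig D \ selfInt D)) : HasJump D g v := by
  obtain ⟨fp, fm, h1, h2, h3⟩ := hf
  refine ⟨fp, fm, h1, h2, fun x hx => ?_⟩
  obtain ⟨h4, h5, h6⟩ := h3 x hx
  refine ⟨h4.congr' ?_, h5.congr' ?_, by rw [h6, hw hx]⟩
  · filter_upwards [self_mem_nhdsWithin] with z hz using h hz.1
  · filter_upwards [self_mem_nhdsWithin] with z hz using h hz.1

theorem HasJump.add {D : ℕ} {f g w v : ℂ → ℂ} (hf : HasJump D f w) (hg : HasJump D g v) :
    HasJump D (fun z => f z + g z) fun z => w z + v z := by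
  obtain ⟨fp, fm, h1, h2, h3⟩ := hf
  obtain ⟨gp, gm, h1', h2', h3'⟩ := hg
  refine ⟨fun z => fp z + gp z, fun z => fm z + gm z, h1.add h1', h2.add h2', fun x hx => ?_⟩
  obtain ⟨h4, h5, h6⟩ := h3 x hx
  obtain ⟨h4', h5', h6'⟩ := h3' x hx
  exact ⟨h4.add h4', h5.add h5', by simp only [h6, h6']; ring⟩

theorem HasJump.const_mul {D : ℕ} {f w : ℂ → ℂ} (hf : HasJump D f w) (c : ℂ) :
    HasJump D (fun z => c * f z) fun z => c * w z := by
  obtain ⟨fp, fm, h1, h2, h3⟩ := hf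
  refine ⟨fun z => c * fp z, fun z => c * fm z, continuousOn_const.mul h1,
    continuousOn_const.mul h2, fun x hx => ?_⟩
  obtain ⟨h4, h5, h6⟩ := h3 x hx
  exact ⟨h4.const_mul c, h5.const_mul c, by simp only [h6]; ring⟩

theorem HasJump.sub {D : ℕ} {f g w v : ℂ → ℂ} (hf : HasJump D f w) (hg : HasJump D g v) :
    HasJump D (fun z => f z - g z) fun z => w z - v z := by
  refine (hf.add (hg.const_mul (-1))).congr (fun z _ => ?_) fun z _ => ?_ <;> ring

theorem Continuous.hasJump {f : ℂ → ℂ} (hf : Continuous f) (D : ℕ) : HasJump D f fun _ => 0 :=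
  ⟨f, f, hf.continuousOn, hf.continuousOn, fun _ _ => ⟨hf.continuousAt.mono_left nhdsWithin_le_nhds,
    hf.continuousAt.mono_left nhdsWithin_le_nhds, (add_zero _).symm⟩⟩

theorem hasJump_sum {D : ℕ} {ι : Type*} (s : Finset ι) {f w : ι → ℂ → ℂ}
    (h : ∀ i ∈ s, HasJump D (f i) (w i)) :
    HasJump D (fun z => ∑ i ∈ s, f i z) fun z => ∑ i ∈ s, w i z := by
  classical
  induction s using Finset.induction_on with
  | empty => simpa using Continuous.hasJump continuous_const D (f := fun _ => 0)
  | insert i s hi ih =>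
    simp only [Finset.sum_insert hi]
    exact (h i (Finset.mem_insert_self i s)).add
      (ih fun j hj => h j (Finset.mem_insert_of_mem hj))

theorem BoundedNear.congr {D : ℕ} {f g : ℂ → ℂ} (hf : BoundedNear D f)
    (h : EqOn f g (Sig D)ᶜ) : BoundedNear D g := fun s hs => by
  obtain ⟨M, hM⟩ := hf s hs
  refine ⟨M, ?_⟩
  filter_upwards [hM, self_mem_nhdsWithin] with z hz hz'
  rwa [← h hz']

theorem BoundedNear.add {D : ℕ} {f g : ℂ → ℂ} (hf : BoundedNear D f) (hg : BoundedNear D g) :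
    BoundedNear D fun z => f z + g z := fun s hs => by
  obtain ⟨M, hM⟩ := hf s hs
  obtain ⟨N, hN⟩ := hg s hs
  refine ⟨M + N, ?_⟩
  filter_upwards [hM, hN] with z h1 h2 using (norm_add_le _ _).trans (add_le_add h1 h2)

theorem BoundedNear.const_mul {D : ℕ} {f : ℂ → ℂ} (hf : BoundedNear D f) (c : ℂ) :
    BoundedNear D fun z => c * f z := fun s hs => by
  obtain ⟨M, hM⟩ := hf s hs
  refine ⟨‖c‖ * M, ?_⟩
  filter_upwards [hM] with z h1
  rw [norm_mul]
  gcongr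

theorem BoundedNear.sub {D : ℕ} {f g : ℂ → ℂ} (hf : BoundedNear D f) (hg : BoundedNear D g) :
    BoundedNear D fun z => f z - g z :=
  (hf.add (hg.const_mul (-1))).congr fun z _ => by ring

theorem ContinuousAt.exists_eventually_norm_le {f : ℂ → ℂ} {s : ℂ} (hf : ContinuousAt f s)
    (t : Set ℂ) : ∃ M : ℝ, ∀ᶠ z in 𝓝[t] s, ‖f z‖ ≤ M :=
  ⟨‖f s‖ + 1, ((hf.norm.tendsto.mono_left nhdsWithin_le_nhds).eventually_le_const
    (lt_add_one _))⟩

theorem Continuous.boundedNear {f : ℂ → ℂ} (hf : Continuous f) (D : ℕ) : BoundedNear D f :=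
  fun _ _ => ContinuousAt.exists_eventually_norm_le hf.continuousAt _

theorem boundedNear_sum {D : ℕ} {ι : Type*} (s : Finset ι) {f : ι → ℂ → ℂ}
    (h : ∀ i ∈ s, BoundedNear D (f i)) : BoundedNear D fun z => ∑ i ∈ s, f i z := by
  classical
  induction s using Finset.induction_on with
  | empty => simpa using Continuous.boundedNear continuous_const D (f := fun _ => 0)
  | insert i s hi ih =>
    simp only [Finset.sum_insert hi]
    exact (h i (Finset.mem_insert_self i s)).add
      (ih fun j hj => h j (Finset.mem_insert_of_mem hj))

/-! ### Boundary values on the half-line -/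

/-- `∫_0^∞ g(t) / (t - w) dt ∓ πi g(w)` in `|w| < T`, above and below the positive half-line. -/
def principalPart (g : ℂ → ℂ) (T : ℝ) (w : ℂ) : ℂ :=
  regularPart g T w + g w * Complex.log (T / w - 1)

/-- For `0 < x < T` the number `T / x - 1` is positive, where the principal logarithm is continuous,
whereas `1 - T / x` lies on the cut. This is the reason for changing the sign inside the logarithm.
-/
theorem RayDecay.continuousAt_principalPart {g : ℂ → ℂ} (hg : RayDecay g) {T : ℝ} {x : ℂ}
    (hx : 0 < x.re) (hx' : x.im = 0) (hT : ‖x‖ < T) : ContinuousAt (principalPart g T) x := by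
  have hx0 : x ≠ 0 := by rintro rfl; simp at hx
  have hxr : (x.re : ℂ) = x := Complex.ext rfl (by simp [hx'])
  refine (hg.continuousAt_regularPart hT).add ((hg.diff x).continuousAt.mul ?_)
  refine ((continuousAt_const.div continuousAt_id hx0).sub continuousAt_const).clog ?_
  have h1 : x.re < T := by rwa [← hxr, Complex.norm_of_nonneg hx.le] at hT
  have h2 : (T : ℂ) / id x - 1 = ((T / x.re - 1 : ℝ) : ℂ) := by push_cast; rw [hxr]; rfl
  change (T : ℂ) / id x - 1 ∈ _
  rw [h2, Complex.ofReal_mem_slitPlane, sub_pos, one_lt_div hx]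
  exact h1

theorem log_neg_of_im_neg {u : ℂ} (hu : u.im < 0) :
    Complex.log (-u) = Complex.log u + Real.pi * Complex.I := by
  rw [Complex.log, Complex.log, norm_neg, Complex.arg_neg_eq_arg_add_pi_of_im_neg hu]
  push_cast
  ring

theorem log_neg_of_im_pos {u : ℂ} (hu : 0 < u.im) :
    Complex.log (-u) = Complex.log u - Real.pi * Complex.I := by
  rw [Complex.log, Complex.log, norm_neg, Complex.arg_neg_eq_arg_sub_pi_of_im_pos hu]
  push_cast
  ring

theorem div_sub_one_im (T : ℝ) (w : ℂ) : ((T : ℂ) / w - 1).im = -(T * w.im / Complex.normSq w) := by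
  simp [Complex.div_im]

/-- Inversion sends the upper half-plane to the lower one, so `u = T / w - 1` has negative imaginary
part and `log (-u) = log u + πi`. With its mirror image below, this is the Sokhotski–Plemelj
formula. -/
theorem RayDecay.stieltjes_of_im_pos {g : ℂ → ℂ} (hg : RayDecay g) {T : ℝ} (hT : 0 < T) {w : ℂ}
    (hw : 0 < w.im) :
    stieltjes 0 g w = principalPart g T w + Real.pi * Complex.I * g w := by
  have hw0 : w ≠ 0 := by rintro rfl; simp at hw
  have h1 : ((T : ℂ) / w - 1).im < 0 := by
    rw [div_sub_one_im, Left.neg_neg_iff]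
    have := Complex.normSq_pos.2 hw0
    positivity
  rw [hg.stieltjes_eq (Or.inr (by simpa using hw.ne')) hT.le, principalPart,
    ← neg_sub (T / w : ℂ), log_neg_of_im_neg h1]
  ring

theorem RayDecay.stieltjes_of_im_neg {g : ℂ → ℂ} (hg : RayDecay g) {T : ℝ} (hT : 0 < T) {w : ℂ}
    (hw : w.im < 0) :
    stieltjes 0 g w = principalPart g T w - Real.pi * Complex.I * g w := by
  have hw0 : w ≠ 0 := by rintro rfl; simp at hw
  have h1 : 0 < ((T : ℂ) / w - 1).im := by
    rw [div_sub_one_im, ← neg_div, ← mul_neg]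
    have := Complex.normSq_pos.2 hw0
    have h2 : 0 < -w.im := by linarith
    positivity
  rw [hg.stieltjes_eq (Or.inr (by simpa using hw.ne)) hT.le, principalPart,
    ← neg_sub (T / w : ℂ), log_neg_of_im_pos h1]
  ring

theorem neBot_nhdsWithin_upper {x : ℂ} (hx : x.im = 0) : (𝓝[{z : ℂ | 0 < z.im}] x).NeBot := by
  rw [← mem_closure_iff_nhdsWithin_neBot, Complex.closure_setOfPred_lt_im]
  exact hx.ge

/-- The open positive half-line. -/
def posHalfLine : Set ℂ := {x | 0 < x.re ∧ x.im = 0}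

/-- Above the half-line both functions equal `stieltjes 0 g - πi g`, which does not involve the
cutoff, and both are continuous at `x`. -/
theorem RayDecay.principalPart_eq {g : ℂ → ℂ} (hg : RayDecay g) {x : ℂ} (hx : x ∈ posHalfLine)
    {T T' : ℝ} (hT : ‖x‖ < T) (hT' : ‖x‖ < T') : principalPart g T x = principalPart g T' x := by
  have := neBot_nhdsWithin_upper hx.2
  have h1 := (hg.continuousAt_principalPart hx.1 hx.2 hT).tendsto.mono_left
    (nhdsWithin_le_nhds (s := {z : ℂ | 0 < z.im}))
  have h2 := (hg.continuousAt_principalPart hx.1 hx.2 hT').tendsto.mono_left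
    (nhdsWithin_le_nhds (s := {z : ℂ | 0 < z.im}))
  refine tendsto_nhds_unique h1 (h2.congr' ?_)
  filter_upwards [self_mem_nhdsWithin] with z hz
  have h3 := hg.stieltjes_of_im_pos ((norm_nonneg x).trans_lt hT) hz
  have h4 := hg.stieltjes_of_im_pos ((norm_nonneg x).trans_lt hT') hz
  exact add_right_cancel (h4.symm.trans h3)

/-- The Cauchy principal value of `∫_0^∞ g(t) / (t - x) dt`. -/
def principalValue (g : ℂ → ℂ) (x : ℂ) : ℂ := principalPart g (‖x‖ + 1) x

theorem RayDecay.continuousOn_principalValue {g : ℂ → ℂ} (hg : RayDecay g) :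
    ContinuousOn (principalValue g) posHalfLine := by
  intro x hx
  have h1 := (hg.continuousAt_principalPart hx.1 hx.2 (lt_add_one ‖x‖)).continuousWithinAt
    (s := posHalfLine)
  -- The cutoff `‖x‖ + 1` moves with the point; it is frozen near `x` by independence of the cutoff.
  refine h1.congr_of_eventuallyEq ?_ rfl
  have h2 : ∀ᶠ z in 𝓝 x, ‖z‖ < ‖x‖ + 1 := continuous_norm.continuousAt.eventually_lt_const (lt_add_one _)
  filter_upwards [self_mem_nhdsWithin, nhdsWithin_le_nhds h2] with z hz hz2
  exact hg.principalPart_eq hz (lt_add_one _) hz2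

theorem RayDecay.tendsto_stieltjes_upper {g : ℂ → ℂ} (hg : RayDecay g) {x : ℂ}
    (hx : x ∈ posHalfLine) : Tendsto (stieltjes 0 g) (𝓝[{z : ℂ | 0 < z.im}] x)
      (𝓝 (principalValue g x + Real.pi * Complex.I * g x)) := by
  have h1 : ContinuousAt (fun z => principalPart g (‖x‖ + 1) z + Real.pi * Complex.I * g z) x :=
    (hg.continuousAt_principalPart hx.1 hx.2 (lt_add_one ‖x‖)).add
      (continuousAt_const.mul (hg.diff x).continuousAt)
  refine (h1.tendsto.mono_left nhdsWithin_le_nhds).congr' ?_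
  filter_upwards [self_mem_nhdsWithin] with z hz
  exact (hg.stieltjes_of_im_pos (by positivity) hz).symm

theorem RayDecay.tendsto_stieltjes_lower {g : ℂ → ℂ} (hg : RayDecay g) {x : ℂ}
    (hx : x ∈ posHalfLine) : Tendsto (stieltjes 0 g) (𝓝[{z : ℂ | z.im < 0}] x)
      (𝓝 (principalValue g x - Real.pi * Complex.I * g x)) := by
  have h1 : ContinuousAt (fun z => principalPart g (‖x‖ + 1) z - Real.pi * Complex.I * g z) x :=
    (hg.continuousAt_principalPart hx.1 hx.2 (lt_add_one ‖x‖)).sub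
      (continuousAt_const.mul (hg.diff x).continuousAt)
  refine (h1.tendsto.mono_left nhdsWithin_le_nhds).congr' ?_
  filter_upwards [self_mem_nhdsWithin] with z hz
  exact (hg.stieltjes_of_im_neg (by positivity) hz).symm

/-! ### Cauchy transforms along a ray -/

theorem div_mem_posHalfLine {D k : ℕ} {x : ℂ} (hx : x ∈ ray D k) (h0 : x ≠ 0) :
    x / omega D ^ k ∈ posHalfLine := by
  obtain ⟨h1, h2⟩ := mem_ray_iff.1 hx
  refine ⟨lt_of_le_of_ne h1 fun h => ?_, h2⟩
  exact div_ne_zero h0 (omega_pow_ne_zero D k) (Complex.ext h.symm h2)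

/-- The Cauchy transform along the `k`-th ray. -/
def rayTransform (D k : ℕ) (g : ℂ → ℂ) (z : ℂ) : ℂ := stieltjes 0 g (z / omega D ^ k)

theorem continuous_div_omega (D k : ℕ) : Continuous fun z : ℂ => z / omega D ^ k := by fun_prop

theorem RayDecay.differentiableAt_rayTransform {g : ℂ → ℂ} (hg : RayDecay g) {D k : ℕ} {z : ℂ}
    (hz : z ∉ ray D k) : DifferentiableAt ℂ (rayTransform D k g) z :=
  (hg.differentiableAt_stieltjes (notMem_ray_iff.1 hz)).comp z (by fun_prop)

theorem RayDecay.rayTransform_upper {g : ℂ → ℂ} (hg : RayDecay g) {D k : ℕ} {x : ℂ}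
    (hx : x ∈ ray D k) (h0 : x ≠ 0) :
    Tendsto (rayTransform D k g) (𝓝[{z : ℂ | 0 < (z / omega D ^ k).im}] x)
      (𝓝 (principalValue g (x / omega D ^ k) + Real.pi * Complex.I * g (x / omega D ^ k))) :=
  (hg.tendsto_stieltjes_upper (div_mem_posHalfLine hx h0)).comp
    ((continuous_div_omega D k).continuousAt.continuousWithinAt.tendsto_nhdsWithin
      fun _ hz => hz)

theorem RayDecay.rayTransform_lower {g : ℂ → ℂ} (hg : RayDecay g) {D k : ℕ} {x : ℂ}
    (hx : x ∈ ray D k) (h0 : x ≠ 0) :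
    Tendsto (rayTransform D k g) (𝓝[{z : ℂ | (z / omega D ^ k).im < 0}] x)
      (𝓝 (principalValue g (x / omega D ^ k) - Real.pi * Complex.I * g (x / omega D ^ k))) :=
  (hg.tendsto_stieltjes_lower (div_mem_posHalfLine hx h0)).comp
    ((continuous_div_omega D k).continuousAt.continuousWithinAt.tendsto_nhdsWithin
      fun _ hz => hz)

theorem nhdsWithin_punctured_ray {D k : ℕ} (hD : 2 ≤ D) {x : ℂ} (hk : k < D) (hx : x ∈ ray D k)
    (hS : x ∉ selfInt D) : 𝓝[Sig D \ selfInt D] x ≤ 𝓝[ray D k \ {0}] x := by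
  refine nhdsWithin_le_iff.2 ?_
  filter_upwards [self_mem_nhdsWithin, nhdsWithin_le_nhds (eventually_mem_ray hD hk hx hS)]
    with z hz hz2
  exact ⟨hz2 hz.1, fun h => hz.2 (Or.inl h)⟩

open Classical in
-- `HasJump` asks for boundary functions on all of `Σ \ S`, not only on the `k`-th ray. Off that ray
-- the transform is analytic and is its own boundary value. The choices `c = ±πi` give the two
-- sides.
theorem RayDecay.continuousOn_boundary {g : ℂ → ℂ} (hg : RayDecay g) {D k : ℕ} (hD : 2 ≤ D)
    (hk : k < D) (c : ℂ) : ContinuousOn (fun x => if x ∈ ray D k then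
      principalValue g (x / omega D ^ k) + c * g (x / omega D ^ k) else rayTransform D k g x)
      (Sig D \ selfInt D) := by
  intro x hx
  by_cases hxk : x ∈ ray D k
  · refine ContinuousWithinAt.mono_of_mem_nhdsWithin (t := ray D k \ {0}) ?_
      (nhdsWithin_le_iff.1 (nhdsWithin_punctured_ray hD hk hxk hx.2))
    have h0 : x ≠ 0 := fun h => hx.2 (Or.inl h)
    have h1 : ContinuousOn (fun x => principalValue g (x / omega D ^ k) + c * g (x / omega D ^ k))
        (ray D k \ {0}) := by
      refine ContinuousOn.add ?_ ?_
      · exact hg.continuousOn_principalValue.comp (continuous_div_omega D k).continuousOn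
          fun z hz => div_mem_posHalfLine hz.1 hz.2
      · exact (continuous_const.mul (hg.diff.continuous.comp
          (continuous_div_omega D k))).continuousOn
    refine (h1 x ⟨hxk, h0⟩).congr (fun y hy => if_pos hy.1) (if_pos hxk)
  · refine ContinuousAt.continuousWithinAt ?_
    refine (hg.differentiableAt_rayTransform hxk).continuousAt.congr ?_
    filter_upwards [(isClosed_ray D k).isOpen_compl.mem_nhds hxk] with z hz
    exact (if_neg hz).symm

open Classical in
-- The sign records the orientation: `C_0` points outwards and has the upper side on its left, while
-- `C_k` with `k ≥ 1` points inwards and has `Im (z / ω^k) < 0` on its left.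
theorem RayDecay.hasJump_rayTransform {g : ℂ → ℂ} (hg : RayDecay g) {D k : ℕ} (hD : 2 ≤ D)
    (hk : k < D) : HasJump D (rayTransform D k g) fun x => (if k = 0 then 1 else -1) *
      (2 * Real.pi * Complex.I * (ray D k).indicator (fun x => g (x / omega D ^ k)) x) := by
  have hc := fun c => hg.continuousOn_boundary hD hk c
  have hoff : ∀ x, x ∉ ray D k → ∀ s, Tendsto (rayTransform D k g) (𝓝[s] x)
      (𝓝 (rayTransform D k g x)) := fun x hx s =>
    (hg.differentiableAt_rayTransform hx).continuousAt.mono_left nhdsWithin_le_nhds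
  have hne : ∀ x ∈ Sig D \ selfInt D, x ≠ 0 := fun x hx h => hx.2 (Or.inl h)
  by_cases hk0 : k = 0
  · refine ⟨_, _, hc (Real.pi * Complex.I), hc (-(Real.pi * Complex.I)), fun x hx => ?_⟩
    by_cases hxk : x ∈ ray D k
    · obtain ⟨hl, hr⟩ := leftSide_of_mem_ray_zero (hk0 ▸ hxk) hx.2 hD
      simp only [hxk, if_true, indicator_of_mem]
      refine ⟨(hg.rayTransform_upper hxk (hne x hx)).mono_left (nhdsWithin_mono _ ?_), ?_, ?_⟩
      · rw [hl, hk0]; rintro z ⟨_, hz⟩; simpa using hz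
      · rw [neg_mul, ← sub_eq_add_neg]
        refine (hg.rayTransform_lower hxk (hne x hx)).mono_left (nhdsWithin_mono _ ?_)
        rw [hr, hk0]; rintro z ⟨_, hz⟩; simpa using hz
      · rw [if_pos hk0]; ring
    · simp only [hxk, if_false, not_false_eq_true, indicator_of_notMem, mul_zero, add_zero,
        and_true]
      exact ⟨hoff x hxk _, hoff x hxk _⟩
  · refine ⟨_, _, hc (-(Real.pi * Complex.I)), hc (Real.pi * Complex.I), fun x hx => ?_⟩
    by_cases hxk : x ∈ ray D k
    · obtain ⟨hl, hr⟩ := leftSide_of_mem_ray hxk hx.2 hk0 hk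
      simp only [hxk, if_true, indicator_of_mem]
      refine ⟨?_, (hg.rayTransform_upper hxk (hne x hx)).mono_left (nhdsWithin_mono _ ?_), ?_⟩
      · rw [neg_mul, ← sub_eq_add_neg]
        refine (hg.rayTransform_lower hxk (hne x hx)).mono_left (nhdsWithin_mono _ ?_)
        rw [hl]; rintro z ⟨_, hz⟩; exact hz
      · rw [hr]; rintro z ⟨_, hz⟩; exact hz
      · rw [if_neg hk0]; ring
    · simp only [hxk, if_false, not_false_eq_true, indicator_of_notMem, mul_zero, add_zero,
        and_true]
      exact ⟨hoff x hxk _, hoff x hxk _⟩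

theorem RayDecay.exists_eventually_norm_rayTransform_le {g : ℂ → ℂ} (hg : RayDecay g) {D k : ℕ}
    {s : ℂ} (hs : s ≠ 0) : ∃ M : ℝ, ∀ᶠ z in 𝓝[(ray D k)ᶜ] s, ‖rayTransform D k g z‖ ≤ M := by
  by_cases hsk : s ∈ ray D k
  · have h1 := (hg.rayTransform_upper hsk hs).norm.eventually_le_const (lt_add_one _)
    have h2 := (hg.rayTransform_lower hsk hs).norm.eventually_le_const (lt_add_one _)
    rw [eventually_nhdsWithin_iff] at h1 h2
    have h3 : ∀ᶠ z in 𝓝 s, 0 < (z / omega D ^ k).re :=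
      (Complex.continuous_re.comp (continuous_div_omega D k)).continuousAt.eventually_const_lt
        (div_mem_posHalfLine hsk hs).1
    refine ⟨max (‖principalValue g (s / omega D ^ k) +
      Real.pi * Complex.I * g (s / omega D ^ k)‖ + 1) (‖principalValue g (s / omega D ^ k) -
      Real.pi * Complex.I * g (s / omega D ^ k)‖ + 1), ?_⟩
    rw [eventually_nhdsWithin_iff]
    filter_upwards [h1, h2, h3] with z h1 h2 h3 hz
    rcases lt_trichotomy (z / omega D ^ k).im 0 with h | h | h
    · exact (h2 h).trans (le_max_right _ _)
    · exact absurd (mem_ray_iff.2 ⟨h3.le, h⟩) hz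
    · exact (h1 h).trans (le_max_left _ _)
  · exact ContinuousAt.exists_eventually_norm_le (hg.differentiableAt_rayTransform hsk).continuousAt _

/-! ### Cauchy transforms along `Γ_k` -/

/-- Decay of an entire function along both ends of `Γ_k`. -/
structure GamDecay (D k : ℕ) (f : ℂ → ℂ) : Prop where
  zero : RayDecay f
  rot : RayDecay fun t => f (omega D ^ k * t)

theorem GamDecay.id_mul {D k : ℕ} {f : ℂ → ℂ} (hf : GamDecay D k f) :
    GamDecay D k fun t => t * f t where
  zero := hf.zero.id_mul
  rot := by
    convert hf.rot.id_mul.const_mul (omega D ^ k) using 2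
    ring

theorem cauchy_integralGam (D k : ℕ) (f : ℂ → ℂ) (z : ℂ) :
    cauchy (integralGam D k) f z = 1 / (2 * Real.pi * Complex.I) *
      (rayTransform D 0 f z - rayTransform D k (fun t => f (omega D ^ k * t)) z) := by
  have h0 := omega_pow_ne_zero D k
  simp only [cauchy, integralGam, rayTransform, stieltjes, pow_zero, div_one]
  congr 2
  refine setIntegral_congr_fun measurableSet_Ioi fun t _ => ?_
  have h1 : omega D ^ k * (t : ℂ) - z = omega D ^ k * (t - z / omega D ^ k) := by
    field_simp
  rw [h1, div_mul_eq_mul_div, mul_comm (omega D ^ k) ((t : ℂ) - z / omega D ^ k),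
    mul_div_mul_right _ _ h0]

theorem notMem_ray_of_notMem_Sig {D k : ℕ} (hD : 2 ≤ D) (hk : k < D) {z : ℂ} (hz : z ∉ Sig D) :
    z ∉ ray D k := fun h => hz ((mem_Sig_iff hD).2 (Or.inr ⟨k, hk, h⟩))

theorem GamDecay.differentiableAt_cauchy {D k : ℕ} {f : ℂ → ℂ} (hf : GamDecay D k f) (hD : 2 ≤ D)
    (hk : k < D) {z : ℂ} (hz : z ∉ Sig D) :
    DifferentiableAt ℂ (cauchy (integralGam D k) f) z := by
  rw [funext (cauchy_integralGam D k f)]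
  exact ((hf.zero.differentiableAt_rayTransform (notMem_ray_of_notMem_Sig hD (by omega) hz)).sub
    (hf.rot.differentiableAt_rayTransform (notMem_ray_of_notMem_Sig hD hk hz))).const_mul _

/-- The two rays enter the transform with opposite signs, and their jumps have opposite signs too,
so both contribute `+f`. -/
theorem GamDecay.hasJump_cauchy {D k : ℕ} {f : ℂ → ℂ} (hf : GamDecay D k f) (hD : 2 ≤ D)
    (hk0 : k ≠ 0) (hk : k < D) :
    HasJump D (cauchy (integralGam D k) f) fun x => (Gam D k).indicator f x := by
  have h0 := omega_pow_ne_zero D k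
  refine (((hf.zero.hasJump_rayTransform hD (k := 0) (by omega)).sub
    (hf.rot.hasJump_rayTransform hD hk)).const_mul (1 / (2 * Real.pi * Complex.I))).congr
    (fun z _ => (cauchy_integralGam D k f z).symm) fun x hx => ?_
  simp only [if_neg hk0, if_true, one_mul, pow_zero, div_one]
  have hne : x ∈ ray D 0 → x ∉ ray D k := fun h =>
    notMem_ray_of_ne (by omega) hk hk0 hx.2 h
  have hpi := Complex.two_pi_I_ne_zero
  have h2 : omega D ^ k * (x / omega D ^ k) = x := by field_simp
  by_cases h1 : x ∈ ray D 0
  · rw [indicator_of_mem h1, indicator_of_notMem (hne h1), indicator_of_mem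
      (show x ∈ Gam D k from Or.inl h1)]
    field_simp
    ring
  · by_cases hk' : x ∈ ray D k
    · rw [indicator_of_notMem h1, indicator_of_mem hk', indicator_of_mem
        (show x ∈ Gam D k from Or.inr hk'), h2]
      field_simp
      ring
    · rw [indicator_of_notMem h1, indicator_of_notMem hk',
        indicator_of_notMem (show x ∉ Gam D k from fun h => h.elim h1 hk')]
      ring

/-! ### Transforms along `Γ_k` at the origin and at infinity. -/

theorem norm_log_sub_log_le' (a b : ℂ) : ‖Complex.log a - Complex.log b‖ ≤
    |Real.log ‖a‖ - Real.log ‖b‖| + 2 * Real.pi := by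
  refine (Complex.norm_le_abs_re_add_abs_im _).trans (add_le_add ?_ ?_)
  · rw [Complex.sub_re, Complex.log_re, Complex.log_re]
  · rw [Complex.sub_im, Complex.log_im, Complex.log_im]
    refine (abs_sub _ _).trans ?_
    linarith [Complex.abs_arg_le_pi a, Complex.abs_arg_le_pi b]

theorem abs_log_norm_sub_le {u z : ℂ} (hu : ‖u‖ = 1) (hz : ‖z‖ ≤ 1 / 2) :
    |Real.log ‖z - u‖| ≤ Real.log 2 := by
  have h1 : ‖u‖ - ‖z‖ ≤ ‖u - z‖ := norm_sub_norm_le u z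
  have h2 : ‖u - z‖ ≤ ‖u‖ + ‖z‖ := norm_sub_le u z
  rw [norm_sub_rev] at h1 h2
  have h3 : 0 < ‖z - u‖ := by linarith
  rw [abs_le, ← Real.log_inv]
  exact ⟨Real.log_le_log (by norm_num) (by norm_num; linarith),
    Real.log_le_log h3 (by linarith)⟩

/-- Both logarithms blow up like `-log ‖z‖`, which cancels. What remains is `log ‖z - 1‖ - log ‖z -
u‖`, bounded for `‖z‖ ≤ 1 / 2`, and a difference of arguments. -/
theorem norm_log_sub_log_near_zero {u z : ℂ} (hu : ‖u‖ = 1) (hz0 : z ≠ 0) (hz : ‖z‖ ≤ 1 / 2) :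
    ‖Complex.log (1 - 1 / z) - Complex.log (1 - 1 / (z / u))‖ ≤
      2 * Real.log 2 + 2 * Real.pi := by
  have hu0 : u ≠ 0 := by rintro rfl; simp at hu
  refine (norm_log_sub_log_le' _ _).trans (add_le_add_left ?_ _)
  have h1 : ∀ v : ℂ, ‖v‖ = 1 → Real.log ‖(z - v) / z‖ = Real.log ‖z - v‖ - Real.log ‖z‖ := by
    intro v hv
    rw [norm_div, Real.log_div _ (norm_ne_zero_iff.2 hz0)]
    rw [norm_ne_zero_iff, sub_ne_zero]
    rintro rfl
    rw [hv] at hz; norm_num at hz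
  have h2 : 1 - 1 / z = (z - 1) / z := by field_simp
  have h3 : 1 - 1 / (z / u) = (z - u) / z := by field_simp
  rw [h2, h3, h1 1 (by simp), h1 u hu]
  have h4 := abs_log_norm_sub_le (z := z) (u := 1) (by simp) hz
  have h5 := abs_log_norm_sub_le hu hz
  calc _ = |Real.log ‖z - 1‖ - Real.log ‖z - u‖| := by congr 1; ring
    _ ≤ _ := abs_sub _ _
    _ ≤ _ := by linarith

/-- At the origin the two rays contribute logarithms with the same coefficient `f z` and opposite
signs, since the rotated function at `z / ω^k` is again `f z`. A single ray would leave a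
logarithmic singularity whenever `f 0 ≠ 0`. -/
theorem GamDecay.boundedNear_cauchy {D k : ℕ} {f : ℂ → ℂ} (hf : GamDecay D k f) (hD : 2 ≤ D)
    (hk : k < D) : BoundedNear D (cauchy (integralGam D k) f) := by
  have h0 := omega_pow_ne_zero D k
  have hsub : ∀ j < D, (Sig D)ᶜ ⊆ (ray D j)ᶜ := fun j hj z hz =>
    notMem_ray_of_notMem_Sig hD hj hz
  have key : BoundedNear D fun z => rayTransform D 0 f z -
      rayTransform D k (fun t => f (omega D ^ k * t)) z := by
    intro s hs
    by_cases hs0 : s = 0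
    · subst hs0
      obtain ⟨M, hM⟩ := ContinuousAt.exists_eventually_norm_le
        (hf.zero.continuousAt_regularPart (T := 1) (w := 0) (by simp)) (Sig D)ᶜ
      obtain ⟨N, hN⟩ := ContinuousAt.exists_eventually_norm_le (s := 0)
        (f := fun z => regularPart (fun t => f (omega D ^ k * t)) 1 (z / omega D ^ k))
        (ContinuousAt.comp (hf.rot.continuousAt_regularPart (T := 1) (by simp))
          (continuous_div_omega D k).continuousAt) (Sig D)ᶜ
      obtain ⟨K, hK⟩ := ContinuousAt.exists_eventually_norm_le
        (hf.zero.diff.continuous.continuousAt (x := 0)) (Sig D)ᶜ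
      have hsmall : ∀ᶠ z : ℂ in 𝓝 0, ‖z‖ ≤ 1 / 2 :=
        continuous_norm.continuousAt.eventually_le_const (by simp)
      refine ⟨M + N + K * (2 * Real.log 2 + 2 * Real.pi), ?_⟩
      filter_upwards [hM, hN, hK, self_mem_nhdsWithin, nhdsWithin_le_nhds hsmall]
        with z hM hN hK hz hz2
      have hz0 : z ≠ 0 := fun h => hz (h ▸ zero_mem_Sig hD)
      have e1 := hf.zero.stieltjes_eq (T := 1)
        (notMem_ray_iff.1 (hsub 0 (by omega) hz)) zero_le_one
      have e2 := hf.rot.stieltjes_eq (T := 1) (notMem_ray_iff.1 (hsub k hk hz)) zero_le_one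
      have h2 : omega D ^ k * (z / omega D ^ k) = z := by field_simp
      rw [pow_zero, div_one] at e1
      rw [h2] at e2
      have e3 := norm_log_sub_log_near_zero (norm_omega_pow (D := D) (by omega) k) hz0 hz2
      rw [rayTransform, rayTransform, pow_zero, div_one, e1, e2, Complex.ofReal_one]
      have h3 : 0 ≤ 2 * Real.log 2 + 2 * Real.pi := (norm_nonneg _).trans e3
      calc _ = ‖regularPart f 1 z - regularPart (fun t => f (omega D ^ k * t)) 1
            (z / omega D ^ k) + f z * (Complex.log (1 - 1 / z) -
              Complex.log (1 - 1 / (z / omega D ^ k)))‖ := by congr 1; ring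
        _ ≤ (‖regularPart f 1 z‖ + ‖regularPart (fun t => f (omega D ^ k * t)) 1
            (z / omega D ^ k)‖) + ‖f z‖ * ‖Complex.log (1 - 1 / z) -
              Complex.log (1 - 1 / (z / omega D ^ k))‖ := by
          rw [← norm_mul]
          exact (norm_add_le _ _).trans (add_le_add_left (norm_sub_le _ _) _)
        _ ≤ _ := add_le_add (add_le_add hM hN) (mul_le_mul hK e3 (norm_nonneg _)
            ((norm_nonneg _).trans hK))
    · obtain ⟨M, hM⟩ := hf.zero.exists_eventually_norm_rayTransform_le (D := D) (k := 0) hs0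
      obtain ⟨N, hN⟩ := hf.rot.exists_eventually_norm_rayTransform_le (D := D) (k := k) hs0
      refine ⟨M + N, ?_⟩
      filter_upwards [nhdsWithin_mono s (hsub 0 (by omega)) hM, nhdsWithin_mono s (hsub k hk) hN]
        with z h1 h2 using (norm_sub_le _ _).trans (add_le_add h1 h2)
  exact (key.const_mul (1 / (2 * Real.pi * Complex.I))).congr
    fun z _ => (cauchy_integralGam D k f z).symm

theorem integralGam_eq {D k : ℕ} {f : ℂ → ℂ} : integralGam D k f =
    (∫ t in Ioi (0 : ℝ), f t) - omega D ^ k * ∫ t in Ioi (0 : ℝ), f (omega D ^ k * t) := by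
  rw [integralGam, integral_mul_const, mul_comm]

theorem GamDecay.mul_cauchy {D k : ℕ} {f : ℂ → ℂ} (hf : GamDecay D k f) (hD : 2 ≤ D)
    (hk : k < D) {z : ℂ} (hz : z ∉ Sig D) :
    z * cauchy (integralGam D k) f z = cauchy (integralGam D k) (fun t => t * f t) z -
      1 / (2 * Real.pi * Complex.I) * integralGam D k f := by
  have h0 := omega_pow_ne_zero D k
  have h1 := hf.zero.mul_stieltjes (notMem_ray_iff.1 (notMem_ray_of_notMem_Sig hD (k := 0)
    (by omega) hz))
  have h2 := hf.rot.mul_stieltjes (notMem_ray_iff.1 (notMem_ray_of_notMem_Sig hD hk hz))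
  have h3 : stieltjes 0 (fun t => omega D ^ k * t * f (omega D ^ k * t)) (z / omega D ^ k) =
      omega D ^ k * stieltjes 0 (fun t => t * f (omega D ^ k * t)) (z / omega D ^ k) := by
    unfold stieltjes
    rw [← integral_const_mul]
    congr 1
    ext t
    ring
  rw [pow_zero, div_one] at h1
  rw [cauchy_integralGam, cauchy_integralGam, integralGam_eq]
  simp only [rayTransform, pow_zero, div_one]
  rw [h3]
  field_simp at h2 ⊢
  linear_combination h1 - h2

theorem eventually_farOff_notMem (D : ℕ) : ∀ᶠ z in farOff D, z ∉ Sig D :=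
  mem_inf_of_right (mem_principal_self _)

theorem eventually_farOff_norm (D : ℕ) (r : ℝ) : ∀ᶠ z in farOff D, r ≤ ‖z‖ :=
  mem_inf_of_left (Filter.hasBasis_cobounded_norm.mem_of_mem (i := r) trivial)

theorem isBigO_const_rayTransform {g : ℂ → ℂ} (hg : RayDecay g) {D k : ℕ} (hD : 2 ≤ D)
    (hk : k < D) : rayTransform D k g =O[farOff D] fun _ => (1 : ℂ) := by
  obtain ⟨C, hC⟩ := hg.exists_norm_stieltjes_le
  refine Asymptotics.IsBigO.of_bound C ?_
  filter_upwards [eventually_farOff_notMem D, eventually_farOff_norm D 2] with z hz hz2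
  rw [norm_one, mul_one]
  refine hC _ (notMem_ray_iff.1 (notMem_ray_of_notMem_Sig hD hk hz)) ?_
  rwa [norm_div, norm_omega_pow (by omega), div_one]

theorem isBigO_inv_of_mul {D : ℕ} {f : ℂ → ℂ}
    (h : (fun z => z * f z) =O[farOff D] fun _ => (1 : ℂ)) : f =O[farOff D] fun z => z⁻¹ := by
  have h1 := (Asymptotics.isBigO_refl (fun z : ℂ => z⁻¹) (farOff D)).mul h
  simp only [mul_one] at h1
  refine h1.congr' ?_ EventuallyEq.rfl
  filter_upwards [eventually_farOff_norm D 1] with z hz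
  have : z ≠ 0 := norm_pos_iff.1 (zero_lt_one.trans_le hz)
  field_simp

theorem GamDecay.isBigO_one {D k : ℕ} {f : ℂ → ℂ} (hf : GamDecay D k f) (hD : 2 ≤ D)
    (hk : k < D) : cauchy (integralGam D k) f =O[farOff D] fun _ => (1 : ℂ) := by
  rw [funext (cauchy_integralGam D k f)]
  exact ((isBigO_const_rayTransform hf.zero hD (by omega)).sub
    (isBigO_const_rayTransform hf.rot hD hk)).const_mul_left _

theorem GamDecay.isBigO_inv {D k : ℕ} {f : ℂ → ℂ} (hf : GamDecay D k f) (hD : 2 ≤ D)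
    (hk : k < D) : cauchy (integralGam D k) f =O[farOff D] fun z => z⁻¹ := by
  refine isBigO_inv_of_mul ?_
  refine ((hf.id_mul.isBigO_one hD hk).sub (Asymptotics.isBigO_const_const
    (1 / (2 * Real.pi * Complex.I) * integralGam D k f) one_ne_zero (farOff D))).congr' ?_
    EventuallyEq.rfl
  filter_upwards [eventually_farOff_notMem D] with z hz
  exact (hf.mul_cauchy hD hk hz).symm

/-! ### Decay of the weights -/

/-- The real parts of the coefficients. -/
def rePart (P : ℂ[X]) : ℝ[X] := ∑ i ∈ Finset.range (P.natDegree + 1), monomial i (P.coeff i).re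

theorem coeff_rePart (P : ℂ[X]) (i : ℕ) : (rePart P).coeff i = (P.coeff i).re := by
  simp only [rePart, finsetSum_coeff, coeff_monomial]
  rw [Finset.sum_ite_eq']
  split_ifs with h
  · rfl
  · rw [Finset.mem_range, not_lt] at h
    rw [coeff_eq_zero_of_natDegree_lt (by omega), Complex.zero_re]

theorem eval_rePart (P : ℂ[X]) (t : ℝ) : (rePart P).eval t = (P.eval (t : ℂ)).re := by
  rw [rePart, eval_finsetSum, eval_eq_sum_range, Complex.re_sum]
  refine Finset.sum_congr rfl fun i _ => ?_
  rw [eval_monomial, ← Complex.ofReal_pow, Complex.re_mul_ofReal]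

theorem natDegree_rePart_le (P : ℂ[X]) : (rePart P).natDegree ≤ P.natDegree :=
  natDegree_le_iff_coeff_eq_zero.2 fun i hi => by
    rw [coeff_rePart, coeff_eq_zero_of_natDegree_lt (by exact_mod_cast hi), Complex.zero_re]

theorem natDegree_rePart {P : ℂ[X]} (h : P.leadingCoeff.re ≠ 0) :
    (rePart P).natDegree = P.natDegree :=
  natDegree_eq_of_le_of_coeff_ne_zero (natDegree_rePart_le P) (by rwa [coeff_rePart])

theorem leadingCoeff_rePart {P : ℂ[X]} (h : P.leadingCoeff.re ≠ 0) :
    (rePart P).leadingCoeff = P.leadingCoeff.re := by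
  rw [leadingCoeff, natDegree_rePart h, coeff_rePart, leadingCoeff]

theorem exists_norm_eval_le (Q : ℂ[X]) :
    ∃ q : ℝ[X], q.natDegree ≤ Q.natDegree ∧ (∀ i, 0 ≤ q.coeff i) ∧
      ∀ z : ℂ, ‖Q.eval z‖ ≤ q.eval ‖z‖ := by
  have hc : ∀ j, (∑ i ∈ Finset.range (Q.natDegree + 1), monomial i ‖Q.coeff i‖).coeff j =
      ‖Q.coeff j‖ := fun j => by
    simp only [finsetSum_coeff, coeff_monomial]
    rw [Finset.sum_ite_eq']
    split_ifs with h
    · rfl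
    · rw [Finset.mem_range, not_lt] at h
      rw [coeff_eq_zero_of_natDegree_lt (by omega), norm_zero]
  refine ⟨∑ i ∈ Finset.range (Q.natDegree + 1), monomial i ‖Q.coeff i‖, ?_, fun i => ?_,
    fun z => ?_⟩
  · refine natDegree_le_iff_coeff_eq_zero.2 fun i hi => ?_
    rw [hc, coeff_eq_zero_of_natDegree_lt (by exact_mod_cast hi), norm_zero]
  · rw [hc]; positivity
  · rw [eval_eq_sum_range, eval_finsetSum]
    refine (norm_sum_le _ _).trans (Finset.sum_le_sum fun i _ => ?_)
    rw [norm_mul, norm_pow, eval_monomial]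

theorem tendsto_sub_X_atTop {u : ℝ[X]} (h : 2 ≤ u.natDegree) (hl : 0 < u.leadingCoeff) :
    Tendsto (fun t : ℝ => u.eval t - t) atTop atTop := by
  have h1 : (X : ℝ[X]).degree < u.degree := by
    rw [degree_X, degree_eq_natDegree (by rintro rfl; simp at h)]
    exact_mod_cast h
  have h2 : (u - X).leadingCoeff = u.leadingCoeff := leadingCoeff_sub_of_degree_lt h1
  have h3 : (u - X).degree = u.degree := degree_sub_eq_left_of_degree_lt h1
  have := tendsto_atTop_of_leadingCoeff_nonneg (u - X)
    (by rw [h3, degree_eq_natDegree (by rintro rfl; simp at h)]; exact_mod_cast (by omega))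
    (by rw [h2]; exact hl.le)
  simpa using this

/-- Along the half-line `Re U(t)` is a real polynomial of degree at least `2` with positive leading
coefficient, so eventually it exceeds `t`, and `e^{-t}` beats every polynomial. -/
theorem exists_norm_exp_mul_le {U : ℂ[X]} (Q : ℂ[X]) (hU : 2 ≤ U.natDegree)
    (hl : 0 < U.leadingCoeff.re) :
    ∃ C, ∀ t : ℝ, 0 ≤ t → ‖Complex.exp (-U.eval (t : ℂ)) * Q.eval (t : ℂ)‖ ≤ C := by
  obtain ⟨q, -, -, hq⟩ := exists_norm_eval_le Q
  have h1 := tendsto_sub_X_atTop (u := rePart U) (by rwa [natDegree_rePart hl.ne'])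
    (by rwa [leadingCoeff_rePart hl.ne'])
  have h2 := (Polynomial.tendsto_div_exp_atTop q).eventually_le_const zero_lt_one
  obtain ⟨T, hT⟩ := ((h1.eventually_ge_atTop 0).and (h2.and (eventually_ge_atTop 0))).exists_forall_of_atTop
  have hc : Continuous fun t : ℝ => ‖Complex.exp (-U.eval (t : ℂ)) * Q.eval (t : ℂ)‖ := by
    fun_prop
  obtain ⟨C, hC⟩ := (isCompact_Icc (a := 0) (b := T)).exists_bound_of_continuousOn hc.continuousOn
  refine ⟨max C 1, fun t ht => ?_⟩
  rcases le_total t T with h | h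
  · exact (by simpa using hC t ⟨ht, h⟩ : _ ≤ C).trans (le_max_left _ _)
  · obtain ⟨h3, h4, h5⟩ := hT t h
    refine le_trans ?_ (le_max_right _ _)
    rw [norm_mul, Complex.norm_exp, Complex.neg_re, ← eval_rePart]
    have h6 := hq t
    rw [Complex.norm_of_nonneg ht] at h6
    calc _ ≤ Real.exp (-t) * q.eval t := by
          refine mul_le_mul (Real.exp_le_exp.2 (by linarith)) h6 (norm_nonneg _)
            (Real.exp_pos _).le
      _ = q.eval t / Real.exp t := by rw [Real.exp_neg]; field_simp
      _ ≤ 1 := h4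

theorem hasDerivAt_exp_mul (U Q : ℂ[X]) (z : ℂ) :
    HasDerivAt (fun z => Complex.exp (-U.eval z) * Q.eval z)
      (Complex.exp (-U.eval z) * (derivative Q - derivative U * Q).eval z) z := by
  refine ((U.hasDerivAt z).fun_neg.cexp.fun_mul (Q.hasDerivAt z)).congr_deriv ?_
  simp only [eval_sub, eval_mul]
  ring

/-- The functions `e^{-U} Q` are stable under multiplication by powers and under differentiation, so
boundedness for all `Q` gives every required estimate. -/
theorem rayDecay_exp_mul {U : ℂ[X]} (Q : ℂ[X]) (hU : 2 ≤ U.natDegree)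
    (hl : 0 < U.leadingCoeff.re) :
    RayDecay fun z => Complex.exp (-U.eval z) * Q.eval z := by
  have key : ∀ Q : ℂ[X], ∀ N : ℕ, ∃ C, ∀ t : ℝ, 0 ≤ t →
      t ^ N * ‖Complex.exp (-U.eval (t : ℂ)) * Q.eval (t : ℂ)‖ ≤ C := fun Q N => by
    obtain ⟨C, hC⟩ := exists_norm_exp_mul_le (X ^ N * Q) hU hl
    refine ⟨C, fun t ht => ?_⟩
    convert hC t ht using 1
    simp only [eval_mul, eval_pow, eval_X, norm_mul, norm_pow, Complex.norm_of_nonneg ht]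
    ring
  refine ⟨fun z => (hasDerivAt_exp_mul U Q z).differentiableAt, key Q, fun N => ?_⟩
  simp only [(hasDerivAt_exp_mul U Q _).deriv]
  exact key _ N

/-- `V` rotated by `ω^k` and multiplied by `m`. -/
def rotPoly (V : ℝ[X]) (D k m : ℕ) : ℂ[X] :=
  C (m : ℂ) * (V.map (algebraMap ℝ ℂ)).comp (C (omega D ^ k) * X)

theorem eval_rotPoly (V : ℝ[X]) (D k m : ℕ) (z : ℂ) :
    (rotPoly V D k m).eval z = m * aeval (omega D ^ k * z) V := by
  simp [rotPoly]

theorem natDegree_rotPoly (V : ℝ[X]) (D k : ℕ) {m : ℕ} (hm : 0 < m) :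
    (rotPoly V D k m).natDegree = V.natDegree := by
  rw [rotPoly, natDegree_C_mul (by exact_mod_cast hm.ne'), natDegree_comp,
    natDegree_C_mul_X _ (omega_pow_ne_zero D k), mul_one, natDegree_map]

/-- `ω^{kD} = 1`, so rotation does not touch the leading term. Hence `e^{-V}` and `e^{-2V}` decay
along all `D` rays. -/
theorem leadingCoeff_rotPoly (V : ℝ[X]) {D : ℕ} (hV : V.natDegree = D) (hD : 0 < D) (k m : ℕ) :
    (rotPoly V D k m).leadingCoeff = m * V.leadingCoeff := by
  rw [rotPoly, leadingCoeff_mul, leadingCoeff_C, leadingCoeff_comp, leadingCoeff_map,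
    leadingCoeff_C_mul_X, natDegree_map, hV, ← pow_mul, mul_comm k D, pow_mul,
    (isPrimitiveRoot_omega hD).pow_eq_one, one_pow, mul_one]
  · rfl
  · rw [natDegree_C_mul_X _ (omega_pow_ne_zero D k)]; exact one_ne_zero

theorem rayDecay_rot {V : ℝ[X]} {D : ℕ} (hV : V.natDegree = D) (hD : 2 ≤ D)
    (hl : 0 < V.leadingCoeff) (k : ℕ) {m : ℕ} (hm : 0 < m) (Q : ℂ[X]) :
    RayDecay fun t => Complex.exp (-(m * aeval (omega D ^ k * t) V)) *
      Q.eval (omega D ^ k * t) := by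
  have := rayDecay_exp_mul (U := rotPoly V D k m) (Q.comp (C (omega D ^ k) * X))
    (by rw [natDegree_rotPoly V D k hm]; omega)
    (by rw [leadingCoeff_rotPoly V hV (by omega), ← Complex.ofReal_natCast, ← Complex.ofReal_mul,
          Complex.ofReal_re]; positivity)
  simpa [eval_rotPoly] using this

theorem gamDecay_weightGam {V : ℝ[X]} {D : ℕ} (hV : V.natDegree = D) (hD : 2 ≤ D)
    (hl : 0 < V.leadingCoeff) (k : ℕ) (Q : ℂ[X]) :
    GamDecay D k fun z => weightGam V z * Q.eval z where
  zero := by simpa [weightGam] using rayDecay_rot hV hD hl 0 one_pos Q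
  rot := by simpa [weightGam] using rayDecay_rot hV hD hl k one_pos Q

theorem gamDecay_weightReal {V : ℝ[X]} {D : ℕ} (hV : V.natDegree = D) (hD : 2 ≤ D)
    (hl : 0 < V.leadingCoeff) (k : ℕ) (Q : ℂ[X]) :
    GamDecay D k fun z => weightReal V z * Q.eval z where
  zero := by simpa [weightReal] using rayDecay_rot hV hD hl 0 two_pos Q
  rot := by simpa [weightReal] using rayDecay_rot hV hD hl k two_pos Q

/-! ### The real line as `Γ_{D/2}` -/

/-- This is where the parity of `D` enters: `ω^{D/2} = -1`, so `C_{D/2}` is the negative half-line.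
The column of `ℝ` then needs no analysis of its own. -/
theorem realLine_eq_Gam {D : ℕ} (hD : 2 ≤ D) (he : Even D) : realLine = Gam D (D / 2) := by
  ext z
  rw [Gam, mem_union, mem_ray_iff, mem_ray_iff, omega_pow_half (by omega) he]
  simp only [realLine, mem_ofPred_eq, pow_zero, div_one, div_neg, Complex.neg_re, Complex.neg_im,
    Left.nonneg_neg_iff, neg_eq_zero]
  constructor
  · intro h
    rcases le_total 0 z.re with h1 | h1
    · exact Or.inl ⟨h1, h⟩
    · exact Or.inr ⟨h1, h⟩
  · rintro (h | h) <;> exact h.2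

theorem integrable_of_halves {f : ℝ → ℂ} (h1 : IntegrableOn f (Ioi 0))
    (h2 : IntegrableOn (fun t => f (-t)) (Ioi 0)) : Integrable f := by
  have h3 : IntegrableOn f (Iic 0) := by
    rw [integrableOn_Iic_iff_integrableOn_Iio]
    refine ((Measure.measurePreserving_neg volume).integrableOn_comp_preimage
      (Homeomorph.neg ℝ).measurableEmbedding).1 ?_
    simpa [Function.comp_def] using h2
  rw [← integrableOn_univ, ← Iic_union_Ioi (a := (0 : ℝ))]
  exact h3.union h1

theorem integralReal_eq_integralGam {D : ℕ} (hD : 2 ≤ D) (he : Even D) {f : ℂ → ℂ}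
    (h1 : IntegrableOn (fun t : ℝ => f t) (Ioi 0))
    (h2 : IntegrableOn (fun t : ℝ => f (omega D ^ (D / 2) * t)) (Ioi 0)) :
    integralReal f = integralGam D (D / 2) f := by
  rw [omega_pow_half (by omega) he] at h2
  have h2' : IntegrableOn (fun t : ℝ => (fun t : ℝ => f t) (-t)) (Ioi 0) := by simpa using h2
  have h3 := integrable_of_halves (f := fun t : ℝ => f t) h1 h2'
  rw [integralReal, integralGam_eq, omega_pow_half (by omega) he,
    ← intervalIntegral.integral_Iic_add_Ioi (b := 0) h3.integrableOn h3.integrableOn]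
  have := integral_comp_neg_Ioi (0 : ℝ) (fun t : ℝ => f t)
  simp only [neg_zero] at this
  rw [← this]
  simp only [neg_one_mul, Complex.ofReal_neg]
  ring

theorem GamDecay.integralReal_eq {D : ℕ} {f : ℂ → ℂ} (hf : GamDecay D (D / 2) f) (hD : 2 ≤ D)
    (he : Even D) : integralReal f = integralGam D (D / 2) f :=
  integralReal_eq_integralGam hD he hf.zero.integrableOn hf.rot.integrableOn

theorem GamDecay.integrable {D : ℕ} {f : ℂ → ℂ} (hf : GamDecay D (D / 2) f) (hD : 2 ≤ D)
    (he : Even D) : Integrable fun t : ℝ => f t := by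
  refine integrable_of_halves hf.zero.integrableOn ?_
  have := hf.rot.integrableOn
  rw [omega_pow_half (by omega) he] at this
  simpa using this

theorem GamDecay.cauchy_integralReal_eq {D : ℕ} {f : ℂ → ℂ} (hf : GamDecay D (D / 2) f)
    (hD : 2 ≤ D) (he : Even D) {z : ℂ} (hz : z ∉ Sig D) :
    cauchy integralReal f z = cauchy (integralGam D (D / 2)) f z := by
  have h0 := omega_pow_ne_zero D (D / 2)
  rw [cauchy, cauchy, integralReal_eq_integralGam hD he]
  · have := hf.zero.integrableOn_div
      (notMem_ray_iff.1 (notMem_ray_of_notMem_Sig hD (k := 0) (by omega) hz))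
    simpa using this
  · have := (hf.rot.integrableOn_div
      (notMem_ray_iff.1 (notMem_ray_of_notMem_Sig hD (k := D / 2) (by omega) hz))).mul_const
        (omega D ^ (D / 2))⁻¹
    refine this.congr (ae_of_all _ fun t => ?_)
    have h1 : omega D ^ (D / 2) * (t : ℂ) - z =
        omega D ^ (D / 2) * (t - z / omega D ^ (D / 2)) := by
      field_simp
    simp only
    rw [h1, ← div_eq_mul_inv, div_div, mul_comm (omega D ^ (D / 2)) ((t : ℂ) - _)]

/-! ### Cauchy transforms on the unit circle -/

/-- The part of `x^e` which is analytic inside the circle. -/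
def innerPart (e : ℤ) (z : ℂ) : ℂ := if 0 ≤ e then z ^ e else 0

/-- Minus the part of `x^e` which is analytic outside the circle. -/
def outerPart (e : ℤ) (z : ℂ) : ℂ := if 0 ≤ e then 0 else -z ^ e

/-- The Cauchy transform of `x^e` on the unit circle. -/
def torusTerm (e : ℤ) (z : ℂ) : ℂ := if ‖z‖ < 1 then innerPart e z else outerPart e z

theorem innerPart_eq (e : ℤ) (z : ℂ) : innerPart e z = outerPart e z + z ^ e := by
  unfold innerPart outerPart
  split_ifs <;> ring

theorem differentiableAt_innerPart (e : ℤ) (z : ℂ) : DifferentiableAt ℂ (innerPart e) z := by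
  unfold innerPart
  by_cases h : 0 ≤ e
  · simp only [if_pos h]
    exact differentiableAt_zpow.2 (Or.inr h)
  · simp only [if_neg h]
    exact differentiableAt_const _

theorem differentiableAt_outerPart (e : ℤ) {z : ℂ} (hz : z ≠ 0) :
    DifferentiableAt ℂ (outerPart e) z := by
  unfold outerPart
  by_cases h : 0 ≤ e
  · simp only [if_pos h]
    exact differentiableAt_const _
  · simp only [if_neg h]
    exact (differentiableAt_zpow.2 (Or.inl hz)).neg

theorem torusTerm_of_lt {e : ℤ} {z : ℂ} (h : ‖z‖ < 1) : torusTerm e z = innerPart e z := if_pos h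

theorem torusTerm_of_ge {e : ℤ} {z : ℂ} (h : 1 ≤ ‖z‖) : torusTerm e z = outerPart e z :=
  if_neg h.not_gt

theorem differentiableAt_torusTerm (e : ℤ) {z : ℂ} (hz : ‖z‖ ≠ 1) :
    DifferentiableAt ℂ (torusTerm e) z := by
  rcases lt_or_gt_of_ne hz with h | h
  · refine (differentiableAt_innerPart e z).congr_of_eventuallyEq ?_
    filter_upwards [continuous_norm.continuousAt.eventually_lt_const h] with w hw
      using torusTerm_of_lt hw
  · refine (differentiableAt_outerPart e (norm_pos_iff.1 (zero_lt_one.trans h))).congr_of_eventuallyEq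
      ?_
    filter_upwards [continuous_norm.continuousAt.eventually_const_lt h] with w hw
      using torusTerm_of_ge hw.le

theorem integral_zpow (e : ℤ) :
    (∮ x in C(0, 1), x ^ e) = if e = -1 then 2 * Real.pi * Complex.I else 0 := by
  split_ifs with h
  · subst h
    simpa using circleIntegral.integral_sub_center_inv (0 : ℂ) (one_ne_zero (α := ℝ))
  · simpa using circleIntegral.integral_sub_zpow_of_ne h (0 : ℂ) 0 1

theorem circle_ne {x z : ℂ} (hz : ‖z‖ ≠ 1) (hx : x ∈ Metric.sphere (0 : ℂ) 1) :
    x ≠ 0 ∧ x - z ≠ 0 := by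
  rw [mem_sphere_zero_iff_norm] at hx
  refine ⟨norm_pos_iff.1 (by rw [hx]; exact one_pos), sub_ne_zero.2 ?_⟩
  rintro rfl
  exact hz hx

theorem circleIntegrable_zpow_div (e : ℤ) {z : ℂ} (hz : ‖z‖ ≠ 1) :
    CircleIntegrable (fun x => x ^ e / (x - z)) 0 1 := by
  refine ContinuousOn.circleIntegrable zero_le_one ?_
  refine ContinuousOn.div ?_ (by fun_prop) fun x hx => (circle_ne hz hx).2
  exact fun x hx => (continuousAt_zpow₀ x e (Or.inl (circle_ne hz hx).1)).continuousWithinAt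

theorem circleIntegrable_zpow (e : ℤ) : CircleIntegrable (fun x : ℂ => x ^ e) 0 1 :=
  ContinuousOn.circleIntegrable zero_le_one fun x hx =>
    (continuousAt_zpow₀ x e (Or.inl (circle_ne (z := 0) (by simp) hx).1)).continuousWithinAt

theorem circleIntegrable_const_mul {f : ℂ → ℂ} (hf : CircleIntegrable f 0 1) (a : ℂ) :
    CircleIntegrable (fun x => a * f x) 0 1 := hf.const_smul (a := a)

theorem integral_zpow_succ_div (e : ℤ) {z : ℂ} (hz : ‖z‖ ≠ 1) :
    (∮ x in C(0, 1), x ^ (e + 1) / (x - z)) =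
      (∮ x in C(0, 1), x ^ e) + z * ∮ x in C(0, 1), x ^ e / (x - z) := by
  rw [← circleIntegral.integral_const_mul,
    ← circleIntegral.integral_add (circleIntegrable_zpow e)
      (circleIntegrable_const_mul (circleIntegrable_zpow_div e hz) z)]
  refine circleIntegral.integral_congr zero_le_one fun x hx => ?_
  obtain ⟨h1, h2⟩ := circle_ne hz hx
  rw [zpow_add_one₀ h1]
  field_simp
  ring

/-- Induction in both directions from `e = 0`, using `x^{e+1} / (x - z) = x^e + z x^e / (x - z)`.
The downward step divides by `z`, hence `z ≠ 0`. -/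
theorem integral_zpow_div (e : ℤ) {z : ℂ} (hz : ‖z‖ ≠ 1) (hz0 : z ≠ 0) :
    (∮ x in C(0, 1), x ^ e / (x - z)) = 2 * Real.pi * Complex.I * torusTerm e z := by
  have hstep : ∀ e : ℤ, 2 * Real.pi * Complex.I * torusTerm (e + 1) z =
      (∮ x in C(0, 1), x ^ e) + z * (2 * Real.pi * Complex.I * torusTerm e z) := by
    intro e
    rw [integral_zpow, torusTerm, torusTerm, innerPart, innerPart, outerPart, outerPart]
    have h1 : z ^ (e + 1) = z * z ^ e := by rw [zpow_add_one₀ hz0]; ring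
    rcases lt_trichotomy e (-1) with h | h | h
    · rw [if_neg (show ¬ 0 ≤ e by omega), if_neg (show ¬ 0 ≤ e + 1 by omega),
        if_neg (show ¬ 0 ≤ e by omega), if_neg (show ¬ 0 ≤ e + 1 by omega), if_neg h.ne, h1]
      split_ifs <;> ring
    · subst h
      norm_num
      split_ifs
      · ring
      · field_simp
        ring
    · rw [if_pos (show 0 ≤ e by omega), if_pos (show 0 ≤ e + 1 by omega),
        if_pos (show 0 ≤ e by omega), if_pos (show 0 ≤ e + 1 by omega), if_neg h.ne', h1]
      split_ifs <;> ring
  induction e using Int.induction_on with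
  | zero =>
    simp only [zpow_zero, one_div, torusTerm, innerPart, outerPart, le_refl, if_true]
    split_ifs with h
    · rw [circleIntegral.integral_sub_inv_of_mem_ball (by simpa using h), mul_one]
    · rw [mul_zero]
      refine Complex.circleIntegral_eq_zero_of_differentiable_on_off_countable zero_le_one
        countable_empty ?_ ?_
      · refine ContinuousOn.inv₀ (by fun_prop) fun x hx => sub_ne_zero.2 ?_
        rintro rfl
        rw [mem_closedBall_zero_iff] at hx
        exact h (lt_of_le_of_ne hx hz)
      · intro x hx
        refine DifferentiableAt.inv (by fun_prop) (sub_ne_zero.2 ?_)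
        rintro rfl
        exact h (mem_ball_zero_iff.1 hx.1)
  | succ i ih => rw [integral_zpow_succ_div _ hz, ih, hstep]
  | pred i ih =>
    have h1 := integral_zpow_succ_div (-(i : ℤ) - 1) hz
    have h2 := hstep (-(i : ℤ) - 1)
    rw [sub_add_cancel] at h1 h2
    rw [ih, h2] at h1
    exact (mul_left_cancel₀ hz0 (add_left_cancel h1)).symm

theorem weightTorus_mul_eval {D n : ℕ} {Q : ℂ[X]} {x : ℂ} (hx : x ≠ 0) :
    weightTorus D n x * Q.eval x =
      ∑ j ∈ Finset.range (Q.natDegree + 1), Q.coeff j * x ^ ((j : ℤ) - (2 * n + D)) := by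
  rw [eval_eq_sum_range, Finset.mul_sum]
  refine Finset.sum_congr rfl fun j _ => ?_
  rw [weightTorus, mul_left_comm, ← zpow_natCast x j, ← zpow_add₀ hx]
  congr 2
  ring

theorem cauchy_integralTorus (D n : ℕ) (Q : ℂ[X]) {z : ℂ} (hz : ‖z‖ ≠ 1) (hz0 : z ≠ 0) :
    cauchy integralTorus (fun x => weightTorus D n x * Q.eval x) z =
      ∑ j ∈ Finset.range (Q.natDegree + 1), Q.coeff j * torusTerm ((j : ℤ) - (2 * n + D)) z := by
  have hpi := Complex.two_pi_I_ne_zero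
  have h1 : integralTorus (fun x => weightTorus D n x * Q.eval x / (x - z)) =
      ∑ j ∈ Finset.range (Q.natDegree + 1),
        Q.coeff j * (2 * Real.pi * Complex.I * torusTerm ((j : ℤ) - (2 * n + D)) z) := by
    rw [integralTorus]
    simp only [← integral_zpow_div _ hz hz0, ← circleIntegral.integral_const_mul]
    rw [← circleIntegral.integral_fun_sum]
    · refine circleIntegral.integral_congr zero_le_one fun x hx => ?_
      rw [weightTorus_mul_eval (circle_ne hz hx).1, Finset.sum_div]
      exact Finset.sum_congr rfl fun j _ => by ring
    · exact fun j _ => circleIntegrable_const_mul (circleIntegrable_zpow_div _ hz) _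
  rw [cauchy, h1, Finset.mul_sum]
  refine Finset.sum_congr rfl fun j _ => ?_
  field_simp

/-- Only the power `x^{-1}` has a nonzero integral, so the circle column tests a single coefficient
of `Q`. The proof also covers `natDegree` below `2n + D - 1`, where that coefficient is zero. -/
theorem integralTorus_weight {D n : ℕ} (hD : 0 < D) (Q : ℂ[X]) :
    integralTorus (fun x => weightTorus D n x * Q.eval x) =
      2 * Real.pi * Complex.I * Q.coeff (2 * n + D - 1) := by
  have h1 : integralTorus (fun x => weightTorus D n x * Q.eval x) =
      ∑ j ∈ Finset.range (Q.natDegree + 1),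
        Q.coeff j * ∮ x in C(0, 1), x ^ ((j : ℤ) - (2 * n + D)) := by
    rw [integralTorus]
    simp only [← circleIntegral.integral_const_mul]
    rw [← circleIntegral.integral_fun_sum]
    · refine circleIntegral.integral_congr zero_le_one fun x hx => ?_
      exact weightTorus_mul_eval (circle_ne (z := 0) (by simp) hx).1
    · exact fun j _ => circleIntegrable_const_mul (circleIntegrable_zpow _) _
  have h2 : ∀ j : ℕ, (j : ℤ) - (2 * n + D) = -1 ↔ j = 2 * n + D - 1 := fun j => by omega
  simp only [h1, integral_zpow, h2, mul_ite, mul_zero]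
  rw [Finset.sum_ite_eq']
  split_ifs with h
  · ring
  · rw [Finset.mem_range, not_lt] at h
    rw [coeff_eq_zero_of_natDegree_lt (by omega), mul_zero]

theorem notMem_torus_of_notMem_Sig {D : ℕ} (hD : 2 ≤ D) {z : ℂ} (hz : z ∉ Sig D) :
    ‖z‖ ≠ 1 ∧ z ≠ 0 :=
  ⟨fun h => hz ((mem_Sig_iff hD).2 (Or.inl h)), fun h => hz (h ▸ zero_mem_Sig hD)⟩

theorem continuousOn_torus_boundary {D : ℕ} (hD : 2 ≤ D) (e : ℤ) {f h : ℂ → ℂ}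
    (hf : ∀ x ∈ torus, ContinuousAt f x) (h1 : EqOn h f torus)
    (h2 : ∀ x, x ∉ torus → h x = torusTerm e x) : ContinuousOn h (Sig D \ selfInt D) := by
  intro x hx
  by_cases hxt : x ∈ torus
  · refine ((hf x hxt).continuousWithinAt (s := Sig D \ selfInt D)).congr_of_eventuallyEq ?_ (h1 hxt)
    filter_upwards [self_mem_nhdsWithin, nhdsWithin_le_nhds (eventually_mem_torus hD hxt hx.2)]
      with z hz hz2 using h1 (hz2 hz.1)
  · refine ContinuousAt.continuousWithinAt ?_
    refine (differentiableAt_torusTerm e hxt).continuousAt.congr ?_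
    filter_upwards [isClosed_torus.isOpen_compl.mem_nhds hxt] with z hz using (h2 z hz).symm

open Classical in
theorem hasJump_torusTerm {D : ℕ} (hD : 2 ≤ D) (e : ℤ) :
    HasJump D (torusTerm e) fun x => torus.indicator (fun x => x ^ e) x := by
  have hne : ∀ x ∈ torus, x ≠ 0 := fun x hx h => by
    subst h; simp [torus] at hx
  refine ⟨fun z => if z ∈ torus then innerPart e z else torusTerm e z,
    fun z => if z ∈ torus then outerPart e z else torusTerm e z,
    continuousOn_torus_boundary hD e (f := innerPart e)
      (fun x _ => (differentiableAt_innerPart e x).continuousAt) (fun x hx => if_pos hx)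
      fun x hx => if_neg hx,
    continuousOn_torus_boundary hD e (f := outerPart e)
      (fun x hx => (differentiableAt_outerPart e (hne x hx)).continuousAt) (fun x hx => if_pos hx)
      fun x hx => if_neg hx, fun x hx => ?_⟩
  by_cases hxt : x ∈ torus
  · obtain ⟨hl, hr⟩ := leftSide_of_mem_torus hxt hx.2 hD
    simp only [hxt, if_true, indicator_of_mem]
    refine ⟨?_, ?_, innerPart_eq e x⟩
    · refine ((differentiableAt_innerPart e x).continuousAt.tendsto.mono_left
        nhdsWithin_le_nhds).congr' ?_
      filter_upwards [self_mem_nhdsWithin] with z hz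
      rw [hl] at hz
      exact (torusTerm_of_lt hz.2).symm
    · refine ((differentiableAt_outerPart e (hne x hxt)).continuousAt.tendsto.mono_left
        nhdsWithin_le_nhds).congr' ?_
      filter_upwards [self_mem_nhdsWithin] with z hz
      rw [hr] at hz
      exact (torusTerm_of_ge (le_of_lt hz.2)).symm
  · simp only [hxt, if_false, not_false_eq_true, indicator_of_notMem, add_zero, and_true]
    have h := (differentiableAt_torusTerm e hxt).continuousAt.tendsto
    exact ⟨h.mono_left nhdsWithin_le_nhds, h.mono_left nhdsWithin_le_nhds⟩

theorem boundedNear_torusTerm {D : ℕ} (e : ℤ) : BoundedNear D (torusTerm e) := by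
  intro s _
  obtain ⟨M, hM⟩ := ContinuousAt.exists_eventually_norm_le
    (differentiableAt_innerPart e s).continuousAt (Sig D)ᶜ
  by_cases hs : s = 0
  · refine ⟨M, ?_⟩
    have h1 : ∀ᶠ z : ℂ in 𝓝 s, ‖z‖ < 1 :=
      continuous_norm.continuousAt.eventually_lt_const (by simp [hs])
    filter_upwards [hM, nhdsWithin_le_nhds h1] with z hz hz1
    rwa [torusTerm_of_lt hz1]
  · obtain ⟨N, hN⟩ := ContinuousAt.exists_eventually_norm_le
      (differentiableAt_outerPart e hs).continuousAt (Sig D)ᶜ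
    refine ⟨max M N, ?_⟩
    filter_upwards [hM, hN] with z h1 h2
    unfold torusTerm
    split_ifs
    · exact h1.trans (le_max_left _ _)
    · exact h2.trans (le_max_right _ _)

theorem isBigO_mul_torusTerm (D : ℕ) (e : ℤ) :
    (fun z => z * torusTerm e z - if e = -1 then -1 else 0) =O[farOff D] fun z => z⁻¹ := by
  refine Asymptotics.IsBigO.of_bound 1 ?_
  filter_upwards [eventually_farOff_norm D 1] with z hz
  have hz0 : z ≠ 0 := norm_pos_iff.1 (zero_lt_one.trans_le hz)
  rw [torusTerm_of_ge hz, outerPart, one_mul]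
  split_ifs with h1 h2 h2
  · omega
  · simp
  · subst h2
    rw [zpow_neg_one, mul_neg, mul_inv_cancel₀ hz0]
    simp
  · rw [mul_neg, sub_zero, norm_neg, mul_comm, ← zpow_add_one₀ hz0, norm_zpow, norm_inv,
      ← zpow_neg_one]
    exact zpow_le_zpow_right₀ hz (by omega)

/-! ### The columns of the explicit solution -/

section Columns

variable {V : ℝ[X]} {D : ℕ} (hV : V.natDegree = D) (hD : 2 ≤ D) (he : Even D)
  (hl : 0 < V.leadingCoeff) (n : ℕ) (Q : ℂ[X])

theorem cauchyRow_zero (V : ℝ[X]) (D n : ℕ) (Q : ℂ[X]) (z : ℂ) {c : Fin (D + 2)}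
    (hc : (c : ℕ) = 0) : cauchyRow V D n Q z c = Q.eval z := by
  rw [cauchyRow, if_pos hc]

include hV hD he hl in
theorem cauchyRow_one {z : ℂ} (hz : z ∉ Sig D) {c : Fin (D + 2)} (hc : (c : ℕ) = 1) :
    cauchyRow V D n Q z c =
      cauchy (integralGam D (D / 2)) (fun x => weightReal V x * Q.eval x) z := by
  rw [cauchyRow, if_neg (by omega), if_pos hc]
  exact (gamDecay_weightReal hV hD hl (D / 2) Q).cauchy_integralReal_eq hD he hz

include hD in
theorem cauchyRow_torus {z : ℂ} (hz : z ∉ Sig D) {c : Fin (D + 2)} (hc : (c : ℕ) = D + 1) :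
    cauchyRow V D n Q z c = ∑ j ∈ Finset.range (Q.natDegree + 1),
      Q.coeff j * torusTerm ((j : ℤ) - (2 * n + D)) z := by
  rw [cauchyRow, if_neg (by omega), if_neg (by omega), if_pos hc]
  exact cauchy_integralTorus D n Q (notMem_torus_of_notMem_Sig hD hz).1
    (notMem_torus_of_notMem_Sig hD hz).2

theorem cauchyRow_gam (V : ℝ[X]) (D n : ℕ) (Q : ℂ[X]) (z : ℂ) {c : Fin (D + 2)} (hc : 2 ≤ (c : ℕ))
    (hc' : (c : ℕ) ≠ D + 1) : cauchyRow V D n Q z c =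
      cauchy (integralGam D ((c : ℕ) - 1)) (fun x => weightGam V x * Q.eval x) z := by
  rw [cauchyRow, if_neg (by omega), if_neg (by omega), if_neg hc']

theorem column_cases {D : ℕ} (c : Fin (D + 2)) : (c : ℕ) = 0 ∨ (c : ℕ) = 1 ∨ (c : ℕ) = D + 1 ∨
    (2 ≤ (c : ℕ) ∧ (c : ℕ) ≠ D + 1 ∧ (c : ℕ) - 1 ≠ 0 ∧ (c : ℕ) - 1 < D) := by
  have := c.2
  omega

include hV hD he hl in
theorem differentiableAt_cauchyRow (c : Fin (D + 2)) {z : ℂ} (hz : z ∉ Sig D) :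
    DifferentiableAt ℂ (fun z => cauchyRow V D n Q z c) z := by
  have hnhds : (Sig D)ᶜ ∈ 𝓝 z := (isClosed_Sig hD).isOpen_compl.mem_nhds hz
  rcases column_cases c with hc | hc | hc | ⟨hc, hc', -, hk⟩
  · simp only [cauchyRow_zero V D n Q _ hc]
    fun_prop
  · refine ((gamDecay_weightReal hV hD hl (D / 2) Q).differentiableAt_cauchy hD (by omega)
      hz).congr_of_eventuallyEq ?_
    filter_upwards [hnhds] with w hw using cauchyRow_one hV hD he hl n Q hw hc
  · have h1 : DifferentiableAt ℂ (fun z => ∑ j ∈ Finset.range (Q.natDegree + 1),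
        Q.coeff j * torusTerm ((j : ℤ) - (2 * n + D)) z) z :=
      DifferentiableAt.fun_sum fun j _ =>
        (differentiableAt_torusTerm _ (notMem_torus_of_notMem_Sig hD hz).1).const_mul _
    refine h1.congr_of_eventuallyEq ?_
    filter_upwards [hnhds] with w hw using cauchyRow_torus hD n Q hw hc
  · simp only [cauchyRow_gam V D n Q _ hc hc']
    exact (gamDecay_weightGam hV hD hl _ Q).differentiableAt_cauchy hD hk hz

include hV hD he hl in
theorem hasJump_cauchyRow {c : Fin (D + 2)} (hc0 : (c : ℕ) ≠ 0) :
    HasJump D (fun z => cauchyRow V D n Q z c) fun x => Q.eval x * jumpRow V D n x c := by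
  rcases column_cases c with hc | hc | hc | ⟨hc, hc', hk0, hk⟩
  · exact absurd hc hc0
  · refine ((gamDecay_weightReal hV hD hl (D / 2) Q).hasJump_cauchy hD (by omega)
      (by omega)).congr (fun z hz => (cauchyRow_one hV hD he hl n Q hz hc).symm) fun x _ => ?_
    simp only [jumpRow]
    rw [if_neg (by omega), if_pos hc, realLine_eq_Gam hD he]
    by_cases hx : x ∈ Gam D (D / 2)
    · rw [indicator_of_mem hx, indicator_of_mem hx, mul_comm]
    · rw [indicator_of_notMem hx, indicator_of_notMem hx, mul_zero]
  · refine (hasJump_sum (Finset.range (Q.natDegree + 1)) fun j _ =>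
      (hasJump_torusTerm hD ((j : ℤ) - (2 * n + D))).const_mul (Q.coeff j)).congr
      (fun z hz => (cauchyRow_torus hD n Q hz hc).symm) fun x _ => ?_
    simp only [jumpRow]
    rw [if_neg (by omega), if_neg (by omega), if_pos hc]
    by_cases hx : x ∈ torus
    · simp only [indicator_of_mem hx]
      rw [mul_comm (eval x Q), weightTorus_mul_eval]
      rintro rfl
      simp [torus] at hx
    · simp only [indicator_of_notMem hx, mul_zero, Finset.sum_const_zero]
  · refine ((gamDecay_weightGam hV hD hl _ Q).hasJump_cauchy hD hk0 hk).congr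
      (fun z hz => (cauchyRow_gam V D n Q z hc hc').symm) fun x _ => ?_
    simp only [jumpRow]
    rw [if_neg (by omega), if_neg (by omega), if_neg hc']
    by_cases hx : x ∈ Gam D ((c : ℕ) - 1)
    · rw [indicator_of_mem hx, indicator_of_mem hx, mul_comm]
    · rw [indicator_of_notMem hx, indicator_of_notMem hx, mul_zero]

include hV hD he hl in
theorem boundedNear_cauchyRow (c : Fin (D + 2)) :
    BoundedNear D fun z => cauchyRow V D n Q z c := by
  rcases column_cases c with hc | hc | hc | ⟨hc, hc', -, hk⟩
  · simp only [cauchyRow_zero V D n Q _ hc]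
    exact Continuous.boundedNear (by fun_prop) D
  · exact ((gamDecay_weightReal hV hD hl (D / 2) Q).boundedNear_cauchy hD (by omega)).congr
      fun z hz => (cauchyRow_one hV hD he hl n Q hz hc).symm
  · exact (boundedNear_sum (Finset.range (Q.natDegree + 1)) fun j _ =>
      (boundedNear_torusTerm ((j : ℤ) - (2 * n + D))).const_mul (Q.coeff j)).congr
      fun z hz => (cauchyRow_torus hD n Q hz hc).symm
  · exact ((gamDecay_weightGam hV hD hl _ Q).boundedNear_cauchy hD hk).congr
      fun z hz => (cauchyRow_gam V D n Q z hc hc').symm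

include hV hD hl in
-- The functional `β` is the first coefficient of the column at infinity. On `Γ_k` the remainder is
-- the transform of `x` times the density, again `O(z⁻¹)`; on the circle the expansion is done power
-- by power.
theorem mul_cauchyRow_sub_beta {c : Fin (D + 2)} (hc : 2 ≤ (c : ℕ)) :
    (fun z => z * cauchyRow V D n Q z c - beta V D n ((c : ℕ) - 1) Q) =O[farOff D]
      fun z => z⁻¹ := by
  rcases column_cases c with hc0 | hc1 | hc1 | ⟨-, hc', hk0, hk⟩
  · omega
  · omega
  · have h1 : (fun z => ∑ j ∈ Finset.range (Q.natDegree + 1), Q.coeff j *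
        (z * torusTerm ((j : ℤ) - (2 * n + D)) z - if (j : ℤ) - (2 * n + D) = -1 then -1 else 0))
        =O[farOff D] fun z => z⁻¹ :=
      Asymptotics.IsBigO.fun_sum fun j _ => (isBigO_mul_torusTerm D _).const_mul_left _
    refine h1.congr' ?_ EventuallyEq.rfl
    filter_upwards [eventually_farOff_notMem D] with z hz
    have h2 : ∀ j : ℕ, (j : ℤ) - (2 * n + D) = -1 ↔ j = 2 * n + D - 1 := fun j => by omega
    have hpi := Complex.two_pi_I_ne_zero
    rw [cauchyRow_torus hD n Q hz hc1, beta, if_pos (by omega), integralTorus_weight (by omega)]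
    simp only [mul_sub, Finset.sum_sub_distrib, h2, mul_ite, mul_zero]
    rw [Finset.sum_ite_eq', Finset.mul_sum]
    congr 1
    · exact Finset.sum_congr rfl fun j _ => by ring
    · split_ifs with h
      · field_simp
      · rw [Finset.mem_range, not_lt] at h
        rw [coeff_eq_zero_of_natDegree_lt (by omega)]
        simp
  · have hf := gamDecay_weightGam hV hD hl ((c : ℕ) - 1) Q
    refine (hf.id_mul.isBigO_inv hD hk).congr' ?_ EventuallyEq.rfl
    filter_upwards [eventually_farOff_notMem D] with z hz
    rw [cauchyRow_gam V D n Q z hc hc', hf.mul_cauchy hD hk hz, beta, if_neg (by omega)]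
    ring

theorem alpha_eq (V : ℝ[X]) (i j : ℕ) (Q : ℂ[X]) : alpha V (i + j) Q = alpha V i (X ^ j * Q) := by
  simp only [alpha, eval_mul, eval_pow, eval_X]
  congr 1
  ext x
  ring

theorem alpha_zero (V : ℝ[X]) (Q : ℂ[X]) :
    alpha V 0 Q = integralReal fun x => weightReal V x * Q.eval x := by
  simp [alpha]

include hV hD he hl in
theorem mul_cauchyRow_one {z : ℂ} (hz : z ∉ Sig D) {c : Fin (D + 2)} (hc : (c : ℕ) = 1) :
    z * cauchyRow V D n Q z c =
      cauchyRow V D n (X * Q) z c - 1 / (2 * Real.pi * Complex.I) * alpha V 0 Q := by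
  have hf := gamDecay_weightReal hV hD hl (D / 2) Q
  rw [cauchyRow_one hV hD he hl n Q hz hc, hf.mul_cauchy hD (by omega) hz,
    cauchyRow_one hV hD he hl n _ hz hc, alpha_zero, hf.integralReal_eq hD he]
  simp only [eval_mul, eval_X, mul_left_comm]

include hV hD he hl in
theorem pow_mul_cauchyRow_one {m : ℕ} (hm : ∀ j < m, alpha V j Q = 0) {z : ℂ} (hz : z ∉ Sig D)
    {c : Fin (D + 2)} (hc : (c : ℕ) = 1) :
    z ^ m * cauchyRow V D n Q z c = cauchyRow V D n (X ^ m * Q) z c := by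
  induction m with
  | zero => simp
  | succ m ih =>
    rw [pow_succ', mul_assoc, ih fun j hj => hm j (by omega),
      mul_cauchyRow_one hV hD he hl n _ hz hc, ← alpha_eq, zero_add, hm m (by omega), mul_zero,
      sub_zero, pow_succ' X, mul_assoc]

include hV hD he hl in
theorem isBigO_cauchyRow {c : Fin (D + 2)} (hc0 : (c : ℕ) ≠ 0) :
    (fun z => cauchyRow V D n Q z c) =O[farOff D] fun z => z⁻¹ := by
  rcases Nat.lt_or_ge (c : ℕ) 2 with hc | hc
  · refine ((gamDecay_weightReal hV hD hl (D / 2) Q).isBigO_inv hD (by omega)).congr' ?_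
      EventuallyEq.rfl
    filter_upwards [eventually_farOff_notMem D] with z hz
    exact (cauchyRow_one hV hD he hl n Q hz (by omega)).symm
  · refine isBigO_inv_of_mul ?_
    have h1 : (fun z : ℂ => z⁻¹) =O[farOff D] fun _ => (1 : ℂ) := by
      refine Asymptotics.IsBigO.of_bound 1 ?_
      filter_upwards [eventually_farOff_norm D 1] with z hz
      rw [norm_inv, norm_one, mul_one]
      exact inv_le_one_of_one_le₀ hz
    have h2 := ((mul_cauchyRow_sub_beta hV hD hl n Q hc).trans h1).add
      (Asymptotics.isBigO_const_const (beta V D n ((c : ℕ) - 1) Q) (one_ne_zero (α := ℂ)) (farOff D))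
    simpa using h2

include hV hD he hl in
-- While moments vanish, powers of `z` pass under the integral freely; the next power releases the
-- first moment that need not vanish, as the leading coefficient.
theorem pow_mul_cauchyRow_add_alpha {m : ℕ} (hm : ∀ j < m, alpha V j Q = 0) {c : Fin (D + 2)}
    (hc : (c : ℕ) = 1) :
    (fun z => z ^ (m + 1) * cauchyRow V D n Q z c + 1 / (2 * Real.pi * Complex.I) * alpha V m Q)
      =O[farOff D] fun z => z⁻¹ := by
  refine (isBigO_cauchyRow hV hD he hl n (X ^ (m + 1) * Q) (c := c) (by omega)).congr' ?_
    EventuallyEq.rfl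
  filter_upwards [eventually_farOff_notMem D] with z hz
  rw [pow_succ' z, mul_assoc z, pow_mul_cauchyRow_one hV hD he hl n Q hm hz hc,
    mul_cauchyRow_one hV hD he hl n _ hz hc, ← alpha_eq, zero_add, pow_succ' X, mul_assoc]
  ring

theorem tendsto_inv_farOff (D : ℕ) : Tendsto (fun z : ℂ => z⁻¹) (farOff D) (𝓝 0) :=
  tendsto_inv₀_cobounded.mono_left inf_le_left

include hD in
theorem eq_zero_of_isBigO_inv {a : ℂ} (h : (fun _ => a) =O[farOff D] fun z => z⁻¹) : a = 0 := by
  have := farOff_neBot hD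
  exact tendsto_nhds_unique tendsto_const_nhds (h.trans_tendsto (tendsto_inv_farOff D))

include hV hD he hl in
-- Induction: dropping one power of `z` only weakens the hypothesis for `‖z‖ ≥ 1`, which gives the
-- lower moments. The next moment is then a constant that is `O(z⁻¹)` near infinity, hence zero.
theorem alpha_eq_zero_of_isBigO {c : Fin (D + 2)} (hc : (c : ℕ) = 1) (m : ℕ)
    (h : (fun z => z ^ m * cauchyRow V D n Q z c) =O[farOff D] fun z => z⁻¹) :
    ∀ j < m, alpha V j Q = 0 := by
  induction m with
  | zero => simp
  | succ m ih =>
    have h1 : ∀ j < m, alpha V j Q = 0 := by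
      refine ih (Asymptotics.IsBigO.trans (Asymptotics.IsBigO.of_bound 1 ?_) h)
      filter_upwards [eventually_farOff_norm D 1] with z hz
      rw [pow_succ', mul_assoc, norm_mul z, one_mul]
      exact le_mul_of_one_le_left (norm_nonneg _) hz
    have h2 := (pow_mul_cauchyRow_add_alpha hV hD he hl n Q h1 hc).sub h
    simp only [add_sub_cancel_left] at h2
    have h3 := eq_zero_of_isBigO_inv hD h2
    have hpi := Complex.two_pi_I_ne_zero
    intro j hj
    rcases Nat.lt_succ_iff_lt_or_eq.1 hj with h | rfl
    · exact h1 j h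
    · simpa [hpi] using h3

include hV hD hl in
theorem beta_eq_zero_of_isBigO {c : Fin (D + 2)} (hc : 2 ≤ (c : ℕ))
    (h : (fun z => z * cauchyRow V D n Q z c) =O[farOff D] fun z => z⁻¹) :
    beta V D n ((c : ℕ) - 1) Q = 0 := by
  have h2 := h.sub (mul_cauchyRow_sub_beta hV hD hl n Q hc)
  simp only [sub_sub_cancel] at h2
  exact eq_zero_of_isBigO_inv hD h2

end Columns

/-! ### Removable singularities along the contour -/

/-- Morera's theorem. Cauchy's theorem for a rectangle needs only continuity up to the boundary, so
rectangles whose interior misses the axis have zero boundary integral; one that crosses the axis is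
cut along it. -/
theorem differentiableOn_ball_of_off_real {f : ℂ → ℂ} {r : ℝ}
    (hc : ContinuousOn f (Metric.ball 0 r))
    (hd : ∀ w ∈ Metric.ball (0 : ℂ) r, w.im ≠ 0 → DifferentiableAt ℂ f w) :
    DifferentiableOn ℂ f (Metric.ball 0 r) := by
  refine (Complex.IsConservativeOn.isExactOn_ball hc ?_).differentiableOn Metric.isOpen_ball
  have key : ∀ z w : ℂ, Complex.Rectangle z w ⊆ Metric.ball 0 r →
      (0 : ℝ) ∉ Ioo (min z.im w.im) (max z.im w.im) →
      Complex.wedgeIntegral z w f + Complex.wedgeIntegral w z f = 0 := by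
    intro z w hzw h0
    rw [Complex.wedgeIntegral_add_wedgeIntegral_eq]
    refine Complex.integral_boundary_rect_eq_zero_of_continuousOn_of_differentiableOn f z w
      (hc.mono hzw) fun u hu => (hd u (hzw ?_) ?_).differentiableWithinAt
    · exact ⟨Ioo_subset_Icc_self hu.1, Ioo_subset_Icc_self hu.2⟩
    · exact fun h => h0 (h ▸ hu.2)
  intro z w hzw
  rw [← add_eq_zero_iff_eq_neg]
  by_cases h0 : (0 : ℝ) ∈ Ioo (min z.im w.im) (max z.im w.im)
  · have h0' : (0 : ℝ) ∈ uIcc z.im w.im := Ioo_subset_Icc_self h0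
    have hre : ∀ a b : ℂ, ((a.re : ℂ) + b.im * Complex.I).re = a.re := by simp
    have him : ∀ a b : ℂ, ((a.re : ℂ) + b.im * Complex.I).im = b.im := by simp
    -- The corners `w.re` and `z.re`, viewed in `ℂ`, lie on the axis. The rectangles spanned by `z,
    -- w.re` and by `z.re, w` are the two pieces, and their edges along the axis cancel.
    have h1 := key z w.re (by
      refine Subset.trans (fun u hu => Complex.mem_reProdIm.2 ⟨?_, ?_⟩) hzw
      · simpa using hu.1
      · exact uIcc_subset_uIcc_left h0' (by simpa using hu.2)) (by
      rw [Complex.ofReal_im]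
      rintro ⟨h1, h2⟩
      rcases le_total z.im 0 with h | h
      · rw [max_eq_right h] at h2; exact lt_irrefl _ h2
      · rw [min_eq_right h] at h1; exact lt_irrefl _ h1)
    have h2 := key z.re w (by
      refine Subset.trans (fun u hu => Complex.mem_reProdIm.2 ⟨?_, ?_⟩) hzw
      · simpa using hu.1
      · exact uIcc_subset_uIcc_right h0' (by simpa using hu.2)) (by
      rw [Complex.ofReal_im]
      rintro ⟨h1, h2⟩
      rcases le_total w.im 0 with h | h
      · rw [max_eq_left h] at h2; exact lt_irrefl _ h2
      · rw [min_eq_left h] at h1; exact lt_irrefl _ h1)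
    rw [Complex.wedgeIntegral_add_wedgeIntegral_eq] at h1 h2 ⊢
    simp only [Complex.ofReal_re, Complex.ofReal_im] at h1 h2
    have hint : ∀ a ∈ uIcc z.re w.re, ∀ s ∈ uIcc z.im w.im, ∀ t ∈ uIcc z.im w.im,
        IntervalIntegrable (fun y : ℝ => f (a + y * Complex.I)) volume s t := by
      intro a ha s hs t ht
      refine ContinuousOn.intervalIntegrable (hc.comp (by fun_prop) fun y hy => hzw ⟨?_, ?_⟩)
      · simpa using ha
      · simpa using uIcc_subset_uIcc hs ht hy
    have e1 := intervalIntegral.integral_add_adjacent_intervals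
      (hint w.re right_mem_uIcc z.im left_mem_uIcc 0 h0')
      (hint w.re right_mem_uIcc 0 h0' w.im right_mem_uIcc)
    have e2 := intervalIntegral.integral_add_adjacent_intervals
      (hint z.re left_mem_uIcc z.im left_mem_uIcc 0 h0')
      (hint z.re left_mem_uIcc 0 h0' w.im right_mem_uIcc)
    rw [← e1, ← e2]
    simp only [smul_eq_mul] at h1 h2 ⊢
    linear_combination h1 + h2
  · exact key z w hzw h0

/-- The map `w ↦ x e^{cw}` straightens the contour: it sends the real axis to the ray through `x` if
`c = 1`, and to the circle through `x` if `c = I`. The logarithm inverts it near `x`. -/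
theorem differentiableAt_of_chart {F : ℂ → ℂ} {x c : ℂ} (hx : x ≠ 0) (hc : c ≠ 0)
    (hF : ∀ᶠ z in 𝓝 x, ContinuousAt F z)
    (hd : ∀ᶠ w in 𝓝 (0 : ℂ), w.im ≠ 0 → DifferentiableAt ℂ F (x * Complex.exp (c * w))) :
    DifferentiableAt ℂ F x := by
  have hchart : Continuous fun w : ℂ => x * Complex.exp (c * w) := by fun_prop
  have h0 : (fun w : ℂ => x * Complex.exp (c * w)) 0 = x := by simp
  have hF' : ∀ᶠ w in 𝓝 (0 : ℂ), ContinuousAt F (x * Complex.exp (c * w)) :=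
    hchart.continuousAt.eventually (p := fun z => ContinuousAt F z) (by rwa [h0])
  obtain ⟨r, hr, h⟩ := Metric.eventually_nhds_iff_ball.1 (hF'.and hd)
  have h1 : DifferentiableOn ℂ (fun w => F (x * Complex.exp (c * w))) (Metric.ball 0 r) := by
    refine differentiableOn_ball_of_off_real (fun w hw => ?_) fun w hw him => ?_
    · exact (ContinuousAt.comp (f := fun w : ℂ => x * Complex.exp (c * w)) (h w hw).1
        hchart.continuousAt).continuousWithinAt
    · exact DifferentiableAt.fun_comp' (g := F) w ((h w hw).2 him) (by fun_prop)
  have h2 : DifferentiableAt ℂ (fun w => F (x * Complex.exp (c * w))) 0 :=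
    h1.differentiableAt (Metric.ball_mem_nhds 0 hr)
  have h3 : DifferentiableAt ℂ (fun z : ℂ => Complex.log (z / x) / c) x :=
    ((differentiableAt_id.div_const x).clog (by simp [hx])).div_const c
  have h4 : Complex.log (x / x) / c = 0 := by simp [hx]
  have h5 : DifferentiableAt ℂ (fun z => F (x * Complex.exp (c * (Complex.log (z / x) / c)))) x :=
    DifferentiableAt.fun_comp' (g := fun w => F (x * Complex.exp (c * w))) x (by rwa [h4]) h3
  refine h5.congr_of_eventuallyEq ?_
  filter_upwards [isOpen_ne.mem_nhds hx] with z hz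
  have hz' : z ≠ 0 := hz
  rw [mul_div_cancel₀ _ hc, Complex.exp_log (div_ne_zero hz' hx), mul_div_cancel₀ _ hx]

theorem exists_chart {D : ℕ} (hD : 2 ≤ D) {x : ℂ} (hx : x ∈ Sig D \ selfInt D) :
    ∃ c : ℂ, c ≠ 0 ∧ ∀ᶠ w in 𝓝 (0 : ℂ), w.im ≠ 0 → x * Complex.exp (c * w) ∉ Sig D := by
  have hx0 : x ≠ 0 := fun h => hx.2 (Or.inl h)
  have hchart : ∀ c : ℂ, Continuous fun w : ℂ => x * Complex.exp (c * w) := fun c => by fun_prop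
  have h0 : ∀ c : ℂ, (fun w : ℂ => x * Complex.exp (c * w)) 0 = x := by simp
  rcases (mem_Sig_iff hD).1 hx.1 with h | ⟨k, hk, h⟩
  · refine ⟨Complex.I, Complex.I_ne_zero, ?_⟩
    have h1 : ∀ᶠ w in 𝓝 (0 : ℂ), x * Complex.exp (Complex.I * w) ∈ Sig D →
        x * Complex.exp (Complex.I * w) ∈ torus :=
      (hchart _).continuousAt.eventually (p := fun z => z ∈ Sig D → z ∈ torus)
        (by rw [h0]; exact eventually_mem_torus hD h hx.2)
    filter_upwards [h1] with w hw him hS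
    have h2 : ‖x * Complex.exp (Complex.I * w)‖ = 1 := hw hS
    rw [norm_mul, show ‖x‖ = 1 from h, one_mul, Complex.norm_exp, Real.exp_eq_one_iff] at h2
    simp at h2
    exact him h2
  · refine ⟨1, one_ne_zero, ?_⟩
    have h1 : ∀ᶠ w in 𝓝 (0 : ℂ), x * Complex.exp (1 * w) ∈ Sig D →
        x * Complex.exp (1 * w) ∈ ray D k :=
      (hchart _).continuousAt.eventually (p := fun z => z ∈ Sig D → z ∈ ray D k)
        (by rw [h0]; exact eventually_mem_ray hD hk h hx.2)
    have h2 : ∀ᶠ w : ℂ in 𝓝 0, |w.im| < Real.pi :=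
      (continuous_abs.comp Complex.continuous_im).continuousAt.eventually_lt_const
        (by simpa using Real.pi_pos)
    filter_upwards [h1, h2] with w hw hpi him hS
    obtain ⟨p1, p2⟩ := div_mem_posHalfLine h hx0
    have h3 := (mem_ray_iff.1 (hw hS)).2
    rw [one_mul, mul_div_right_comm, Complex.mul_im, p2, zero_mul, add_zero, Complex.exp_im] at h3
    rcases mul_eq_zero.1 h3 with h4 | h4
    · exact p1.ne' h4
    · rcases mul_eq_zero.1 h4 with h5 | h5
      · exact (Real.exp_pos _).ne' h5
      · rw [abs_lt] at hpi
        exact him ((Real.sin_eq_zero_iff_of_lt_of_lt hpi.1 hpi.2).1 h5)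

theorem eventually_mem_sides {D : ℕ} (hD : 2 ≤ D) {x : ℂ} (hx : x ∈ Sig D \ selfInt D) :
    ∀ᶠ z in 𝓝 x, z ∈ Sig D ∨ z ∈ leftSide D x ∨ z ∈ rightSide D x := by
  have hx0 : x ≠ 0 := fun h => hx.2 (Or.inl h)
  rcases (mem_Sig_iff hD).1 hx.1 with h | ⟨k, hk, h⟩
  · obtain ⟨hl, hr⟩ := leftSide_of_mem_torus h hx.2 hD
    refine Eventually.of_forall fun z => ?_
    rw [hl, hr]
    rcases lt_trichotomy ‖z‖ 1 with h1 | h1 | h1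
    · exact Or.inr (Or.inl h1)
    · exact Or.inl ((mem_Sig_iff hD).2 (Or.inl h1))
    · exact Or.inr (Or.inr h1)
  · have h3 : ∀ᶠ z in 𝓝 x, 0 < (z / omega D ^ k).re :=
      (Complex.continuous_re.comp (continuous_div_omega D k)).continuousAt.eventually_const_lt
        (div_mem_posHalfLine h hx0).1
    filter_upwards [h3] with z hz
    rcases eq_or_ne k 0 with rfl | hk0
    · obtain ⟨hl, hr⟩ := leftSide_of_mem_ray_zero h hx.2 hD
      rw [hl, hr]
      rcases lt_trichotomy z.im 0 with h1 | h1 | h1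
      · exact Or.inr (Or.inr h1)
      · exact Or.inl ((mem_Sig_iff hD).2 (Or.inr ⟨0, hk, mem_ray_iff.2 ⟨hz.le, by simpa using h1⟩⟩))
      · exact Or.inr (Or.inl h1)
    · obtain ⟨hl, hr⟩ := leftSide_of_mem_ray h hx.2 hk0 hk
      rw [hl, hr]
      rcases lt_trichotomy (z / omega D ^ k).im 0 with h1 | h1 | h1
      · exact Or.inr (Or.inl h1)
      · exact Or.inl ((mem_Sig_iff hD).2 (Or.inr ⟨k, hk, mem_ray_iff.2 ⟨hz.le, h1⟩⟩))
      · exact Or.inr (Or.inr h1)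

theorem isOpen_compl_selfInt (D : ℕ) : IsOpen (selfInt D)ᶜ := (finite_selfInt D).isClosed.isOpen_compl

theorem nhds_le_sides {D : ℕ} (hD : 2 ≤ D) {x : ℂ} (hx : x ∈ Sig D \ selfInt D) :
    𝓝 x ≤ 𝓝[Sig D \ selfInt D] x ⊔ (𝓝[(Sig D)ᶜ ∩ leftSide D x] x ⊔
      𝓝[(Sig D)ᶜ ∩ rightSide D x] x) := by
  rw [← nhdsWithin_union, ← nhdsWithin_union, nhdsWithin_eq_nhds.2]
  filter_upwards [eventually_mem_sides hD hx, (isOpen_compl_selfInt D).mem_nhds hx.2] with z h1 h2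
  by_cases hz : z ∈ Sig D
  · exact Or.inl ⟨hz, h2⟩
  · exact Or.inr ((h1.resolve_left hz).imp (fun h => ⟨hz, h⟩) fun h => ⟨hz, h⟩)

open Classical in
-- Filling in the common boundary values gives a function continuous off `S`; Morera in a
-- straightening chart makes it analytic there, and boundedness makes the finitely many points of
-- `S` removable.
theorem exists_entire_extension {D : ℕ} (hD : 2 ≤ D) {f : ℂ → ℂ}
    (hd : ∀ z, z ∉ Sig D → DifferentiableAt ℂ f z) (hj : HasJump D f fun _ => 0)
    (hb : BoundedNear D f) : ∃ g : ℂ → ℂ, Differentiable ℂ g ∧ EqOn g f (Sig D)ᶜ := by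
  obtain ⟨fp, fm, hfp, -, h⟩ := hj
  set F : ℂ → ℂ := fun z => if z ∈ Sig D then fp z else f z with hF
  have hFoff : EqOn F f (Sig D)ᶜ := fun z hz => if_neg hz
  have hFon : EqOn F fp (Sig D) := fun z hz => if_pos hz
  have hopen := (isClosed_Sig hD).isOpen_compl
  have hdF : ∀ z, z ∉ Sig D → DifferentiableAt ℂ F z := fun z hz =>
    (hd z hz).congr_of_eventuallyEq (hFoff.eventuallyEq_of_mem (hopen.mem_nhds hz))
  have hcF : ∀ z, z ∉ selfInt D → ContinuousAt F z := by
    intro x hxS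
    by_cases hx : x ∈ Sig D
    · have hx' : x ∈ Sig D \ selfInt D := ⟨hx, hxS⟩
      obtain ⟨h1, h2, h3⟩ := h x hx'
      rw [add_zero] at h3
      rw [← h3] at h2
      rw [ContinuousAt, hFon hx]
      refine Tendsto.mono_left ?_ (nhds_le_sides hD hx')
      refine tendsto_sup.2 ⟨?_, tendsto_sup.2 ⟨?_, ?_⟩⟩
      · refine (hfp x hx').tendsto.congr' ?_
        filter_upwards [self_mem_nhdsWithin] with z hz using (hFon hz.1).symm
      · refine h1.congr' ?_
        filter_upwards [self_mem_nhdsWithin] with z hz using (hFoff hz.1).symm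
      · refine h2.congr' ?_
        filter_upwards [self_mem_nhdsWithin] with z hz using (hFoff hz.1).symm
    · exact (hdF x hx).continuousAt
  have hdF' : ∀ z, z ∉ selfInt D → DifferentiableAt ℂ F z := by
    intro x hxS
    by_cases hx : x ∈ Sig D
    · obtain ⟨c, hc, hchart⟩ := exists_chart hD ⟨hx, hxS⟩
      refine differentiableAt_of_chart (fun h => hxS (Or.inl h)) hc ?_ ?_
      · filter_upwards [(isOpen_compl_selfInt D).mem_nhds hxS] with z hz using hcF z hz
      · filter_upwards [hchart] with w hw him using hdF _ (hw him)
    · exact hdF x hx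
  refine ⟨fun z => if z ∈ selfInt D then limUnder (𝓝[≠] z) F else F z, fun x => ?_, fun z hz => ?_⟩
  · by_cases hx : x ∈ selfInt D
    · obtain ⟨M, hM⟩ := hb x hx
      rw [eventually_nhdsWithin_iff] at hM
      have hiso : ∀ᶠ z in 𝓝 x, z ∈ selfInt D → z = x := by
        have := ((finite_selfInt D).subset (sdiff_subset (t := {x}))).isClosed.isOpen_compl.mem_nhds
          (x := x) (fun h => h.2 rfl)
        filter_upwards [this] with z hz hzS
        by_contra hne
        exact hz ⟨hzS, hne⟩
      obtain ⟨r, hr, hball⟩ := Metric.eventually_nhds_iff_ball.1 (hM.and hiso)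
      have hdiff := Complex.differentiableOn_update_limUnder_of_bddAbove (f := F)
        (Metric.ball_mem_nhds x hr) (fun z hz => (hdF' z fun hzS =>
          hz.2 ((hball z hz.1).2 hzS)).differentiableWithinAt) ?_
      · refine (hdiff.differentiableAt (Metric.ball_mem_nhds x hr)).congr_of_eventuallyEq ?_
        filter_upwards [Metric.ball_mem_nhds x hr] with z hz
        by_cases hzx : z = x
        · subst hzx
          rw [if_pos hx, Function.update_self]
        · rw [if_neg fun hzS => hzx ((hball z hz).2 hzS), Function.update_of_ne hzx]
      · refine ⟨M, ?_⟩
        rintro _ ⟨z, hz, rfl⟩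
        have hzS : z ∉ selfInt D := fun hzS => hz.2 ((hball z hz.1).2 hzS)
        -- The point `z` may lie on `Σ`, where `hb` says nothing; the bound passes to `F z` as a
        -- limit from the dense complement.
        have hne : (𝓝[(Sig D)ᶜ] z).NeBot := mem_closure_iff_nhdsWithin_neBot.1
          (dense_compl_Sig hD z)
        refine le_of_tendsto ((hcF z hzS).norm.tendsto.mono_left
          (nhdsWithin_le_nhds (s := (Sig D)ᶜ))) ?_
        filter_upwards [self_mem_nhdsWithin,
          nhdsWithin_le_nhds (Metric.isOpen_ball.mem_nhds hz.1)] with w hw hwb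
        rw [hFoff hw]
        exact (hball w hwb).1 hw
    · refine (hdF' x hx).congr_of_eventuallyEq ?_
      filter_upwards [(isOpen_compl_selfInt D).mem_nhds hx] with z hz
      exact if_neg hz
  · have : z ∉ selfInt D := fun h => hz (selfInt_subset hD h)
    simp only
    rw [if_neg this, hFoff hz]

/-! ### Entire functions of polynomial growth -/

/-- Induction on the exponent: the slope of `g` at `0` is entire and grows one power slower. The
base case is Liouville's theorem. -/
theorem eq_polynomial_of_growth (m : ℕ) : ∀ {g : ℂ → ℂ}, Differentiable ℂ g →
    (∃ C, ∀ z, ‖g z‖ ≤ C * (1 + ‖z‖) ^ m) →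
    ∃ q : ℂ[X], q.natDegree ≤ m ∧ ∀ z, g z = q.eval z := by
  induction m with
  | zero =>
    rintro g hg ⟨C, hC⟩
    refine ⟨Polynomial.C (g 0), by simp, fun z => ?_⟩
    rw [eval_C]
    refine hg.apply_eq_apply_of_bounded ?_ z 0
    refine isBounded_iff_forall_norm_le.2 ⟨C, ?_⟩
    rintro _ ⟨z, rfl⟩
    simpa using hC z
  | succ m ih =>
    rintro g hg ⟨C, hC⟩
    have hd : Differentiable ℂ (dslope g 0) := by
      rw [← differentiableOn_univ]
      exact (Complex.differentiableOn_dslope univ_mem).2 hg.differentiableOn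
    have hC0 : 0 ≤ C := by simpa using (norm_nonneg _).trans (hC 0)
    obtain ⟨K, hK⟩ := (isCompact_closedBall (0 : ℂ) 1).exists_bound_of_continuousOn
      hd.continuous.continuousOn
    have hK0 : 0 ≤ K := (norm_nonneg _).trans (hK 0 (by simp))
    -- `K` covers the unit disc. Outside it `1 + ‖z‖ ≤ 2 ‖z‖`, and the factor `4` also absorbs the
    -- term `‖g 0‖ ≤ C`.
    obtain ⟨q, hq, hqe⟩ := ih hd ⟨K + 4 * C, fun z => by
      have h1 : 1 ≤ (1 + ‖z‖) ^ m := one_le_pow₀ (by linarith [norm_nonneg z])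
      rcases le_total ‖z‖ 1 with h | h
      · calc ‖dslope g 0 z‖ ≤ K * 1 := by rw [mul_one]; exact hK z (by simpa using h)
          _ ≤ (K + 4 * C) * (1 + ‖z‖) ^ m := mul_le_mul (by linarith) h1 zero_le_one (by linarith)
      · have hz0 : z ≠ 0 := norm_pos_iff.1 (by linarith)
        rw [dslope_of_ne _ hz0, slope_def_field, sub_zero, norm_div, div_le_iff₀ (by linarith)]
        have h2 : ‖g 0‖ ≤ C := by simpa using hC 0
        have h3 := hC z
        calc ‖g z - g 0‖ ≤ C * (1 + ‖z‖) ^ (m + 1) + C := (norm_sub_le _ _).trans (by linarith)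
          _ = C * ((1 + ‖z‖) ^ m * (1 + ‖z‖) + 1) := by ring
          _ ≤ C * (4 * (1 + ‖z‖) ^ m * ‖z‖) := by
            refine mul_le_mul_of_nonneg_left ?_ hC0
            nlinarith
          _ ≤ (K + 4 * C) * (1 + ‖z‖) ^ m * ‖z‖ := by
            have : 0 ≤ K * (1 + ‖z‖) ^ m * ‖z‖ := by positivity
            nlinarith⟩
    refine ⟨Polynomial.C (g 0) + X * q, ?_, fun z => ?_⟩
    · refine (natDegree_add_le _ _).trans (max_le (by simp) (natDegree_mul_le.trans ?_))
      have := natDegree_X_le (R := ℂ)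
      omega
    · have := sub_smul_dslope g 0 z
      rw [sub_zero, smul_eq_mul] at this
      simp only [eval_add, eval_C, eval_mul, eval_X, ← hqe]
      linear_combination -this

/-- The growth is known only off `Σ`, but the inequality is a closed condition and the complement of
`Σ` is dense. -/
theorem eq_polynomial_of_isBigO {D : ℕ} (hD : 2 ≤ D) {g : ℂ → ℂ} (hg : Differentiable ℂ g) {m : ℕ}
    (h : g =O[farOff D] fun z => z ^ m) :
    ∃ q : ℂ[X], q.natDegree ≤ m ∧ ∀ z, g z = q.eval z := by
  obtain ⟨C, hC⟩ := h.bound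
  rw [farOff, eventually_inf_principal] at hC
  obtain ⟨R, -, hR⟩ := Filter.hasBasis_cobounded_norm.mem_iff.1 hC
  obtain ⟨K, hK⟩ := (isCompact_closedBall (0 : ℂ) R).exists_bound_of_continuousOn
    hg.continuous.continuousOn
  have hfar : ∀ z : ℂ, R < ‖z‖ → ‖g z‖ ≤ C * ‖z ^ m‖ := by
    intro z hz
    have h1 : IsOpen {z : ℂ | R < ‖z‖} := isOpen_lt continuous_const continuous_norm
    have h2 : IsClosed {z : ℂ | ‖g z‖ ≤ C * ‖z ^ m‖} :=
      isClosed_le hg.continuous.norm (by fun_prop)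
    refine closure_minimal ?_ h2 ((dense_compl_Sig hD).open_subset_closure_inter h1 hz)
    rintro w ⟨hw, hw'⟩
    exact hR (show R ≤ ‖w‖ from le_of_lt hw) hw'
  refine eq_polynomial_of_growth m hg ⟨|C| + |K|, fun z => ?_⟩
  have h1 : 1 ≤ (1 + ‖z‖) ^ m := one_le_pow₀ (by linarith [norm_nonneg z])
  rcases le_or_gt ‖z‖ R with h | h
  · calc ‖g z‖ ≤ K := hK z (by simpa using h)
      _ ≤ (|C| + |K|) * 1 := by linarith [le_abs_self K, abs_nonneg C]
      _ ≤ _ := by gcongr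
  · calc ‖g z‖ ≤ C * ‖z ^ m‖ := hfar z h
      _ ≤ |C| * (1 + ‖z‖) ^ m := by
        rw [norm_pow]
        exact mul_le_mul (le_abs_self C) (by gcongr; linarith) (by positivity) (abs_nonneg C)
      _ ≤ _ := by gcongr; linarith [abs_nonneg K]

theorem eq_zero_of_isBigO_inv_farOff {D : ℕ} (hD : 2 ≤ D) {g : ℂ → ℂ} (hg : Differentiable ℂ g)
    (h : g =O[farOff D] fun z => z⁻¹) : ∀ z, g z = 0 := by
  have h1 : (fun z : ℂ => z⁻¹) =O[farOff D] fun z => z ^ 0 := by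
    simpa using (tendsto_inv_farOff D).isBigO_one ℂ
  obtain ⟨q, hq, hqe⟩ := eq_polynomial_of_isBigO hD hg (h.trans h1)
  rw [eq_C_of_natDegree_le_zero hq] at hqe
  simp only [eval_C] at hqe
  rw [funext hqe] at h
  intro z
  rw [hqe, eq_zero_of_isBigO_inv hD h]

/-! ### Bounds for exponential integrals along a ray -/

theorem eventually_le_derivative {u q : ℝ[X]} (h : q.natDegree + 2 ≤ u.natDegree)
    (hl : 0 < u.leadingCoeff) : ∀ᶠ t : ℝ in atTop, q.eval t ≤ (derivative u).eval t := by
  have hc : (derivative u).coeff (u.natDegree - 1) = u.leadingCoeff * u.natDegree := by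
    rw [coeff_derivative, Nat.sub_add_cancel (by omega), leadingCoeff, Nat.cast_sub (by omega)]
    push_cast
    ring
  have hpos : 0 < u.leadingCoeff * (u.natDegree : ℝ) := by
    have : (0 : ℝ) < u.natDegree := by exact_mod_cast (by omega)
    positivity
  have hn : (derivative u).natDegree = u.natDegree - 1 :=
    natDegree_eq_of_le_of_coeff_ne_zero (natDegree_derivative_le u) (by rw [hc]; exact hpos.ne')
  have hlt : q.natDegree < (derivative u).natDegree := by omega
  have hdeg : q.degree < (derivative u).degree := degree_lt_degree hlt
  have h1 : (derivative u - q).leadingCoeff = (derivative u).leadingCoeff :=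
    leadingCoeff_sub_of_degree_lt hdeg
  have h2 : (derivative u - q).degree = (derivative u).degree := degree_sub_eq_left_of_degree_lt hdeg
  have h3 := tendsto_atTop_of_leadingCoeff_nonneg (derivative u - q)
    (by rw [h2]; exact natDegree_pos_iff_degree_pos.1 (by omega))
    (by rw [h1, leadingCoeff, hn, hc]; exact hpos.le)
  filter_upwards [h3.eventually_ge_atTop 0] with t ht
  rw [eval_sub] at ht
  linarith

theorem norm_sub_le_of_exp_bound {φ φ' : ℝ → ℂ} {v : ℝ[X]} {a b : ℝ} (hab : a ≤ b)
    (hφ : ∀ t ∈ Icc a b, HasDerivAt φ (φ' t) t)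
    (hb : ∀ t ∈ Icc a b, ‖φ' t‖ ≤ (derivative v).eval t * Real.exp (v.eval t)) :
    ‖φ b - φ a‖ ≤ Real.exp (v.eval b) - Real.exp (v.eval a) := by
  refine image_norm_le_of_norm_deriv_right_le_deriv_boundary (f := fun t => φ t - φ a)
    (f' := φ') (B := fun t => Real.exp (v.eval t) - Real.exp (v.eval a))
    (B' := fun t => (derivative v).eval t * Real.exp (v.eval t)) (a := a) (b := b)
    ?_ ?_ ?_ ?_ ?_ ⟨hab, le_rfl⟩
  · exact fun t ht => ((hφ t ht).sub_const _).continuousAt.continuousWithinAt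
  · exact fun t ht => ((hφ t (Ico_subset_Icc_self ht)).sub_const _).hasDerivWithinAt
  · simp
  · intro t
    refine ((v.hasDerivAt t).exp.sub_const _).congr_deriv ?_
    ring
  · exact fun t ht => hb t (Ico_subset_Icc_self ht)

theorem exists_bound_of_eventually {f : ℝ → ℂ} (hf : Continuous f) {T C : ℝ}
    (h : ∀ t, T ≤ t → ‖f t‖ ≤ C) : ∃ C, ∀ t : ℝ, 0 ≤ t → ‖f t‖ ≤ C := by
  obtain ⟨K, hK⟩ := (isCompact_Icc (a := 0) (b := T)).exists_bound_of_continuousOn hf.continuousOn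
  refine ⟨max K C, fun t ht => ?_⟩
  rcases le_total t T with h1 | h1
  · exact (hK t ⟨ht, h1⟩).trans (le_max_left _ _)
  · exact (h t h1).trans (le_max_right _ _)

/-- The degree condition makes `q ≤ |u'|` eventually, so `q e^{-u}` is dominated by the derivative
of `±e^{-u}`. If `u → -∞` one integrates from a fixed point; if `u → ∞` one integrates from
infinity, which is where `φ → 0` is needed. -/
theorem exists_bound_exp_integral {φ φ' : ℝ → ℂ} {u q : ℝ[X]}
    (h : q.natDegree + 2 ≤ u.natDegree) (hφ : ∀ t, HasDerivAt φ (φ' t) t)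
    (hb : ∀ t, 0 ≤ t → ‖φ' t‖ ≤ q.eval t * Real.exp (-u.eval t))
    (hcase : u.leadingCoeff < 0 ∨ 0 < u.leadingCoeff ∧ Tendsto φ atTop (𝓝 0)) :
    ∃ C, ∀ t : ℝ, 0 ≤ t → ‖φ t * Real.exp (u.eval t)‖ ≤ C := by
  have hcφ : Continuous φ := continuous_iff_continuousAt.2 fun t => (hφ t).continuousAt
  have hc : Continuous fun t => φ t * (Real.exp (u.eval t) : ℂ) := by fun_prop
  have hnorm : ∀ t, ‖φ t * (Real.exp (u.eval t) : ℂ)‖ = ‖φ t‖ * Real.exp (u.eval t) := fun t => by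
    rw [norm_mul, Complex.norm_real, Real.norm_of_nonneg (Real.exp_pos _).le]
  rcases hcase with hl | ⟨hl, hlim⟩
  · have hn : (-u).natDegree = u.natDegree := natDegree_neg u
    have hl' : 0 < (-u).leadingCoeff := by rw [leadingCoeff_neg]; linarith
    have h1 := eventually_le_derivative (u := -u) (q := q) (by rwa [hn]) hl'
    have h2 := (tendsto_sub_X_atTop (u := -u) (by omega) hl').eventually_ge_atTop 0
    obtain ⟨T, hT⟩ := (h1.and (h2.and (eventually_ge_atTop 0))).exists_forall_of_atTop
    refine exists_bound_of_eventually hc (T := T) (C := 1 + ‖φ T‖) fun t ht => ?_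
    have h3 := norm_sub_le_of_exp_bound (φ := φ) (φ' := φ') (v := -u) ht (fun s _ => hφ s)
      fun s hs => by
        refine (hb s (hT s hs.1).2.2).trans ?_
        rw [eval_neg]
        exact mul_le_mul_of_nonneg_right (hT s hs.1).1 (Real.exp_pos _).le
    have h4 : u.eval t ≤ 0 := by
      have h5 := hT t ht
      rw [eval_neg] at h5
      linarith [h5.2.1, h5.2.2]
    have h5 : ‖φ t‖ ≤ Real.exp (-u.eval t) + ‖φ T‖ := by
      have := norm_le_norm_sub_add (φ t) (φ T)
      rw [eval_neg, eval_neg] at h3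
      linarith [Real.exp_pos (-u.eval T)]
    rw [hnorm]
    calc _ ≤ (Real.exp (-u.eval t) + ‖φ T‖) * Real.exp (u.eval t) := by gcongr
      _ = 1 + ‖φ T‖ * Real.exp (u.eval t) := by
        rw [add_mul, ← Real.exp_add, neg_add_cancel, Real.exp_zero]
      _ ≤ 1 + ‖φ T‖ * 1 := by
        gcongr
        exact Real.exp_le_one_iff.2 h4
      _ = _ := by rw [mul_one]
  · have h1 := eventually_le_derivative (u := u) (q := q) h hl
    obtain ⟨T, hT⟩ := (h1.and (eventually_ge_atTop 0)).exists_forall_of_atTop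
    refine exists_bound_of_eventually hc (T := T) (C := 1) fun t ht => ?_
    have h3 : ∀ s, t ≤ s → ‖φ s - φ t‖ ≤ Real.exp (-u.eval t) := fun s hs => by
      have hd : ∀ x, HasDerivAt (fun y => -Real.exp (-u.eval y))
          ((derivative u).eval x * Real.exp (-u.eval x)) x := fun x => by
        refine ((u.hasDerivAt x).fun_neg.exp.fun_neg).congr_deriv ?_
        ring
      have := image_norm_le_of_norm_deriv_right_le_deriv_boundary (f := fun x => φ x - φ t)
        (f' := φ') (B := fun x => -Real.exp (-u.eval x) + Real.exp (-u.eval t))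
        (B' := fun x => (derivative u).eval x * Real.exp (-u.eval x)) (a := t) (b := s)
        (fun x _ => ((hφ x).sub_const _).continuousAt.continuousWithinAt)
        (fun x _ => ((hφ x).sub_const _).hasDerivWithinAt) (by simp)
        (fun x => (hd x).add_const _)
        (fun x hx => (hb x (hT x (ht.trans hx.1)).2).trans
          (mul_le_mul_of_nonneg_right (hT x (ht.trans hx.1)).1 (Real.exp_pos _).le))
        ⟨hs, le_rfl⟩
      linarith [Real.exp_pos (-u.eval s)]
    have h4 : ‖φ t‖ ≤ Real.exp (-u.eval t) := by
      have h5 : Tendsto (fun s => ‖φ s - φ t‖) atTop (𝓝 ‖0 - φ t‖) := (hlim.sub_const _).norm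
      rw [zero_sub, norm_neg] at h5
      refine le_of_tendsto h5 ?_
      filter_upwards [eventually_ge_atTop t] with s hs using h3 s hs
    rw [hnorm]
    calc _ ≤ Real.exp (-u.eval t) * Real.exp (u.eval t) := by gcongr
      _ = 1 := by rw [← Real.exp_add, neg_add_cancel, Real.exp_zero]

theorem eval_le_eval_one_mul {q : ℝ[X]} (hq : ∀ i, 0 ≤ q.coeff i) {N : ℕ} (hN : q.natDegree ≤ N)
    {r : ℝ} (hr : 0 ≤ r) : q.eval r ≤ q.eval 1 * (1 + r) ^ N := by
  rw [eval_eq_sum_range, eval_eq_sum_range, Finset.sum_mul]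
  refine Finset.sum_le_sum fun i hi => ?_
  rw [one_pow, mul_one]
  refine mul_le_mul_of_nonneg_left ?_ (hq i)
  calc r ^ i ≤ (1 + r) ^ i := by gcongr; linarith
    _ ≤ (1 + r) ^ N := pow_le_pow_right₀ (by linarith)
      (by have := Finset.mem_range.1 hi; omega)

theorem exists_norm_eval_le_pow (Q : ℂ[X]) {N : ℕ} (hN : Q.natDegree ≤ N) :
    ∃ K, 0 ≤ K ∧ ∀ z : ℂ, ‖Q.eval z‖ ≤ K * (1 + ‖z‖) ^ N := by
  obtain ⟨q, hq, hq0, hqe⟩ := exists_norm_eval_le Q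
  have h1 : ∀ z : ℂ, ‖Q.eval z‖ ≤ q.eval 1 * (1 + ‖z‖) ^ N := fun z =>
    (hqe z).trans (eval_le_eval_one_mul hq0 (hq.trans hN) (norm_nonneg z))
  exact ⟨q.eval 1, by simpa using (norm_nonneg _).trans (h1 0), h1⟩

/-- `E` is controlled by the maximum of its derivative on the disc of radius `‖z‖`, and `x ≤ e^x`
absorbs all polynomial factors into the exponential. -/
theorem exists_growth {U R : ℂ[X]} {D : ℕ} (hD : 1 ≤ D) (hU : U.natDegree ≤ D)
    (hR : R.natDegree ≤ D) {E : ℂ → ℂ}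
    (hE : ∀ z, HasDerivAt E (Complex.exp (-U.eval z) * R.eval z) z) :
    ∃ B, 0 ≤ B ∧ ∀ z : ℂ, ‖Complex.exp (U.eval z) * E z‖ ≤ Real.exp (B * (1 + ‖z‖) ^ D) := by
  obtain ⟨K, hK0, hK⟩ := exists_norm_eval_le_pow U hU
  obtain ⟨L, hL0, hL⟩ := exists_norm_eval_le_pow R hR
  refine ⟨K + (1 + ‖E 0‖ + (1 + K + L)), by positivity, fun z => ?_⟩
  set s := (1 + ‖z‖) ^ D with hs
  have hs1 : 1 + ‖z‖ ≤ s := le_self_pow₀ (by linarith [norm_nonneg z]) (by omega)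
  have hs0 : 1 ≤ s := by linarith [norm_nonneg z]
  have hmono : ∀ y : ℂ, ‖y‖ ≤ ‖z‖ → (1 + ‖y‖) ^ D ≤ s := fun y hy => by
    rw [hs]; gcongr
  have hexp : ∀ x : ℝ, x ≤ Real.exp x := fun x => by linarith [Real.add_one_le_exp x]
  have h1 : ∀ y ∈ Metric.closedBall (0 : ℂ) ‖z‖,
      ‖Complex.exp (-U.eval y) * R.eval y‖ ≤ Real.exp (K * s) * Real.exp (L * s) := by
    intro y hy
    rw [mem_closedBall_zero_iff] at hy
    rw [norm_mul, Complex.norm_exp]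
    refine mul_le_mul (Real.exp_le_exp.2 ?_) (((hL y).trans ?_).trans (hexp _)) (norm_nonneg _)
      (Real.exp_pos _).le
    · refine (Complex.re_le_norm _).trans ?_
      rw [norm_neg]
      exact (hK y).trans (mul_le_mul_of_nonneg_left (hmono y hy) hK0)
    · exact mul_le_mul_of_nonneg_left (hmono y hy) hL0
  have h2 : ‖E z - E 0‖ ≤ Real.exp (K * s) * Real.exp (L * s) * ‖z - 0‖ :=
    (convex_closedBall (0 : ℂ) ‖z‖).norm_image_sub_le_of_norm_hasDerivWithin_le
      (fun y _ => (hE y).hasDerivWithinAt) h1 (by simp) (by simp)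
  have h3 : ‖E z‖ ≤ Real.exp (‖E 0‖ * s) + Real.exp ((1 + K + L) * s) := by
    have h4 : ‖E 0‖ ≤ Real.exp (‖E 0‖ * s) :=
      (le_mul_of_one_le_right (norm_nonneg _) hs0).trans (hexp _)
    have h5 : ‖z - 0‖ ≤ Real.exp s := by
      rw [sub_zero]; exact (by linarith : ‖z‖ ≤ s).trans (hexp s)
    have h6 : Real.exp (K * s) * Real.exp (L * s) * ‖z - 0‖ ≤ Real.exp ((1 + K + L) * s) := by
      calc _ ≤ Real.exp (K * s) * Real.exp (L * s) * Real.exp s := by gcongr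
        _ = _ := by rw [← Real.exp_add, ← Real.exp_add]; congr 1; ring
    have := norm_le_norm_sub_add (E z) (E 0)
    linarith
  have h7 : ‖E z‖ ≤ Real.exp ((1 + ‖E 0‖ + (1 + K + L)) * s) := by
    have hx : Real.exp (‖E 0‖ * s) ≤ Real.exp ((‖E 0‖ + (1 + K + L)) * s) := by
      gcongr; linarith
    have hy : Real.exp ((1 + K + L) * s) ≤ Real.exp ((‖E 0‖ + (1 + K + L)) * s) := by
      have h8 := norm_nonneg (E 0)
      exact Real.exp_le_exp.2 (mul_le_mul_of_nonneg_right (by linarith) (by linarith))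
    have h2' : (2 : ℝ) ≤ Real.exp s := by
      linarith [Real.add_one_le_exp s]
    calc _ ≤ 2 * Real.exp ((‖E 0‖ + (1 + K + L)) * s) := by linarith
      _ ≤ Real.exp s * Real.exp ((‖E 0‖ + (1 + K + L)) * s) := by gcongr
      _ = _ := by rw [← Real.exp_add]; congr 1; ring
  rw [norm_mul, Complex.norm_exp, add_mul, Real.exp_add]
  refine mul_le_mul (Real.exp_le_exp.2 ?_) h7 (norm_nonneg _) (Real.exp_pos _).le
  exact (Complex.re_le_norm _).trans (hK z)

/-! ### Phragmén–Lindelöf and the independence of the functionals on `Γ_k`. -/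

theorem re_neg_of_pow_three {ξ : ℂ} (h3 : ξ ^ 3 = 1) (h1 : ξ ≠ 1) : ξ.re < 0 := by
  have hn : ‖ξ‖ = 1 := Complex.norm_eq_one_of_pow_eq_one h3 (by norm_num)
  have h2 : ξ ^ 2 + ξ + 1 = 0 := by
    have : (ξ - 1) * (ξ ^ 2 + ξ + 1) = 0 := by linear_combination h3
    exact (mul_eq_zero.1 this).resolve_left (sub_ne_zero.2 h1)
  have h4 : ξ * (starRingEnd ℂ) ξ = 1 := by
    rw [Complex.mul_conj, Complex.normSq_eq_norm_sq, hn]; simp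
  have h5 : ξ + 1 + (starRingEnd ℂ) ξ = 0 := by
    linear_combination (starRingEnd ℂ) ξ * h2 - (ξ + 1) * h4
  have h6 := congrArg Complex.re h5
  simp at h6
  linarith

/-- The direction `e^{2πij/(3D)}`. -/
def direction (D j : ℕ) : ℂ := Complex.exp ((2 * Real.pi / (3 * D) * j : ℝ) * Complex.I)

theorem norm_direction (D j : ℕ) : ‖direction D j‖ = 1 := Complex.norm_exp_ofReal_mul_I _

/-- The `D`-th power of the direction is a cube root of unity. It is `1` exactly on the contour
rays; otherwise its real part is negative, so that `Re V → -∞` in that direction. -/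
theorem direction_pow_cases {D : ℕ} (hD : 0 < D) (j : ℕ) :
    (∃ k < D, direction D j = omega D ^ k) ∨ (direction D j ^ D).re < 0 := by
  have hD' : (D : ℂ) ≠ 0 := by exact_mod_cast hD.ne'
  have hpow : direction D j ^ D = Complex.exp (2 * Real.pi * Complex.I / (3 : ℕ)) ^ j := by
    rw [direction, ← Complex.exp_nat_mul, ← Complex.exp_nat_mul]
    congr 1
    push_cast
    field_simp
  have hprim := Complex.isPrimitiveRoot_exp 3 (by norm_num)
  by_cases h : 3 ∣ j
  · obtain ⟨k, rfl⟩ := h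
    refine Or.inl ⟨k % D, Nat.mod_lt _ hD, ?_⟩
    have h1 : omega D ^ k = omega D ^ (k % D) := by
      conv_lhs => rw [← Nat.div_add_mod k D, pow_add, pow_mul,
        (isPrimitiveRoot_omega hD).pow_eq_one, one_pow, one_mul]
    rw [← h1, omega, ← Complex.exp_nat_mul, direction]
    congr 1
    push_cast
    field_simp
  · refine Or.inr (re_neg_of_pow_three ?_ ?_)
    · rw [hpow, ← pow_mul, mul_comm j, pow_mul, hprim.pow_eq_one, one_pow]
    · rw [hpow]
      exact fun h1 => h ((hprim.pow_eq_one_iff_dvd j).1 h1)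

theorem natDegree_comp_C_mul_X (U : ℂ[X]) {ζ : ℂ} (hζ : ζ ≠ 0) :
    (U.comp (C ζ * X)).natDegree = U.natDegree := by
  rw [natDegree_comp, natDegree_C_mul_X _ hζ, mul_one]

theorem leadingCoeff_comp_C_mul_X (U : ℂ[X]) {ζ : ℂ} (hζ : ζ ≠ 0) :
    (U.comp (C ζ * X)).leadingCoeff = U.leadingCoeff * ζ ^ U.natDegree := by
  rw [leadingCoeff_comp (by rw [natDegree_C_mul_X _ hζ]; exact one_ne_zero), leadingCoeff_C_mul_X]

/-- On a contour ray `e^V` grows, and the vanishing of `E` at infinity compensates. In the other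
directions `e^V` decays and no condition on `E` at infinity is needed. -/
theorem exists_bound_on_ray {V : ℝ[X]} {D : ℕ} (hV : V.natDegree = D) (hD : 2 ≤ D)
    (hl : 0 < V.leadingCoeff) {R : ℂ[X]} (hR : R.natDegree + 2 ≤ D) {E : ℂ → ℂ}
    (hE : ∀ z, HasDerivAt E (Complex.exp (-(V.map (algebraMap ℝ ℂ)).eval z) * R.eval z) z)
    (hlim : ∀ k < D, Tendsto (fun t : ℝ => E (omega D ^ k * t)) atTop (𝓝 0)) (j : ℕ) :
    ∃ C, ∀ t : ℝ, 0 ≤ t → ‖Complex.exp ((V.map (algebraMap ℝ ℂ)).eval (direction D j * t)) *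
      E (direction D j * t)‖ ≤ C := by
  set U := V.map (algebraMap ℝ ℂ) with hU
  set ζ := direction D j with hζ
  have hζn : ‖ζ‖ = 1 := norm_direction D j
  have hζ0 : ζ ≠ 0 := norm_pos_iff.1 (by rw [hζn]; exact one_pos)
  have hUn : U.natDegree = D := by rw [hU, natDegree_map, hV]
  have hlc : (U.comp (C ζ * X)).leadingCoeff.re = V.leadingCoeff * (ζ ^ D).re := by
    rw [leadingCoeff_comp_C_mul_X U hζ0, hUn, hU, leadingCoeff_map]
    exact Complex.re_ofReal_mul _ _
  obtain ⟨q, hq, -, hqe⟩ := exists_norm_eval_le R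
  have hcases := direction_pow_cases (D := D) (by omega) j
  have hre : (ζ ^ D).re ≠ 0 := by
    rcases hcases with ⟨k, -, hk⟩ | h
    · rw [hζ, hk, ← pow_mul, mul_comm, pow_mul, (isPrimitiveRoot_omega (by omega)).pow_eq_one,
        one_pow, Complex.one_re]
      exact one_ne_zero
    · exact h.ne
  have hlc0 : (U.comp (C ζ * X)).leadingCoeff.re ≠ 0 := by
    rw [hlc]; exact mul_ne_zero hl.ne' hre
  have hu : ∀ t : ℝ, (rePart (U.comp (C ζ * X))).eval t = (U.eval (ζ * t)).re := fun t => by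
    rw [eval_rePart]; simp
  have hder : ∀ t : ℝ, HasDerivAt (fun t : ℝ => E (ζ * t))
      (Complex.exp (-U.eval (ζ * t)) * R.eval (ζ * t) * ζ) t := fun t => by
    have h1 : HasDerivAt (fun t : ℝ => ζ * (t : ℂ)) ζ t := by
      simpa using (Complex.ofRealCLM.hasDerivAt (x := t)).const_mul ζ
    exact (hE (ζ * t)).comp t h1
  obtain ⟨C, hC⟩ := exists_bound_exp_integral (u := rePart (U.comp (C ζ * X))) (q := q)
    (by rw [natDegree_rePart hlc0, natDegree_comp_C_mul_X U hζ0]; omega) hder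
    (fun t ht => by
      rw [norm_mul, norm_mul, hζn, mul_one, Complex.norm_exp, Complex.neg_re, ← hu, mul_comm]
      refine mul_le_mul_of_nonneg_right ?_ (Real.exp_pos _).le
      have := hqe (ζ * t)
      rwa [norm_mul, hζn, one_mul, Complex.norm_of_nonneg ht] at this)
    (by
      rw [leadingCoeff_rePart hlc0, hlc]
      rcases hcases with ⟨k, hkD, hk⟩ | h
      · right
        rw [← hζ] at hk
        refine ⟨?_, by rw [hk]; exact hlim k hkD⟩
        rw [hk, ← pow_mul, mul_comm k, pow_mul, (isPrimitiveRoot_omega (by omega)).pow_eq_one,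
          one_pow, Complex.one_re, mul_one]
        exact hl
      · exact Or.inl (mul_neg_of_pos_of_neg hl h))
  refine ⟨C, fun t ht => ?_⟩
  have := hC t ht
  rw [norm_mul, Complex.norm_real, Real.norm_of_nonneg (Real.exp_pos _).le, hu] at this
  rwa [norm_mul, Complex.norm_exp, mul_comm]

/-- An entire function of order less than `3D/2` which is bounded on the rays `arg z = 2πj/(3D)` is
bounded. -/
theorem bounded_of_bounded_on_rays {D : ℕ} (hD : 0 < D) {F : ℂ → ℂ} (hF : Differentiable ℂ F)
    {B : ℝ} (hB : 0 ≤ B) (hgrowth : ∀ z, ‖F z‖ ≤ Real.exp (B * (1 + ‖z‖) ^ D))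
    (hray : ∀ j : ℕ, ∃ C, ∀ t : ℝ, 0 ≤ t → ‖F (direction D j * t)‖ ≤ C) :
    Bornology.IsBounded (range F) := by
  choose c hc using hray
  set a : ℝ := 2 * Real.pi / (3 * D) with ha
  have hDr : (0 : ℝ) < D := by exact_mod_cast hD
  have ha0 : 0 < a := by have := Real.pi_pos; positivity
  set M := ∑ j ∈ Finset.range (3 * D + 1), |c j| with hM
  have hcM : ∀ j ≤ 3 * D, c j ≤ M := fun j hj => (le_abs_self _).trans
    (Finset.single_le_sum (f := fun j => |c j|) (fun i _ => abs_nonneg _)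
      (Finset.mem_range.2 (by omega)))
  have hline : ∀ j ≤ 3 * D, ∀ w : ℂ, w.im = a * j → ‖F (Complex.exp w)‖ ≤ M := by
    intro j hj w hw
    have h1 : Complex.exp w = direction D j * (Real.exp w.re : ℝ) := by
      conv_lhs => rw [← Complex.re_add_im w, Complex.exp_add, hw]
      rw [direction, ha, mul_comm, Complex.ofReal_exp]
    rw [h1]
    exact (hc j _ (Real.exp_pos _).le).trans (hcM j hj)
  have hstrip : ∀ j < 3 * D, ∀ w : ℂ, a * j ≤ w.im → w.im ≤ a * (j + 1 : ℕ) →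
      ‖F (Complex.exp w)‖ ≤ M := by
    intro j hj w hw1 hw2
    refine PhragmenLindelof.horizontal_strip (f := fun w => F (Complex.exp w))
      (a := a * j) (b := a * (j + 1 : ℕ)) ?_ ?_ (hline j hj.le) (hline (j + 1) hj) hw1 hw2
    · exact (hF.comp Complex.differentiable_exp).diffContOnCl
    -- In the coordinate `e^w` a sector is a strip of width `a = 2π / (3D)`, and growth `exp (B e^{c
    -- |Re w|})` is allowed for `c < π / a = 3D / 2`; here `c = D`. The factor `2^D` comes from `1 +
    -- ‖e^w‖ ≤ 2 e^{|Re w|}`.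
    · refine ⟨D, ?_, B * 2 ^ D, Asymptotics.IsBigO.of_bound 1 (Eventually.of_forall fun z => ?_)⟩
      · have h1 : a * ((j + 1 : ℕ) : ℝ) - a * j = a := by push_cast; ring
        rw [h1, ha]
        have h2 : Real.pi / (2 * Real.pi / (3 * D)) = 3 / 2 * D := by
          have := Real.pi_ne_zero
          field_simp
        rw [h2]
        linarith
      · rw [one_mul, Real.norm_of_nonneg (Real.exp_pos _).le]
        refine (hgrowth _).trans (Real.exp_le_exp.2 ?_)
        rw [mul_assoc]
        refine mul_le_mul_of_nonneg_left ?_ hB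
        rw [Complex.norm_exp, Real.exp_nat_mul, ← mul_pow]
        have h1 : Real.exp z.re ≤ Real.exp |z.re| := Real.exp_le_exp.2 (le_abs_self _)
        have h2 : 1 ≤ Real.exp |z.re| := Real.one_le_exp (abs_nonneg _)
        have h3 := Real.exp_pos z.re
        gcongr
        linarith
  have hexp : ∀ w : ℂ, 0 ≤ w.im → w.im < 2 * Real.pi → ‖F (Complex.exp w)‖ ≤ M := by
    intro w h0 h1
    have h2 : 0 ≤ w.im / a := div_nonneg h0 ha0.le
    refine hstrip ⌊w.im / a⌋₊ ?_ w ?_ ?_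
    · rw [Nat.floor_lt h2, div_lt_iff₀ ha0, ha]
      push_cast
      have : 3 * (D : ℝ) * (2 * Real.pi / (3 * D)) = 2 * Real.pi := by field_simp
      linarith
    · have := Nat.floor_le h2
      rw [le_div_iff₀ ha0] at this
      linarith
    · have := (Nat.lt_floor_add_one (w.im / a)).le
      rw [div_le_iff₀ ha0] at this
      push_cast
      linarith
  refine isBounded_iff_forall_norm_le.2 ⟨max M ‖F 0‖, ?_⟩
  rintro _ ⟨z, rfl⟩
  by_cases hz : z = 0
  · rw [hz]; exact le_max_right _ _
  · refine le_trans ?_ (le_max_left _ _)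
    have hpi := Real.pi_pos
    -- The strips cover `0 ≤ Im w < 2π`, so a negative argument is shifted by `2π`.
    rcases le_or_gt 0 z.arg with h | h
    · have := hexp (Complex.log z) (by rwa [Complex.log_im])
        (by rw [Complex.log_im]; linarith [Complex.arg_le_pi z])
      rwa [Complex.exp_log hz] at this
    · have := hexp (Complex.log z + 2 * Real.pi * Complex.I)
        (by simp [Complex.log_im]; linarith [Complex.neg_pi_lt_arg z])
        (by simpa [Complex.log_im] using h)
      rwa [Complex.exp_periodic, Complex.exp_log hz] at this

/-- The functionals `β_1, …, β_{D-1}` are linearly independent on polynomials of degree at most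
`D - 2`. -/
theorem eq_zero_of_integralGam_eq_zero {V : ℝ[X]} {D : ℕ} (hV : V.natDegree = D) (hD : 2 ≤ D)
    (hl : 0 < V.leadingCoeff) {R : ℂ[X]} (hR : R.natDegree + 2 ≤ D)
    (hint : ∀ k ∈ Finset.Icc 1 (D - 1),
      integralGam D k (fun x => weightGam V x * R.eval x) = 0) : R = 0 := by
  set U := V.map (algebraMap ℝ ℂ) with hU
  have hUn : U.natDegree = D := by rw [hU, natDegree_map, hV]
  have hw : ∀ z, weightGam V z = Complex.exp (-U.eval z) := fun z => by
    rw [weightGam, hU, eval_map_algebraMap]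
  have hdiff : Differentiable ℂ fun z => Complex.exp (-U.eval z) * R.eval z := by fun_prop
  -- The value at `0` makes `E` vanish at the end of `C_0`. Vanishing integrals over the `Γ_k` say
  -- that all integrals from `0` along the rays `C_k` agree, so `E` vanishes at all `D` ends.
  obtain ⟨E, hE0, hE⟩ := (hdiff.isExactOn_univ).with_val_at 0
    (-∫ t in Ioi (0 : ℝ), weightGam V t * R.eval (t : ℂ))
  replace hE : ∀ z, HasDerivAt E (Complex.exp (-U.eval z) * R.eval z) z := fun z => hE z trivial
  have hlim : ∀ k < D, Tendsto (fun t : ℝ => E (omega D ^ k * t)) atTop (𝓝 0) := by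
    intro k hk
    have hdec := gamDecay_weightGam hV hD hl k R
    have h1 : (omega D ^ k * ∫ t in Ioi (0 : ℝ), weightGam V (omega D ^ k * t) *
        R.eval (omega D ^ k * t)) = ∫ t in Ioi (0 : ℝ), weightGam V t * R.eval (t : ℂ) := by
      rcases Nat.eq_zero_or_pos k with rfl | hk0
      · simp
      · have := hint k (Finset.mem_Icc.2 ⟨hk0, by omega⟩)
        rw [integralGam_eq, sub_eq_zero] at this
        exact this.symm
    have hder : ∀ t : ℝ, HasDerivAt (fun t : ℝ => E (omega D ^ k * t))
        (omega D ^ k * (weightGam V (omega D ^ k * t) * R.eval (omega D ^ k * t))) t := fun t => by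
      have h1 : HasDerivAt (fun t : ℝ => omega D ^ k * (t : ℂ)) (omega D ^ k) t := by
        simpa using (Complex.ofRealCLM.hasDerivAt (x := t)).const_mul (omega D ^ k)
      rw [hw, mul_comm (omega D ^ k)]
      exact (hE (omega D ^ k * t)).comp t h1
    have hcont : Continuous fun t : ℝ =>
        omega D ^ k * (weightGam V (omega D ^ k * t) * R.eval (omega D ^ k * t)) :=
      continuous_const.mul hdec.rot.continuous_ofReal
    have h2 := intervalIntegral_tendsto_integral_Ioi 0
      (hdec.rot.integrableOn.const_mul (omega D ^ k)) tendsto_id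
    rw [integral_const_mul, h1] at h2
    have h3 : ∀ T : ℝ, E (omega D ^ k * T) = (∫ t in (0 : ℝ)..T,
        omega D ^ k * (weightGam V (omega D ^ k * t) * R.eval (omega D ^ k * t))) + E 0 := by
      intro T
      rw [intervalIntegral.integral_eq_sub_of_hasDerivAt (fun t _ => hder t)
        (hcont.intervalIntegrable _ _)]
      simp
    have h4 := h2.add_const (E 0)
    rw [hE0, add_neg_cancel] at h4
    refine h4.congr fun T => ?_
    rw [h3, hE0]
    rfl
  have hFd : Differentiable ℂ fun z => Complex.exp (U.eval z) * E z := fun z =>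
    (by fun_prop : DifferentiableAt ℂ (fun z => Complex.exp (U.eval z)) z).mul
      (hE z).differentiableAt
  obtain ⟨B, hB, hgrowth⟩ := exists_growth (by omega) hUn.le (by omega) hE
  have hbdd := bounded_of_bounded_on_rays (by omega) hFd hB hgrowth
    (exists_bound_on_ray hV hD hl hR hE hlim)
  obtain ⟨c, hc⟩ : ∃ c, ∀ z, Complex.exp (U.eval z) * E z = c :=
    ⟨_, fun z => hFd.apply_eq_apply_of_bounded hbdd z 0⟩
  have hEc : ∀ z, E z = Complex.exp (-U.eval z) * (Polynomial.C c).eval z := fun z => by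
    rw [eval_C, ← hc z, ← mul_assoc, ← Complex.exp_add, neg_add_cancel, Complex.exp_zero, one_mul]
  -- Differentiating `E = c e^{-V}` gives `R = -c V'`, whose degree `D - 1` exceeds `D - 2` unless
  -- `c = 0`.
  have hRc : R = -(Polynomial.C c * derivative U) := by
    refine Polynomial.funext fun z => ?_
    have h1 := hE z
    rw [funext hEc] at h1
    have h2 := mul_left_cancel₀ (Complex.exp_ne_zero _) (h1.unique (hasDerivAt_exp_mul U _ z))
    rw [h2]
    simp [mul_comm]
  by_cases hc0 : c = 0
  · rw [hRc, hc0]; simp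
  · exfalso
    have h1 : R.natDegree = D - 1 := by
      rw [hRc, natDegree_neg, natDegree_C_mul hc0, natDegree_derivative, hUn]
    omega

/-! ### The dual polynomials -/

/-- The dual polynomial over an arbitrary field. -/
def gdual {K : Type*} [Field K] (V P : K[X]) : K[X] :=
  C (-(1 / (V.leadingCoeff * V.natDegree))) * (derivative P - derivative V * P)

theorem dual_eq_gdual (V P : ℝ[X]) : dual V P = gdual V P := rfl

theorem map_dual (V P : ℝ[X]) : (dual V P).map (algebraMap ℝ ℂ) =
    gdual (V.map (algebraMap ℝ ℂ)) (P.map (algebraMap ℝ ℂ)) := by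
  simp [dual, gdual, derivative_map]

section Dual

variable {K : Type*} [Field K]

theorem gdual_add (V P Q : K[X]) : gdual V (P + Q) = gdual V P + gdual V Q := by
  simp only [gdual, derivative_add]; ring

theorem gdual_sub (V P Q : K[X]) : gdual V (P - Q) = gdual V P - gdual V Q := by
  simp only [gdual, derivative_sub]; ring

theorem gdual_C_mul (V P : K[X]) (c : K) : gdual V (C c * P) = C c * gdual V P := by
  simp only [gdual, derivative_C_mul]; ring

theorem natDegree_gdual_le {V P : K[X]} {D m : ℕ} (hV : V.natDegree = D) (hD : 0 < D)
    (hP : P.natDegree ≤ m) : (gdual V P).natDegree ≤ m + D - 1 := by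
  refine (natDegree_C_mul_le _ _).trans ((natDegree_sub_le _ _).trans (max_le ?_ ?_))
  · have := natDegree_derivative_le P
    omega
  · have := natDegree_derivative_le V
    refine natDegree_mul_le.trans ?_
    omega

theorem coeff_gdual [CharZero K] {V P : K[X]} {D m : ℕ} (hV : V.natDegree = D) (hD : 0 < D)
    (hP : P.natDegree ≤ m) : (gdual V P).coeff (m + D - 1) = P.coeff m := by
  have hl : V.leadingCoeff ≠ 0 := leadingCoeff_ne_zero.2 (by rintro rfl; simp at hV; omega)
  have hDK : (D : K) ≠ 0 := by exact_mod_cast hD.ne'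
  have h1 : (derivative V).coeff (D - 1) = V.leadingCoeff * D := by
    rw [coeff_derivative, Nat.sub_add_cancel hD, leadingCoeff, hV, Nat.cast_sub hD]
    push_cast
    ring
  have h2 : (derivative P).coeff (m + D - 1) = 0 := by
    rw [coeff_derivative, coeff_eq_zero_of_natDegree_lt (by omega), zero_mul]
  have h3 : (derivative V * P).coeff (m + D - 1) = V.leadingCoeff * D * P.coeff m := by
    rw [show m + D - 1 = D - 1 + m by omega, coeff_mul_add_eq_of_natDegree_le
      (by have := natDegree_derivative_le V; omega) hP, h1]
  rw [gdual, coeff_C_mul, coeff_sub, h2, h3, hV]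
  field_simp
  ring

theorem natDegree_gdual [CharZero K] {V P : K[X]} {D m : ℕ} (hV : V.natDegree = D) (hD : 0 < D)
    (hm : P.Monic) (hP : P.natDegree = m) : (gdual V P).natDegree = m + D - 1 := by
  refine natDegree_eq_of_le_of_coeff_ne_zero (natDegree_gdual_le hV hD hP.le) ?_
  rw [coeff_gdual hV hD hP.le, ← hP, coeff_natDegree, hm.leadingCoeff]
  exact one_ne_zero

/-- Division with remainder: the dual raises the degree by `D - 1` and keeps the top coefficient, so
leading terms are peeled off until the degree is at most `D - 2`. -/
theorem exists_gdual_sub {V : K[X]} [CharZero K] {D : ℕ} (hV : V.natDegree = D) (hD : 2 ≤ D)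
    (N : ℕ) : ∀ R : K[X], R.natDegree < N + (D - 1) →
    ∃ P : K[X], P.degree < N ∧ (R - gdual V P).natDegree + 2 ≤ D := by
  induction N with
  | zero => exact fun R hR => ⟨0, by simp, by simp [gdual]; omega⟩
  | succ N ih =>
    intro R hR
    set c := R.coeff (N + D - 1) with hc
    have hdeg : (C c * X ^ N : K[X]).natDegree ≤ N := natDegree_C_mul_X_pow_le c N
    have h1 : (R - gdual V (C c * X ^ N)).natDegree ≤ N + D - 1 :=
      (natDegree_sub_le _ _).trans (max_le (by omega) (natDegree_gdual_le hV (by omega) hdeg))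
    have h2 : (R - gdual V (C c * X ^ N)).coeff (N + D - 1) = 0 := by
      rw [coeff_sub, coeff_gdual hV (by omega) hdeg]
      simp [hc]
    have h3 : (R - gdual V (C c * X ^ N)).natDegree < N + (D - 1) := by
      refine lt_of_le_of_ne (by omega) fun h => ?_
      have h4 : (R - gdual V (C c * X ^ N)).leadingCoeff = 0 := by
        rw [leadingCoeff, h, show N + (D - 1) = N + D - 1 by omega, h2]
      rw [leadingCoeff_eq_zero] at h4
      rw [h4, natDegree_zero] at h
      omega
    obtain ⟨P, hP, hr⟩ := ih _ h3
    refine ⟨C c * X ^ N + P, ?_, ?_⟩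
    · refine (degree_add_le _ _).trans_lt (max_lt ?_ (hP.trans (by exact_mod_cast N.lt_succ_self)))
      exact (degree_C_mul_X_pow_le N c).trans_lt (by exact_mod_cast N.lt_succ_self)
    · rwa [gdual_add, ← sub_sub]

theorem eq_zero_of_monic_basis {M : Type*} [AddCommGroup M] [Module K M] (φ : K[X] →ₗ[K] M)
    {P : ℕ → K[X]} (hm : ∀ j, (P j).Monic) (hd : ∀ j, (P j).natDegree = j) {N : ℕ}
    (h : ∀ j < N, φ (P j) = 0) {Q : K[X]} (hQ : Q.degree < N) : φ Q = 0 := by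
  induction N generalizing Q with
  | zero =>
    have : Q = 0 := degree_eq_bot.1 (Nat.WithBot.lt_zero_iff.1 hQ)
    rw [this, map_zero]
  | succ N ih =>
    set c := Q.coeff N
    have h1 : (Q - C c * P N).degree < N := by
      rw [degree_lt_iff_coeff_zero]
      intro i hi
      rcases Nat.eq_or_lt_of_le hi with rfl | hi
      · have : (P N).coeff N = 1 := by
          have := (hm N).leadingCoeff
          rwa [leadingCoeff, hd] at this
        rw [coeff_sub, coeff_C_mul, this, mul_one, sub_self]
      · rw [coeff_sub, coeff_C_mul, (degree_lt_iff_coeff_zero _ _).1 hQ i hi,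
          coeff_eq_zero_of_natDegree_lt (by rwa [hd])]
        simp
    have h2 := ih (fun j hj => h j (by omega)) h1
    rw [map_sub, ← smul_eq_C_mul, map_smul, h N (by omega), smul_zero, sub_zero] at h2
    exact h2

theorem surjective_of_injective_degreeLT {N : ℕ} (φ : K[X] →ₗ[K] (Fin N → K))
    (h : ∀ P : K[X], P.degree < N → φ P = 0 → P = 0) (v : Fin N → K) :
    ∃ P : K[X], P.degree < N ∧ φ P = v := by
  have hfin : Module.finrank K (degreeLT K N) = Module.finrank K (Fin N → K) := by
    rw [(degreeLTEquiv K N).finrank_eq]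
  have : FiniteDimensional K (degreeLT K N) := Module.Finite.equiv (degreeLTEquiv K N).symm
  have hinj : Function.Injective (φ.comp (degreeLT K N).subtype) := by
    rw [← LinearMap.ker_eq_bot, LinearMap.ker_eq_bot']
    intro P hP
    exact Subtype.ext (h P (mem_degreeLT.1 P.2) hP)
  obtain ⟨P, hP⟩ := (LinearMap.injective_iff_surjective_of_finrank_eq_finrank hfin).1 hinj v
  exact ⟨P, mem_degreeLT.1 P.2, hP⟩

end Dual

/-! ### The skew form -/

section Skew

variable {V : ℝ[X]} {D : ℕ} (hV : V.natDegree = D) (hD : 2 ≤ D) (he : Even D)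
  (hl : 0 < V.leadingCoeff)

theorem aeval_ofReal (V : ℝ[X]) (x : ℝ) : aeval (x : ℂ) V = ((V.eval x : ℝ) : ℂ) := by
  rw [← Complex.coe_algebraMap, aeval_algebraMap_apply, coe_aeval_eq_eval]

theorem weightReal_ofReal (V : ℝ[X]) (x : ℝ) :
    weightReal V x = ((Real.exp (-2 * V.eval x) : ℝ) : ℂ) := by
  rw [weightReal, aeval_ofReal]; push_cast; rfl

theorem eval_map_ofReal (P : ℝ[X]) (x : ℝ) :
    (P.map (algebraMap ℝ ℂ)).eval (x : ℂ) = ((P.eval x : ℝ) : ℂ) := by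
  rw [eval_map_algebraMap, aeval_ofReal]

include hV hD he hl in
theorem integrable_weightReal (Q : ℂ[X]) : Integrable fun t : ℝ => weightReal V t * Q.eval (t : ℂ) :=
  (gamDecay_weightReal hV hD hl (D / 2) Q).integrable hD he

include hV hD he hl in
theorem integrable_eval_mul_exp (P : ℝ[X]) :
    Integrable fun x : ℝ => P.eval x * Real.exp (-2 * V.eval x) := by
  have := (integrable_weightReal hV hD he hl (P.map (algebraMap ℝ ℂ))).re
  refine this.congr (ae_of_all _ fun x => ?_)
  simp only [weightReal_ofReal, eval_map_ofReal]
  rw [← Complex.ofReal_mul, mul_comm]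
  exact Complex.ofReal_re _

/-- The linear functional `P ↦ ∫ P e^{-2V} dx`. -/
def momentMap (V : ℝ[X])
    (h : ∀ P : ℝ[X], Integrable fun x : ℝ => P.eval x * Real.exp (-2 * V.eval x)) :
    ℝ[X] →ₗ[ℝ] ℝ where
  toFun P := ∫ x : ℝ, P.eval x * Real.exp (-2 * V.eval x)
  map_add' P Q := by
    rw [← integral_add (h P) (h Q)]
    simp only [eval_add, add_mul]
  map_smul' c P := by
    rw [RingHom.id_apply, smul_eq_mul, ← integral_const_mul]
    simp only [eval_smul, smul_eq_mul, mul_assoc]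

/-- The skew form as a bilinear map. -/
def skewMap (V : ℝ[X])
    (h : ∀ P : ℝ[X], Integrable fun x : ℝ => P.eval x * Real.exp (-2 * V.eval x)) :
    ℝ[X] →ₗ[ℝ] ℝ[X] →ₗ[ℝ] ℝ :=
  LinearMap.mk₂ ℝ (fun P Q => 1 / 2 * momentMap V h (P * derivative Q - derivative P * Q))
    (fun P P' Q => by
      rw [← mul_add, ← map_add]; simp only [derivative_add]; congr 2; ring)
    (fun c P Q => by
      rw [derivative_smul, smul_mul_assoc, smul_mul_assoc, ← smul_sub, map_smul]
      simp only [smul_eq_mul]; ring)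
    (fun P Q Q' => by
      rw [← mul_add, ← map_add]; simp only [derivative_add]; congr 2; ring)
    (fun c P Q => by
      rw [derivative_smul, mul_smul_comm, mul_smul_comm, ← smul_sub, map_smul]
      simp only [smul_eq_mul]; ring)

theorem skewMap_apply (h : ∀ P : ℝ[X], Integrable fun x : ℝ =>
    P.eval x * Real.exp (-2 * V.eval x)) (P Q : ℝ[X]) : skewMap V h P Q = skewForm V P Q := by
  simp [skewMap, momentMap, skewForm]

theorem skewForm_swap (V P Q : ℝ[X]) : skewForm V P Q = -skewForm V Q P := by
  rw [skewForm, skewForm, ← mul_neg, ← integral_neg]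
  congr 2
  ext x
  ring

theorem skewForm_self (V P : ℝ[X]) : skewForm V P P = 0 := by
  have := skewForm_swap V P P
  linarith

include hV hD he hl in
-- Because `P (XP)' - P' (XP) = P²`. All nondegeneracy of the skew form comes from this positivity.
theorem skewForm_mul_X_pos {P : ℝ[X]} (hP : P ≠ 0) : 0 < skewForm V P (X * P) := by
  have h1 : skewForm V P (X * P) =
      1 / 2 * ∫ x : ℝ, (P ^ 2).eval x * Real.exp (-2 * V.eval x) := by
    rw [skewForm]
    congr 2
    ext x
    simp
    ring
  rw [h1]
  obtain ⟨x, hx⟩ : ∃ x, P.eval x ≠ 0 := by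
    by_contra! hall
    exact hP (Polynomial.funext fun x => by rw [hall x, eval_zero])
  refine mul_pos (by norm_num) (integral_pos_of_integrable_nonneg_nonzero (x := x)
    (by fun_prop) (integrable_eval_mul_exp hV hD he hl _) (fun y => ?_) ?_)
  · simp only [eval_pow, Pi.zero_apply]; positivity
  · simp only [eval_pow]
    exact mul_ne_zero (pow_ne_zero 2 hx) (Real.exp_pos _).ne'

include hV hD he hl in
theorem moment_derivative (P : ℝ[X]) :
    ∫ x : ℝ, (derivative P - 2 * derivative V * P).eval x * Real.exp (-2 * V.eval x) = 0 := by
  have hd : ∀ x, HasDerivAt (fun x => P.eval x * Real.exp (-2 * V.eval x))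
      ((derivative P - 2 * derivative V * P).eval x * Real.exp (-2 * V.eval x)) x := fun x => by
    refine ((P.hasDerivAt x).fun_mul (((V.hasDerivAt x).const_mul (-2)).exp)).congr_deriv ?_
    simp
    ring
  exact integral_eq_zero_of_hasDerivAt_of_integrable hd (integrable_eval_mul_exp hV hD he hl _)
    (integrable_eval_mul_exp hV hD he hl P)

include hV hD he hl in
-- Integration by parts: the integrand of `2 ⟨P, Q⟩₄` and `2 (V' P - P') Q e^{-2V}` differ by the
-- derivative of `P Q e^{-2V}`. Skew-orthogonality of `P` thus becomes vanishing of moments of its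
-- dual.
theorem skewForm_eq_moment_dual (P Q : ℝ[X]) :
    skewForm V P Q = V.leadingCoeff * D *
      ∫ x : ℝ, (dual V P * Q).eval x * Real.exp (-2 * V.eval x) := by
  have hint := integrable_eval_mul_exp hV hD he hl
  have hD0 : (D : ℝ) ≠ 0 := by positivity
  have h1 : V.leadingCoeff * D * ∫ x : ℝ, (dual V P * Q).eval x * Real.exp (-2 * V.eval x) =
      ∫ x : ℝ, ((derivative V * P - derivative P) * Q).eval x * Real.exp (-2 * V.eval x) := by
    rw [← integral_const_mul]
    congr 1
    ext x
    simp only [dual, eval_mul, eval_C, eval_sub, hV]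
    field_simp
    ring
  have h2 := moment_derivative hV hD he hl (P * Q)
  have h3 : ∫ x : ℝ, (2 * (derivative V * P - derivative P) * Q).eval x *
      Real.exp (-2 * V.eval x) = 2 * ∫ x : ℝ, ((derivative V * P - derivative P) * Q).eval x *
      Real.exp (-2 * V.eval x) := by
    rw [← integral_const_mul]
    congr 1
    ext x
    simp [mul_assoc]
  have h4 : ∫ x : ℝ, (P * derivative Q - derivative P * Q).eval x * Real.exp (-2 * V.eval x) =
      2 * ∫ x : ℝ, ((derivative V * P - derivative P) * Q).eval x * Real.exp (-2 * V.eval x) := by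
    rw [← h3, ← sub_eq_zero, ← integral_sub (hint _) (hint _), ← h2]
    congr 1
    ext x
    simp only [eval_sub, eval_mul, derivative_mul, eval_add, eval_ofNat]
    ring
  rw [h1, skewForm]
  simp only [eval_sub, eval_mul] at h4 ⊢
  linarith

theorem alpha_map (V Q : ℝ[X]) (i : ℕ) : alpha V i (Q.map (algebraMap ℝ ℂ)) =
    ((∫ x : ℝ, (Q * X ^ i).eval x * Real.exp (-2 * V.eval x) : ℝ) : ℂ) := by
  rw [alpha, integralReal, ← integral_complex_ofReal]
  congr 1
  ext x
  rw [weightReal_ofReal, eval_map_ofReal]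
  simp only [eval_mul, eval_pow, eval_X]
  push_cast
  ring

include hV hD he hl in
theorem alpha_dual (P : ℝ[X]) (i : ℕ) : alpha V i ((dual V P).map (algebraMap ℝ ℂ)) =
    ((skewForm V P (X ^ i) / (V.leadingCoeff * D) : ℝ) : ℂ) := by
  have hD0 : (D : ℝ) ≠ 0 := by positivity
  have hl0 := hl.ne'
  rw [alpha_map, skewForm_eq_moment_dual hV hD he hl, mul_div_cancel_left₀ _ (by positivity)]

/-! ### Nondegeneracy and skew-orthogonal polynomials -/

include hV hD he hl in
theorem eq_zero_of_radical {P : ℝ[X]} {N : ℕ} (hP : P.degree < N)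
    (h : ∀ Q : ℝ[X], Q.degree < (N + 1 : ℕ) → skewForm V P Q = 0) : P = 0 := by
  by_contra hne
  refine (skewForm_mul_X_pos hV hD he hl hne).ne' (h _ ?_)
  rw [degree_eq_natDegree hne] at hP
  rw [degree_eq_natDegree (mul_ne_zero X_ne_zero hne), natDegree_X_mul hne]
  norm_cast at hP ⊢
  omega

theorem det_eq_zero_of_skew {m : ℕ} {A : Matrix (Fin (2 * m + 1)) (Fin (2 * m + 1)) ℝ}
    (h : A.transpose = -A) : A.det = 0 := by
  have h1 := A.det_transpose
  rw [h, Matrix.det_neg, Fintype.card_fin, pow_succ, pow_mul] at h1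
  simp at h1
  linarith

include hV hD he hl in
-- A skew matrix of odd size is singular, so the Gram matrix of `1, …, x^{2m}` has a kernel vector.
-- It has degree exactly `2m`, since in lower degree it could be tested against `x` times itself.
theorem exists_even_skewOrthogonal (m : ℕ) : ∃ P : ℝ[X], P.Monic ∧ P.natDegree = 2 * m ∧
    ∀ Q : ℝ[X], Q.degree < (2 * m + 1 : ℕ) → skewForm V P Q = 0 := by
  have hint := integrable_eval_mul_exp hV hD he hl
  set A : Matrix (Fin (2 * m + 1)) (Fin (2 * m + 1)) ℝ :=
    Matrix.of fun i j => skewForm V (X ^ (i : ℕ)) (X ^ (j : ℕ)) with hA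
  have hdet : A.det = 0 := det_eq_zero_of_skew (by
    ext i j
    simp only [hA, Matrix.transpose_apply, Matrix.of_apply, Matrix.neg_apply]
    exact skewForm_swap _ _ _)
  obtain ⟨v, hv0, hv⟩ := Matrix.exists_mulVec_eq_zero_iff.2 hdet
  set P : ℝ[X] := ∑ j : Fin (2 * m + 1), C (v j) * X ^ (j : ℕ) with hP
  have hcoeff : ∀ j : Fin (2 * m + 1), P.coeff j = v j := fun j => by
    simp only [hP, finsetSum_coeff, coeff_C_mul, coeff_X_pow]
    rw [Finset.sum_eq_single j]
    · simp
    · intro b _ hb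
      rw [if_neg fun h => hb (Fin.ext h.symm), mul_zero]
    · simp
  have hPne : P ≠ 0 := fun h => hv0 (funext fun j => by rw [← hcoeff, h]; simp)
  have hPdeg : P.degree < (2 * m + 1 : ℕ) :=
    (degree_sum_le _ _).trans_lt ((Finset.sup_lt_iff (by exact WithBot.bot_lt_coe _)).2
      fun j _ => (degree_C_mul_X_pow_le _ _).trans_lt (by exact_mod_cast j.2))
  have hrad : ∀ Q : ℝ[X], Q.degree < (2 * m + 1 : ℕ) → skewForm V P Q = 0 := by
    intro Q hQ
    rw [← skewMap_apply hint]
    refine eq_zero_of_monic_basis (skewMap V hint P) (P := fun j => X ^ j)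
      (fun j => monic_X_pow j) (fun j => natDegree_X_pow j) (fun j hj => ?_) hQ
    have h1 := congrFun hv ⟨j, hj⟩
    simp only [Matrix.mulVec, dotProduct, hA, Matrix.of_apply, Pi.zero_apply] at h1
    rw [skewMap_apply, skewForm_swap, ← skewMap_apply hint, hP, map_sum, neg_eq_zero, ← h1]
    refine Finset.sum_congr rfl fun i _ => ?_
    rw [← smul_eq_C_mul, map_smul, skewMap_apply, smul_eq_mul, mul_comm]
  have hnat : P.natDegree = 2 * m := by
    have h1 : P.natDegree < 2 * m + 1 := (natDegree_lt_iff_degree_lt hPne).2 hPdeg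
    by_contra hne
    exact hPne (eq_zero_of_radical hV hD he hl (N := 2 * m)
      ((natDegree_lt_iff_degree_lt hPne).1 (by omega)) hrad)
  have hlc : P.leadingCoeff ≠ 0 := leadingCoeff_ne_zero.2 hPne
  refine ⟨C P.leadingCoeff⁻¹ * P, ?_, ?_, fun Q hQ => ?_⟩
  · rw [Monic, leadingCoeff_mul, leadingCoeff_C, inv_mul_cancel₀ hlc]
  · rw [natDegree_C_mul (inv_ne_zero hlc), hnat]
  · rw [← skewMap_apply hint, ← smul_eq_C_mul, map_smul, LinearMap.smul_apply, skewMap_apply,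
      hrad Q hQ, smul_zero]

include hV hD he hl in
-- If the top coefficient of `d` vanishes, `x d` is an admissible test polynomial and positivity
-- applies. Otherwise `d` and the polynomials of degree at most `2k` span degree at most `2k + 1`,
-- so the even skew-orthogonal `P` of degree `2k` would be orthogonal to `x P`.
theorem eq_zero_of_even_radical {m : ℕ} {d : ℝ[X]} (hd : d.degree < (2 * m : ℕ))
    (h : ∀ Q : ℝ[X], Q.degree < (2 * m : ℕ) → skewForm V d Q = 0) : d = 0 := by
  have hint := integrable_eval_mul_exp hV hD he hl
  rcases m with _ | k
  · simpa using hd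
  · have hcast : ((2 * (k + 1) : ℕ) : WithBot ℕ) = ((2 * k + 1 + 1 : ℕ) : WithBot ℕ) := rfl
    obtain ⟨P, hPm, hPd, hP⟩ := exists_even_skewOrthogonal hV hD he hl k
    have hP0 : P ≠ 0 := hPm.ne_zero
    have hPdeg : P.degree < (2 * k + 1 : ℕ) := (natDegree_lt_iff_degree_lt hP0).1 (by omega)
    have hPdeg' : P.degree < (2 * (k + 1) : ℕ) := (natDegree_lt_iff_degree_lt hP0).1 (by omega)
    by_cases hc : d.coeff (2 * k + 1) = 0
    · refine eq_zero_of_radical hV hD he hl (N := 2 * k + 1) ?_ h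
      rw [degree_lt_iff_coeff_zero] at hd ⊢
      intro i hi
      rcases Nat.eq_or_lt_of_le hi with rfl | hi
      · exact hc
      · exact hd i (by omega)
    · refine absurd (eq_zero_of_radical hV hD he hl hPdeg fun Q hQ => ?_) hP0
      set a := Q.coeff (2 * k + 1) / d.coeff (2 * k + 1) with ha
      have h1 : (Q - C a * d).degree < (2 * k + 1 : ℕ) := by
        rw [degree_lt_iff_coeff_zero] at hd hQ ⊢
        intro i hi
        rw [coeff_sub, coeff_C_mul]
        rcases Nat.eq_or_lt_of_le hi with rfl | hi
        · rw [ha]; field_simp; ring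
        · rw [hd i (by omega), hQ i (by omega)]; ring
      have h2 := hP _ h1
      rw [← skewMap_apply hint, map_sub, ← smul_eq_C_mul, map_smul, skewMap_apply, skewMap_apply,
        skewForm_swap V P d, h P hPdeg', neg_zero, smul_zero, sub_zero] at h2
      exact h2

theorem monic_sub_degree_lt {P Q : ℝ[X]} {m : ℕ} (hP : P.Monic) (hPd : P.natDegree = m)
    (hQ : Q.Monic) (hQd : Q.natDegree = m) : (P - Q).degree < m := by
  have h1 : P.degree = m := by rw [degree_eq_natDegree hP.ne_zero, hPd]
  have h2 : Q.degree = m := by rw [degree_eq_natDegree hQ.ne_zero, hQd]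
  rw [← h1]
  exact degree_sub_lt_left (h1.trans h2.symm) hP.ne_zero (by rw [hP.leadingCoeff, hQ.leadingCoeff])

include hV hD he hl in
-- Nondegeneracy below degree `2m` corrects `x^{2m+1}` to an orthogonal polynomial. Multiples of the
-- even polynomial of degree `2m` can still be added freely, and this freedom serves the
-- normalization.
theorem exists_odd_skewOrthogonal (m : ℕ) : ∃ P : ℝ[X], P.Monic ∧ P.natDegree = 2 * m + 1 ∧
    (dual V P).nextCoeff = 0 ∧
    ∀ Q : ℝ[X], Q.degree < (2 * m : ℕ) → skewForm V P Q = 0 := by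
  have hint := integrable_eval_mul_exp hV hD he hl
  obtain ⟨E, hEm, hEd, hE⟩ := exists_even_skewOrthogonal hV hD he hl m
  have hbasis : ∀ P : ℝ[X], (∀ i < 2 * m, skewForm V P (X ^ i) = 0) →
      ∀ Q : ℝ[X], Q.degree < (2 * m : ℕ) → skewForm V P Q = 0 := fun P hP Q hQ => by
    rw [← skewMap_apply hint]
    exact eq_zero_of_monic_basis (skewMap V hint P) (P := fun j => X ^ j)
      (fun j => monic_X_pow j) (fun j => natDegree_X_pow j)
      (fun j hj => by rw [skewMap_apply]; exact hP j hj) hQ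
  let φ : ℝ[X] →ₗ[ℝ] (Fin (2 * m) → ℝ) :=
    LinearMap.pi fun i => (skewMap V hint).flip (X ^ (i : ℕ))
  have hφ : ∀ P i, φ P i = skewForm V P (X ^ (i : ℕ)) := fun P i => by
    simp [φ, skewMap_apply]
  obtain ⟨p, hp, hpv⟩ := surjective_of_injective_degreeLT φ (fun P hP h0 =>
    eq_zero_of_even_radical hV hD he hl hP (hbasis P fun i hi => by
      rw [← hφ P ⟨i, hi⟩, h0]; rfl)) (φ (X ^ (2 * m + 1)))
  -- The dual of the monic `E` has coefficient `1` in degree `2m + D - 1`, so subtracting `c E`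
  -- cancels this coefficient.
  set c := (gdual V (X ^ (2 * m + 1) - p)).coeff (2 * m + D - 1) with hc
  have hlow : (p + C c * E).degree < (X ^ (2 * m + 1) : ℝ[X]).degree := by
    rw [degree_X_pow]
    refine (degree_add_le _ _).trans_lt (max_lt (hp.trans (by exact_mod_cast (by omega))) ?_)
    rw [← smul_eq_C_mul]
    refine (degree_smul_le _ _).trans_lt ?_
    rw [degree_eq_natDegree hEm.ne_zero, hEd]
    exact_mod_cast (by omega)
  have hm : (X ^ (2 * m + 1) - (p + C c * E)).Monic := (monic_X_pow _).sub_of_left hlow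
  have hnd : (X ^ (2 * m + 1) - (p + C c * E)).natDegree = 2 * m + 1 :=
    natDegree_eq_of_degree_eq_some (by rw [degree_sub_eq_left_of_degree_lt hlow, degree_X_pow])
  refine ⟨_, hm, hnd, ?_, ?_⟩
  · have h1 : (dual V (X ^ (2 * m + 1) - (p + C c * E))).natDegree = 2 * m + 1 + D - 1 :=
      natDegree_gdual hV (by omega) hm hnd
    rw [nextCoeff_of_natDegree_pos (by omega), h1, dual_eq_gdual, ← sub_sub, gdual_sub,
      gdual_C_mul, coeff_sub, coeff_C_mul, show 2 * m + 1 + D - 1 - 1 = 2 * m + D - 1 by omega,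
      coeff_gdual hV (by omega) hEd.le, ← hc, ← hEd, coeff_natDegree, hEm.leadingCoeff]
    ring
  · refine hbasis _ fun i hi => ?_
    have h1 : φ (X ^ (2 * m + 1) - (p + C c * E)) ⟨i, hi⟩ = 0 := by
      rw [map_sub, map_add, hpv, ← smul_eq_C_mul, map_smul, sub_add_cancel_left, Pi.neg_apply,
        Pi.smul_apply, hφ, hE _ (by rw [degree_X_pow]; exact_mod_cast (by simp; omega)), smul_zero,
        neg_zero]
    rwa [hφ] at h1

include hV hD he hl in
theorem IsSkewOrthogonal.even_orthogonal {P : ℕ → ℝ[X]} (h : IsSkewOrthogonal V P) (m : ℕ)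
    {Q : ℝ[X]} (hQ : Q.degree < (2 * m + 1 : ℕ)) : skewForm V (P (2 * m)) Q = 0 := by
  have hint := integrable_eval_mul_exp hV hD he hl
  rw [← skewMap_apply hint]
  refine eq_zero_of_monic_basis _ h.monic h.natDegree_eq (fun j hj => ?_) hQ
  rw [skewMap_apply]
  rcases Nat.even_or_odd' j with ⟨l, rfl | rfl⟩
  · exact h.even_even _ _
  · exact h.even_odd _ _ (by omega)

include hV hD he hl in
theorem IsSkewOrthogonal.odd_orthogonal {P : ℕ → ℝ[X]} (h : IsSkewOrthogonal V P) (m : ℕ)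
    {Q : ℝ[X]} (hQ : Q.degree < (2 * m : ℕ)) : skewForm V (P (2 * m + 1)) Q = 0 := by
  have hint := integrable_eval_mul_exp hV hD he hl
  rw [← skewMap_apply hint]
  refine eq_zero_of_monic_basis _ h.monic h.natDegree_eq (fun j hj => ?_) hQ
  rw [skewMap_apply]
  rcases Nat.even_or_odd' j with ⟨l, rfl | rfl⟩
  · rw [skewForm_swap, h.even_odd _ _ (by omega), neg_zero]
  · exact h.odd_odd _ _

include hV hD he hl in
-- Otherwise `P_{2m}` would be orthogonal to everything of degree at most `2m + 1`, an
-- even-dimensional space on which the form is nondegenerate.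
theorem IsSkewOrthogonal.skewNorm_ne_zero {P : ℕ → ℝ[X]} (h : IsSkewOrthogonal V P) (m : ℕ) :
    skewNorm V P m ≠ 0 := by
  have hint := integrable_eval_mul_exp hV hD he hl
  intro h0
  refine (h.monic (2 * m)).ne_zero (eq_zero_of_even_radical hV hD he hl (m := m + 1) ?_
    fun Q hQ => ?_)
  · rw [degree_eq_natDegree (h.monic _).ne_zero, h.natDegree_eq]
    exact_mod_cast (by omega)
  · rw [← skewMap_apply hint]
    refine eq_zero_of_monic_basis _ h.monic h.natDegree_eq (fun j hj => ?_) hQ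
    rw [skewMap_apply]
    rcases Nat.lt_or_ge j (2 * m + 1) with hj' | hj'
    · refine h.even_orthogonal hV hD he hl m ?_
      rw [degree_eq_natDegree (h.monic _).ne_zero, h.natDegree_eq]
      exact_mod_cast hj'
    · obtain rfl : j = 2 * m + 1 := by omega
      exact h0

include hV hD he hl in
theorem exists_isNormalizedSkewOrthogonal : ∃ P : ℕ → ℝ[X], IsNormalizedSkewOrthogonal V P := by
  choose E hEm hEd hE using exists_even_skewOrthogonal hV hD he hl
  choose O hOm hOd hOn hO using exists_odd_skewOrthogonal hV hD he hl
  have hEdeg : ∀ n, (E n).degree = (2 * n : ℕ) := fun n => by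
    rw [degree_eq_natDegree (hEm n).ne_zero, hEd]
  have hOdeg : ∀ n, (O n).degree = (2 * n + 1 : ℕ) := fun n => by
    rw [degree_eq_natDegree (hOm n).ne_zero, hOd]
  set P : ℕ → ℝ[X] := fun j => if j % 2 = 0 then E (j / 2) else O (j / 2) with hP
  have he' : ∀ n, P (2 * n) = E n := fun n => by
    simp only [hP]
    rw [if_pos (by omega), Nat.mul_div_cancel_left n two_pos]
  have ho' : ∀ n, P (2 * n + 1) = O n := fun n => by
    simp only [hP]
    rw [if_neg (by omega), show (2 * n + 1) / 2 = n by omega]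
  refine ⟨P, ⟨⟨fun n => ?_, fun n => ?_, fun n m => ?_, fun n m => ?_, fun n m hnm => ?_⟩,
    fun n => ?_⟩⟩
  · rcases Nat.even_or_odd' n with ⟨l, rfl | rfl⟩
    · rw [he']; exact hEm l
    · rw [ho']; exact hOm l
  · rcases Nat.even_or_odd' n with ⟨l, rfl | rfl⟩
    · rw [he']; exact hEd l
    · rw [ho']; exact hOd l
  · rw [he', he']
    rcases le_total m n with h | h
    · exact hE n _ (by rw [hEdeg]; exact_mod_cast (by omega))
    · rw [skewForm_swap, hE m _ (by rw [hEdeg]; exact_mod_cast (by omega)), neg_zero]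
  · rw [ho', ho']
    rcases lt_trichotomy m n with h | rfl | h
    · exact hO n _ (by rw [hOdeg]; exact_mod_cast (by omega))
    · exact skewForm_self _ _
    · rw [skewForm_swap, hO m _ (by rw [hOdeg]; exact_mod_cast (by omega)), neg_zero]
  · rw [he', ho']
    rcases lt_or_gt_of_ne hnm with h | h
    · rw [skewForm_swap, hO m _ (by rw [hEdeg]; exact_mod_cast (by omega)), neg_zero]
    · exact hE n _ (by rw [hOdeg]; exact_mod_cast (by omega))
  · rw [ho']; exact hOn n

include hV hD in
theorem IsNormalizedSkewOrthogonal.coeff_dual {P : ℕ → ℝ[X]} (h : IsNormalizedSkewOrthogonal V P)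
    (m : ℕ) : (dual V (P (2 * m + 1))).coeff (2 * m + D - 1) = 0 := by
  have h1 : (dual V (P (2 * m + 1))).natDegree = 2 * m + 1 + D - 1 :=
    natDegree_gdual hV (by omega) (h.monic _) (h.natDegree_eq _)
  have h2 := h.nextCoeff_dual m
  rwa [nextCoeff_of_natDegree_pos (by omega), h1,
    show 2 * m + 1 + D - 1 - 1 = 2 * m + D - 1 by omega] at h2

include hV hD he hl in
-- Two even polynomials differ by a radical element of degree below `2m`, hence by zero. Two odd
-- ones differ by a multiple `c P_{2m}`, and comparing the normalized coefficients of the duals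
-- gives `c = 0`.
theorem IsNormalizedSkewOrthogonal.unique {P P' : ℕ → ℝ[X]} (h : IsNormalizedSkewOrthogonal V P)
    (h' : IsNormalizedSkewOrthogonal V P') : P = P' := by
  have hint := integrable_eval_mul_exp hV hD he hl
  have hsub : ∀ A B Q : ℝ[X], skewForm V (A - B) Q = skewForm V A Q - skewForm V B Q :=
    fun A B Q => by simp only [← skewMap_apply hint, map_sub, LinearMap.sub_apply]
  have heven : ∀ m, P (2 * m) = P' (2 * m) := fun m => by
    rw [← sub_eq_zero]
    refine eq_zero_of_even_radical hV hD he hl (m := m)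
      (monic_sub_degree_lt (h.monic _) (h.natDegree_eq _) (h'.monic _) (h'.natDegree_eq _))
      fun Q hQ => ?_
    have hQ' : Q.degree < (2 * m + 1 : ℕ) := hQ.trans (by exact_mod_cast (by omega))
    rw [hsub, h.even_orthogonal hV hD he hl m hQ', h'.even_orthogonal hV hD he hl m hQ', sub_zero]
  funext n
  rcases Nat.even_or_odd' n with ⟨m, rfl | rfl⟩
  · exact heven m
  · have hd := monic_sub_degree_lt (h.monic (2 * m + 1)) (h.natDegree_eq _) (h'.monic _)
      (h'.natDegree_eq _)
    set d := P (2 * m + 1) - P' (2 * m + 1) with hdd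
    set c := d.coeff (2 * m) with hc
    have hPc : (P (2 * m)).coeff (2 * m) = 1 := by
      have := (h.monic (2 * m)).leadingCoeff
      rwa [leadingCoeff, h.natDegree_eq] at this
    have h1 : d - C c * P (2 * m) = 0 := by
      refine eq_zero_of_even_radical hV hD he hl (m := m) ?_ fun Q hQ => ?_
      · rw [degree_lt_iff_coeff_zero] at hd ⊢
        intro i hi
        rw [coeff_sub, coeff_C_mul]
        rcases Nat.eq_or_lt_of_le hi with rfl | hi
        · rw [hPc, mul_one, sub_self]
        · rw [hd i hi, coeff_eq_zero_of_natDegree_lt (by rwa [h.natDegree_eq])]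
          ring
      · have hQ' : Q.degree < (2 * m + 1 : ℕ) := hQ.trans (by exact_mod_cast (by omega))
        have h3 : skewForm V (C c * P (2 * m)) Q = 0 := by
          rw [← skewMap_apply hint, ← smul_eq_C_mul, map_smul, LinearMap.smul_apply, skewMap_apply,
            h.even_orthogonal hV hD he hl m hQ', smul_zero]
        rw [hsub, hsub, h.odd_orthogonal hV hD he hl m hQ, h'.odd_orthogonal hV hD he hl m hQ, h3]
        ring
    rw [sub_eq_zero] at h1
    have h2 : (gdual V d).coeff (2 * m + D - 1) = 0 := by
      rw [hdd, gdual_sub, coeff_sub]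
      have e1 := h.coeff_dual hV hD m
      have e2 := h'.coeff_dual hV hD m
      rw [dual_eq_gdual] at e1 e2
      rw [e1, e2, sub_zero]
    rw [h1, gdual_C_mul, coeff_C_mul, coeff_gdual hV (by omega) (h.natDegree_eq _).le, hPc,
      mul_one] at h2
    rw [h2] at h1
    rw [← sub_eq_zero, ← hdd, h1]
    simp

end Skew

/-! ### The functionals `α` and `β` -/

section Functionals

variable {V : ℝ[X]} {D : ℕ} (hV : V.natDegree = D) (hD : 2 ≤ D) (he : Even D)
  (hl : 0 < V.leadingCoeff) (n : ℕ)

theorem alpha_eq_zero_mul (V : ℝ[X]) (i : ℕ) (Q : ℂ[X]) :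
    alpha V i Q = ∫ t : ℝ, weightReal V t * (X ^ i * Q).eval (t : ℂ) := by
  have := alpha_eq V 0 i Q
  rw [zero_add] at this
  rw [this, alpha_zero]
  rfl

include hV hD he hl in
theorem alpha_add (i : ℕ) (Q R : ℂ[X]) : alpha V i (Q + R) = alpha V i Q + alpha V i R := by
  have hint := integrable_weightReal hV hD he hl
  rw [alpha_eq_zero_mul, alpha_eq_zero_mul, alpha_eq_zero_mul, ← integral_add (hint _) (hint _)]
  simp only [mul_add, eval_add]

theorem alpha_C_mul (V : ℝ[X]) (i : ℕ) (a : ℂ) (Q : ℂ[X]) :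
    alpha V i (C a * Q) = a * alpha V i Q := by
  rw [alpha_eq_zero_mul, alpha_eq_zero_mul, ← integral_const_mul]
  congr 1
  ext t
  simp only [eval_mul, eval_C]
  ring

theorem beta_top (V : ℝ[X]) (hD : 0 < D) (Q : ℂ[X]) :
    beta V D n D Q = -Q.coeff (2 * n + D - 1) := by
  have hpi := Complex.two_pi_I_ne_zero
  rw [beta, if_pos rfl, integralTorus_weight hD]
  field_simp

theorem beta_of_ne (V : ℝ[X]) {k : ℕ} (hk : k ≠ D) (Q : ℂ[X]) : beta V D n k Q =
    -(1 / (2 * Real.pi * Complex.I)) * integralGam D k fun x => weightGam V x * Q.eval x := by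
  rw [beta, if_neg hk]

include hV hD hl in
theorem beta_add (k : ℕ) (Q R : ℂ[X]) :
    beta V D n k (Q + R) = beta V D n k Q + beta V D n k R := by
  by_cases hk : k = D
  · subst hk
    simp only [beta_top n V (by omega : 0 < k), coeff_add]
    ring
  · have hQ := gamDecay_weightGam hV hD hl k Q
    have hR := gamDecay_weightGam hV hD hl k R
    simp only [beta_of_ne n V hk, integralGam_eq, eval_add, mul_add]
    rw [integral_add hQ.zero.integrableOn hR.zero.integrableOn,
      integral_add hQ.rot.integrableOn hR.rot.integrableOn]
    ring

include hD in
theorem beta_C_mul (V : ℝ[X]) (k : ℕ) (a : ℂ) (Q : ℂ[X]) :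
    beta V D n k (C a * Q) = a * beta V D n k Q := by
  by_cases hk : k = D
  · subst hk
    simp only [beta_top n V (by omega : 0 < k), coeff_C_mul]
    ring
  · simp only [beta_of_ne n V hk, integralGam_eq, eval_mul, eval_C, mul_left_comm _ a,
      integral_const_mul]
    ring

include hV hD hl in
-- The integrand is the derivative of `e^{-V} P` along the ray. The boundary value at the origin is
-- the same for every `k`, so it cancels between the two rays of `Γ_k`.
theorem ray_integral_derivative (k : ℕ) (P : ℂ[X]) :
    (omega D ^ k * ∫ t in Ioi (0 : ℝ), weightGam V (omega D ^ k * t) *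
      (derivative P - derivative (V.map (algebraMap ℝ ℂ)) * P).eval (omega D ^ k * t)) =
      -(weightGam V 0 * P.eval 0) := by
  set U := V.map (algebraMap ℝ ℂ) with hU
  have hw : ∀ z, weightGam V z = Complex.exp (-U.eval z) := fun z => by
    rw [weightGam, hU, eval_map_algebraMap]
  have hdec := (gamDecay_weightGam hV hD hl k (derivative P - derivative U * P)).rot
  have hlim := (gamDecay_weightGam hV hD hl k P).rot.tendsto_zero
  have hder : ∀ t : ℝ, HasDerivAt (fun t : ℝ => weightGam V (omega D ^ k * t) *
      P.eval (omega D ^ k * t)) (omega D ^ k * (weightGam V (omega D ^ k * t) *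
      (derivative P - derivative U * P).eval (omega D ^ k * t))) t := fun t => by
    have h1 : HasDerivAt (fun t : ℝ => omega D ^ k * (t : ℂ)) (omega D ^ k) t := by
      simpa using (Complex.ofRealCLM.hasDerivAt (x := t)).const_mul (omega D ^ k)
    simp only [hw]
    rw [mul_comm (omega D ^ k) (Complex.exp _ * _)]
    exact (hasDerivAt_exp_mul U P (omega D ^ k * t)).comp t h1
  have := integral_Ioi_of_hasDerivAt_of_tendsto' (a := 0) (fun t _ => hder t)
    (hdec.integrableOn.const_mul (omega D ^ k)) hlim
  rw [integral_const_mul] at this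
  rw [this]
  simp

include hV hD hl in
theorem integralGam_gdual (k : ℕ) (P : ℂ[X]) : integralGam D k (fun x => weightGam V x *
    (gdual (V.map (algebraMap ℝ ℂ)) P).eval x) = 0 := by
  have h1 := ray_integral_derivative hV hD hl k P
  have h2 := ray_integral_derivative hV hD hl 0 P
  simp only [pow_zero, one_mul] at h2
  simp only [integralGam_eq, gdual, eval_mul, eval_C,
    mul_left_comm (weightGam V _) (-(1 / ((V.map (algebraMap ℝ ℂ)).leadingCoeff * _))),
    integral_const_mul]
  linear_combination
    (-(1 / ((V.map (algebraMap ℝ ℂ)).leadingCoeff * ((V.map (algebraMap ℝ ℂ)).natDegree : ℂ)))) *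
      (h2 - h1)

include hV hD hl in
theorem beta_gdual {k : ℕ} (hk : k ≠ D) (P : ℂ[X]) :
    beta V D n k (gdual (V.map (algebraMap ℝ ℂ)) P) = 0 := by
  rw [beta_of_ne n V hk, integralGam_gdual hV hD hl, mul_zero]

/-! ### Unisolvence -/

include hV hD he hl in
theorem eq_zero_of_alpha_gdual {P : ℂ[X]} (hP : P.degree < (2 * n : ℕ))
    (hα : ∀ i < 2 * n, alpha V i (gdual (V.map (algebraMap ℝ ℂ)) P) = 0) : P = 0 := by
  have hint := integrable_eval_mul_exp hV hD he hl
  have hγ : V.leadingCoeff * (D : ℝ) ≠ 0 := by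
    have : (0 : ℝ) < D := by exact_mod_cast (by omega)
    positivity
  set A := rePart P with hA
  -- `Re (-i z) = Im z`, so `B` collects the imaginary parts. The moments of duals of real
  -- polynomials are real, hence the conditions on `A` and `B` separate.
  set B := rePart (C (-Complex.I) * P) with hB
  have hsplit : P = A.map (algebraMap ℝ ℂ) + C Complex.I * B.map (algebraMap ℝ ℂ) := by
    ext i
    rw [coeff_add, coeff_C_mul, coeff_map, coeff_map, coeff_rePart, coeff_rePart, coeff_C_mul]
    apply Complex.ext <;> simp
  have hAd : A.degree < (2 * n : ℕ) := by
    rw [degree_lt_iff_coeff_zero] at hP ⊢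
    intro i hi
    rw [coeff_rePart, hP i hi, Complex.zero_re]
  have hBd : B.degree < (2 * n : ℕ) := by
    rw [degree_lt_iff_coeff_zero] at hP ⊢
    intro i hi
    rw [coeff_rePart, coeff_C_mul, hP i hi, mul_zero, Complex.zero_re]
  have hzero : ∀ i < 2 * n, skewForm V A (X ^ i) = 0 ∧ skewForm V B (X ^ i) = 0 := by
    intro i hi
    have h1 := hα i hi
    rw [hsplit, gdual_add, gdual_C_mul, ← map_dual, ← map_dual, alpha_add hV hD he hl,
      alpha_C_mul, alpha_dual hV hD he hl, alpha_dual hV hD he hl] at h1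
    have hre := congrArg Complex.re h1
    have him := congrArg Complex.im h1
    rw [Complex.add_re, Complex.I_mul_re, Complex.ofReal_re, Complex.ofReal_im, neg_zero, add_zero,
      Complex.zero_re, div_eq_zero_iff, or_iff_left hγ] at hre
    rw [Complex.add_im, Complex.I_mul_im, Complex.ofReal_re, Complex.ofReal_im, zero_add,
      Complex.zero_im, div_eq_zero_iff, or_iff_left hγ] at him
    exact ⟨hre, him⟩
  have hvan : ∀ p : ℝ[X], (∀ i < 2 * n, skewForm V p (X ^ i) = 0) → p.degree < (2 * n : ℕ) →
      p = 0 := fun p hp hpd => eq_zero_of_even_radical hV hD he hl hpd fun Q hQ => by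
    rw [← skewMap_apply hint]
    exact eq_zero_of_monic_basis (skewMap V hint p) (P := fun j => X ^ j)
      (fun j => monic_X_pow j) (fun j => natDegree_X_pow j)
      (fun j hj => by rw [skewMap_apply]; exact hp j hj) hQ
  rw [hsplit, hvan A (fun i hi => (hzero i hi).1) hAd, hvan B (fun i hi => (hzero i hi).2) hBd]
  simp

include hV hD he hl in
-- `β_D` removes the top coefficient, leaving a dual plus a remainder of degree at most `D - 2`. The
-- other `β_k` see only the remainder and force it to vanish; the `α_i` then see only the skew form.
theorem eq_zero_of_alpha_beta {R : ℂ[X]} (hR : R.natDegree ≤ 2 * n + D - 1)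
    (hα : ∀ i < 2 * n, alpha V i R = 0) (hβ : ∀ k ∈ Finset.Icc 1 D, beta V D n k R = 0) :
    R = 0 := by
  have hUd : (V.map (algebraMap ℝ ℂ)).natDegree = D := by rw [natDegree_map, hV]
  have htop : R.coeff (2 * n + D - 1) = 0 := by
    have := hβ D (Finset.mem_Icc.2 ⟨by omega, le_rfl⟩)
    rwa [beta_top n V (by omega), neg_eq_zero] at this
  have hR' : R.natDegree < 2 * n + (D - 1) := by
    refine lt_of_le_of_ne (by omega) fun h => ?_
    have h1 : R.leadingCoeff = 0 := by
      rw [leadingCoeff, h, show 2 * n + (D - 1) = 2 * n + D - 1 by omega, htop]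
    rw [leadingCoeff_eq_zero] at h1
    rw [h1, natDegree_zero] at h
    omega
  obtain ⟨P, hP, hr⟩ := exists_gdual_sub hUd hD (2 * n) R hR'
  have hRP : R - gdual (V.map (algebraMap ℝ ℂ)) P = 0 := by
    refine eq_zero_of_integralGam_eq_zero hV hD hl hr fun k hk => ?_
    rw [Finset.mem_Icc] at hk
    have hkD : k ≠ D := by omega
    have h1 : beta V D n k (R - gdual (V.map (algebraMap ℝ ℂ)) P) = 0 := by
      have h2 := beta_add hV hD hl n k (R - gdual (V.map (algebraMap ℝ ℂ)) P)
        (gdual (V.map (algebraMap ℝ ℂ)) P)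
      rw [sub_add_cancel, hβ k (Finset.mem_Icc.2 ⟨hk.1, by omega⟩), beta_gdual hV hD hl n hkD,
        add_zero] at h2
      exact h2.symm
    rw [beta_of_ne n V hkD, mul_eq_zero] at h1
    exact h1.resolve_left (by simp)
  rw [sub_eq_zero] at hRP
  rw [hRP] at hα ⊢
  rw [eq_zero_of_alpha_gdual hV hD he hl n hP hα]
  simp [gdual]

theorem degree_lt_iff_natDegree_le {K : Type*} [Field K] {P : K[X]} {N : ℕ} (hN : 0 < N) :
    P.degree < N ↔ P.natDegree ≤ N - 1 := by
  rw [degree_lt_iff_coeff_zero, natDegree_le_iff_coeff_eq_zero]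
  exact forall_congr' fun i => ⟨fun h hi => h (by omega), fun h hi => h (by omega)⟩

include hV hD he hl in
theorem exists_alpha_beta (b : ℕ → ℂ) : ∃ R : ℂ[X], R.natDegree ≤ 2 * n + D - 1 ∧
    (∀ i < 2 * n, alpha V i R = 0) ∧ ∀ k ∈ Finset.Icc 1 D, beta V D n k R = b k := by
  let φ : ℂ[X] →ₗ[ℂ] (Fin (2 * n + D) → ℂ) :=
    -- Index `2n + k - 1` carries `β_k`. The number of functionals equals the dimension of the
    -- polynomials of degree below `2n + D`, so injectivity suffices.
    { toFun := fun Q i => if (i : ℕ) < 2 * n then alpha V i Q else beta V D n (i + 1 - 2 * n) Q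
      map_add' := fun Q R => by
        ext i
        simp only [Pi.add_apply, alpha_add hV hD he hl, beta_add hV hD hl]
        split_ifs <;> rfl
      map_smul' := fun a Q => by
        ext i
        simp only [Pi.smul_apply, smul_eq_C_mul, alpha_C_mul, beta_C_mul hD, smul_eq_mul,
          RingHom.id_apply]
        split_ifs <;> rfl }
  have hα : ∀ Q, ∀ i (h : i < 2 * n), φ Q ⟨i, by omega⟩ = alpha V i Q := fun Q i h => if_pos h
  have hβ : ∀ Q, ∀ k (h1 : 1 ≤ k) (h2 : k ≤ D), φ Q ⟨2 * n + k - 1, by omega⟩ = beta V D n k Q :=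
    fun Q k h1 h2 => by
      refine (if_neg ?_).trans ?_
      · simp only; omega
      · congr 1; simp only; omega
  obtain ⟨R, hR, hφ⟩ := surjective_of_injective_degreeLT φ (fun P hP h0 => by
    rw [degree_lt_iff_natDegree_le (by omega)] at hP
    refine eq_zero_of_alpha_beta hV hD he hl n hP (fun i hi => ?_) fun k hk => ?_
    · rw [← hα P i hi, h0]; rfl
    · rw [Finset.mem_Icc] at hk
      rw [← hβ P k hk.1 hk.2, h0]; rfl)
    (fun i => if (i : ℕ) < 2 * n then 0 else b (i + 1 - 2 * n))
  refine ⟨R, (degree_lt_iff_natDegree_le (by omega)).1 hR, fun i hi => ?_, fun k hk => ?_⟩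
  · rw [← hα R i hi, hφ]
    exact if_pos hi
  · rw [Finset.mem_Icc] at hk
    rw [← hβ R k hk.1 hk.2, hφ]
    refine (if_neg ?_).trans ?_
    · simp only; omega
    · congr 1; simp only; omega

variable {n}

include hV hD he hl in
theorem IsAux.eq {j : ℕ} {Q R : ℂ[X]} (hQ : IsAux V D n j Q) (hR : IsAux V D n j R) : Q = R := by
  have hsub : Q - R = Q + C (-1) * R := by simp [sub_eq_add_neg]
  rw [← sub_eq_zero]
  refine eq_zero_of_alpha_beta hV hD he hl n
    ((natDegree_sub_le _ _).trans (max_le hQ.1 hR.1)) (fun i hi => ?_) fun k hk => ?_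
  · rw [hsub, alpha_add hV hD he hl, alpha_C_mul, hQ.2.1 i hi, hR.2.1 i hi]
    ring
  · rw [hsub, beta_add hV hD hl, beta_C_mul hD, hQ.2.2 k hk, hR.2.2 k hk]
    ring

include hV hD he hl in
theorem existsUnique_isAux (n j : ℕ) : ∃! Q : ℂ[X], IsAux V D n j Q := by
  obtain ⟨R, hR⟩ := exists_alpha_beta hV hD he hl n fun k => if k = j then 1 else 0
  exact ⟨R, hR, fun Q hQ => IsAux.eq hV hD he hl hQ hR⟩

include hD in
-- For `j < D` the condition on `β_D` says that the coefficient of `x^{2n+D-1}` vanishes, which is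
-- the stricter degree bound.
theorem IsAux.isEvenAux {j : ℕ} (hj : j ∈ Finset.Icc 1 (D - 1)) {R : ℂ[X]}
    (hR : IsAux V D n j R) : IsEvenAux V D n j R := by
  rw [Finset.mem_Icc] at hj
  refine ⟨?_, hR.2.1, fun k hk => hR.2.2 k ?_⟩
  · have h1 := hR.2.2 D (Finset.mem_Icc.2 ⟨by omega, le_rfl⟩)
    rw [beta_top n V (by omega), if_neg (by omega), neg_eq_zero] at h1
    have h2 := hR.1
    rw [natDegree_le_iff_coeff_eq_zero] at h2 ⊢
    intro i hi
    rcases Nat.lt_or_ge (2 * n + D - 1) i with h | h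
    · exact h2 i h
    · rwa [show i = 2 * n + D - 1 by omega]
  · rw [Finset.mem_Icc] at hk ⊢
    omega

include hD in
theorem IsEvenAux.isAux {j : ℕ} (hj : j ∈ Finset.Icc 1 (D - 1)) {R : ℂ[X]}
    (hR : IsEvenAux V D n j R) : IsAux V D n j R := by
  rw [Finset.mem_Icc] at hj
  refine ⟨hR.1.trans (by omega), hR.2.1, fun k hk => ?_⟩
  rw [Finset.mem_Icc] at hk
  by_cases hkD : k = D
  · subst hkD
    rw [beta_top n V (by omega), if_neg (by omega), coeff_eq_zero_of_natDegree_lt, neg_zero]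
    have := hR.1
    omega
  · exact hR.2.2 k (Finset.mem_Icc.2 ⟨hk.1, by omega⟩)

/-! ### The polynomials `Ψ` -/

theorem Psi_eq (V : ℝ[X]) (P : ℕ → ℝ[X]) (m : ℕ) :
    Psi V P m = gdual (V.map (algebraMap ℝ ℂ)) ((P m).map (algebraMap ℝ ℂ)) := map_dual V (P m)

include hV hD in
theorem natDegree_Psi {P : ℕ → ℝ[X]} (h : IsSkewOrthogonal V P) (m : ℕ) :
    (Psi V P m).natDegree = m + D - 1 := by
  rw [Psi, natDegree_map]
  exact natDegree_gdual hV (by omega) (h.monic m) (h.natDegree_eq m)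

include hV hD in
theorem coeff_Psi {P : ℕ → ℝ[X]} (h : IsSkewOrthogonal V P) (m : ℕ) :
    (Psi V P m).coeff (m + D - 1) = 1 := by
  have h1 := h.monic m
  rw [Monic, leadingCoeff, h.natDegree_eq] at h1
  rw [Psi, coeff_map, dual_eq_gdual, coeff_gdual hV (by omega) (h.natDegree_eq m).le, h1, map_one]

include hV hD he hl in
-- Being a dual, `Ψ_{2n}` is killed by `β_1, …, β_{D-1}`. The sign arises because `β_D` is minus the
-- coefficient of `x^{2n+D-1}`, which is `1` for `Ψ_{2n}`.
theorem isAux_neg_Psi {P : ℕ → ℝ[X]} (h : IsSkewOrthogonal V P) (n : ℕ) :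
    IsAux V D n D (-Psi V P (2 * n)) := by
  have hneg : -Psi V P (2 * n) = C (-1) * Psi V P (2 * n) := by simp
  refine ⟨by rw [natDegree_neg, natDegree_Psi hV hD h], fun i hi => ?_, fun k hk => ?_⟩
  · rw [hneg, alpha_C_mul, Psi, alpha_dual hV hD he hl, h.even_orthogonal hV hD he hl]
    · simp
    · rw [degree_X_pow]
      exact_mod_cast (by omega)
  · rw [hneg, beta_C_mul hD]
    split_ifs with hkD
    · subst hkD
      rw [beta_top n V (by omega), coeff_Psi hV hD h]
      ring
    · rw [Psi_eq, beta_gdual hV hD hl n hkD, mul_zero]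

end Functionals

/-! ### From scalar to matrix conditions -/

theorem mul_jumpMatrix_apply (V : ℝ[X]) (D n : ℕ) (x : ℂ) (M : Matrix (Fin (D + 2)) (Fin (D + 2)) ℂ)
    (i c : Fin (D + 2)) : (M * jumpMatrix V D n x) i c =
      if (c : ℕ) = 0 then M i 0 else M i 0 * jumpRow V D n x c + M i c := by
  rw [Matrix.mul_apply, Fin.sum_univ_succ]
  have h1 : ∀ k : Fin (D + 1), M i k.succ * jumpMatrix V D n x k.succ c =
      if k.succ = c then M i k.succ else 0 := fun k => by
    simp [jumpMatrix]
  simp only [h1]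
  have h2 : jumpMatrix V D n x 0 c = jumpRow V D n x c := by simp [jumpMatrix]
  rw [h2]
  refine Fin.cases ?_ (fun c => ?_) c
  · simp [jumpRow, Fin.succ_ne_zero]
  · simp [Finset.sum_ite_eq']

theorem exists_jump_of_hasJump {V : ℝ[X]} {D n : ℕ} {B : ℂ → Matrix (Fin (D + 2)) (Fin (D + 2)) ℂ}
    {q : Fin (D + 2) → ℂ → ℂ} (hq : ∀ i, Continuous (q i))
    (h0 : ∀ i (c : Fin (D + 2)) z, (c : ℕ) = 0 → B z i c = q i z)
    (h : ∀ i (c : Fin (D + 2)), (c : ℕ) ≠ 0 →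
      HasJump D (fun z => B z i c) fun x => q i x * jumpRow V D n x c) :
    ∃ Bp Bm : ℂ → Matrix (Fin (D + 2)) (Fin (D + 2)) ℂ,
      ContinuousOn Bp (Sig D \ selfInt D) ∧ ContinuousOn Bm (Sig D \ selfInt D) ∧
      ∀ x ∈ Sig D \ selfInt D,
        Tendsto B (𝓝[(Sig D)ᶜ ∩ leftSide D x] x) (𝓝 (Bp x)) ∧
        Tendsto B (𝓝[(Sig D)ᶜ ∩ rightSide D x] x) (𝓝 (Bm x)) ∧
        Bp x = Bm x * jumpMatrix V D n x := by
  have key : ∀ i c, ∃ fp fm : ℂ → ℂ, ContinuousOn fp (Sig D \ selfInt D) ∧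
      ContinuousOn fm (Sig D \ selfInt D) ∧ ∀ x ∈ Sig D \ selfInt D,
        Tendsto (fun z => B z i c) (𝓝[(Sig D)ᶜ ∩ leftSide D x] x) (𝓝 (fp x)) ∧
        Tendsto (fun z => B z i c) (𝓝[(Sig D)ᶜ ∩ rightSide D x] x) (𝓝 (fm x)) ∧
        fp x = (if (c : ℕ) = 0 then q i x else q i x * jumpRow V D n x c + fm x) ∧
        ((c : ℕ) = 0 → fm x = q i x) := by
    intro i c
    by_cases hc : (c : ℕ) = 0
    · have hB : (fun z => B z i c) = q i := funext fun z => h0 i c z hc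
      refine ⟨q i, q i, (hq i).continuousOn, (hq i).continuousOn, fun x _ => ?_⟩
      rw [hB, if_pos hc]
      exact ⟨(hq i).continuousAt.mono_left nhdsWithin_le_nhds,
        (hq i).continuousAt.mono_left nhdsWithin_le_nhds, rfl, fun _ => rfl⟩
    · obtain ⟨fp, fm, h1, h2, h3⟩ := h i c hc
      refine ⟨fp, fm, h1, h2, fun x hx => ?_⟩
      obtain ⟨h4, h5, h6⟩ := h3 x hx
      exact ⟨h4, h5, by rw [if_neg hc, h6, add_comm], fun h => absurd h hc⟩
  choose fp fm h1 h2 h3 using key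
  refine ⟨fun x => Matrix.of fun i c => fp i c x, fun x => Matrix.of fun i c => fm i c x,
    continuousOn_pi.2 fun i => continuousOn_pi.2 fun c => h1 i c,
    continuousOn_pi.2 fun i => continuousOn_pi.2 fun c => h2 i c, fun x hx => ⟨?_, ?_, ?_⟩⟩
  · exact tendsto_pi_nhds.2 fun i => tendsto_pi_nhds.2 fun c => (h3 i c x hx).1
  · exact tendsto_pi_nhds.2 fun i => tendsto_pi_nhds.2 fun c => (h3 i c x hx).2.1
  · ext i c
    rw [mul_jumpMatrix_apply]
    simp only [Matrix.of_apply]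
    rw [(h3 i c x hx).2.2.1, (h3 i 0 x hx).2.2.2 rfl]

/-- The reciprocals of the diagonal entries of `normMatrix`. -/
def normInv (D n : ℕ) (z : ℂ) (c : Fin (D + 2)) : ℂ :=
  if (c : ℕ) = 0 then (z ^ (2 * n + D))⁻¹ else if (c : ℕ) = 1 then z ^ (2 * n) else z

theorem mul_normMatrix_apply {D n : ℕ} {z : ℂ} (M : Matrix (Fin (D + 2)) (Fin (D + 2)) ℂ)
    (i c : Fin (D + 2)) : (M * normMatrix D n z) i c = M i c * (normInv D n z c)⁻¹ := by
  rw [normMatrix, Matrix.mul_diagonal, normInv]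
  split_ifs
  · rw [inv_inv]
  · rw [zpow_neg]
    norm_cast
  · rfl

theorem normInv_ne_zero (D n : ℕ) {z : ℂ} (hz : z ≠ 0) (c : Fin (D + 2)) :
    normInv D n z c ≠ 0 := by
  rw [normInv]
  split_ifs
  · exact inv_ne_zero (pow_ne_zero _ hz)
  · exact pow_ne_zero _ hz
  · exact hz

/-! ### Asymptotics of rows -/

theorem isBigO_eval_mul_inv_pow (D : ℕ) {N : ℕ} (hN : 0 < N) {Q : ℂ[X]} {a : ℂ}
    (hQ : (Q - C a * X ^ N).natDegree ≤ N - 1) :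
    (fun z => Q.eval z * (z ^ N)⁻¹ - a) =O[farOff D] fun z => z⁻¹ := by
  obtain ⟨q, hq, hq0, hqe⟩ := exists_norm_eval_le (Q - C a * X ^ N)
  refine Asymptotics.IsBigO.of_bound (q.eval 1) ?_
  filter_upwards [eventually_farOff_norm D 1] with z hz
  have hz0 : z ≠ 0 := norm_pos_iff.1 (zero_lt_one.trans_le hz)
  have h1 : Q.eval z * (z ^ N)⁻¹ - a = (Q - C a * X ^ N).eval z * (z ^ N)⁻¹ := by
    simp only [eval_sub, eval_mul, eval_C, eval_pow, eval_X]
    field_simp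
  have h2 : q.eval ‖z‖ ≤ q.eval 1 * ‖z‖ ^ (N - 1) := by
    rw [eval_eq_sum_range, eval_eq_sum_range, Finset.sum_mul]
    refine Finset.sum_le_sum fun i hi => ?_
    rw [one_pow, mul_one]
    refine mul_le_mul_of_nonneg_left (pow_le_pow_right₀ hz ?_) (hq0 i)
    have := Finset.mem_range.1 hi
    omega
  rw [h1, norm_mul, norm_inv, norm_inv, norm_pow]
  calc _ ≤ q.eval 1 * ‖z‖ ^ (N - 1) * (‖z‖ ^ N)⁻¹ := by
        gcongr
        exact (hqe z).trans h2
    _ = _ := by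
        obtain ⟨k, rfl⟩ : ∃ k, N = k + 1 := ⟨N - 1, by omega⟩
        have : ‖z‖ ≠ 0 := norm_ne_zero_iff.2 hz0
        rw [Nat.add_sub_cancel, pow_succ]
        field_simp

section Rows

variable {V : ℝ[X]} {D : ℕ} (hV : V.natDegree = D) (hD : 2 ≤ D) (he : Even D)
  (hl : 0 < V.leadingCoeff) {n : ℕ}

include hV hD he hl in
-- The dictionary between the normalization and the functionals: column `0` sees the coefficient of
-- `x^{2n+D}`, column `1` the moments `α`, and column `k + 1` the value `β_k`.
theorem isBigO_cauchyRow_normInv {Q : ℂ[X]} (i c : Fin (D + 2))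
    (hdeg : (Q - C (if (i : ℕ) = 0 then 1 else 0) * X ^ (2 * n + D)).natDegree ≤ 2 * n + D - 1)
    (hα : (i : ℕ) ≠ 1 → ∀ j < 2 * n, alpha V j Q = 0)
    (hα' : (i : ℕ) = 1 → 0 < n ∧ (∀ j < 2 * n - 1, alpha V j Q = 0) ∧
      alpha V (2 * n - 1) Q = -(2 * Real.pi * Complex.I))
    (hβ : ∀ k ∈ Finset.Icc 1 D, beta V D n k Q = if k + 1 = (i : ℕ) then 1 else 0) :
    (fun z => cauchyRow V D n Q z c * normInv D n z c -
      (1 : Matrix (Fin (D + 2)) (Fin (D + 2)) ℂ) i c) =O[farOff D] fun z => z⁻¹ := by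
  simp only [Matrix.one_apply, Fin.ext_iff, normInv]
  by_cases hc0 : (c : ℕ) = 0
  · simp only [cauchyRow_zero V D n Q _ hc0, hc0]
    exact isBigO_eval_mul_inv_pow D (by omega) hdeg
  by_cases hc1 : (c : ℕ) = 1
  · simp only [hc1, one_ne_zero, if_false, if_true]
    by_cases hi : (i : ℕ) = 1
    · obtain ⟨hn, h1, h2⟩ := hα' hi
      have h3 := pow_mul_cauchyRow_add_alpha hV hD he hl n Q h1 hc1
      have hpi := Complex.two_pi_I_ne_zero
      refine h3.congr_left fun z => ?_
      rw [h2, if_pos hi, show 2 * n - 1 + 1 = 2 * n by omega]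
      field_simp
      ring
    · refine (isBigO_cauchyRow hV hD he hl n (X ^ (2 * n) * Q) (c := c) hc0).congr' ?_
        EventuallyEq.rfl
      filter_upwards [eventually_farOff_notMem D] with z hz
      rw [← pow_mul_cauchyRow_one hV hD he hl n Q (hα hi) hz hc1, if_neg hi]
      ring
  · simp only [if_neg hc0, if_neg hc1]
    have h1 := mul_cauchyRow_sub_beta hV hD hl n Q (c := c) (by omega)
    have h2 := c.2
    rw [hβ _ (Finset.mem_Icc.2 ⟨by omega, by omega⟩)] at h1
    refine h1.congr_left fun z => ?_
    rw [mul_comm]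
    congr 2
    exact propext (by omega)

/-! ### The explicit solution -/

include hV hD he hl in
-- `x^{2m+1}` and `P_{2m+1}` differ by a polynomial of degree at most `2m`, which is orthogonal to
-- `P_{2m}`.
theorem alpha_Psi_top {P : ℕ → ℝ[X]} (h : IsSkewOrthogonal V P) (m : ℕ) :
    alpha V (2 * m + 1) (Psi V P (2 * m)) =
      ((skewNorm V P m / (V.leadingCoeff * D) : ℝ) : ℂ) := by
  have hint := integrable_eval_mul_exp hV hD he hl
  rw [Psi, alpha_dual hV hD he hl, skewNorm]
  congr 2
  have h1 := monic_sub_degree_lt (monic_X_pow (2 * m + 1)) (natDegree_X_pow _)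
    (h.monic (2 * m + 1)) (h.natDegree_eq _)
  have h2 := h.even_orthogonal hV hD he hl m h1
  rw [← skewMap_apply hint, map_sub, sub_eq_zero, skewMap_apply, skewMap_apply] at h2
  exact h2

include hV hD he hl in
theorem alpha_Psi_even {P : ℕ → ℝ[X]} (h : IsSkewOrthogonal V P) {m j : ℕ} (hj : j < 2 * m + 1) :
    alpha V j (Psi V P (2 * m)) = 0 := by
  rw [Psi, alpha_dual hV hD he hl, h.even_orthogonal hV hD he hl]
  · simp
  · rw [degree_X_pow]
    exact_mod_cast hj

include hV hD he hl in
theorem alpha_Psi_odd {P : ℕ → ℝ[X]} (h : IsSkewOrthogonal V P) {m j : ℕ} (hj : j < 2 * m) :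
    alpha V j (Psi V P (2 * m + 1)) = 0 := by
  rw [Psi, alpha_dual hV hD he hl, h.odd_orthogonal hV hD he hl]
  · simp
  · rw [degree_X_pow]
    exact_mod_cast hj

include hV hD he hl in
theorem isBigO_explicitSolution {P : ℕ → ℝ[X]} (h : IsNormalizedSkewOrthogonal V P) {R : ℕ → ℂ[X]}
    (hR : ∀ j ∈ Finset.Icc 1 D, IsAux V D n j (R j)) (i c : Fin (D + 2)) :
    (fun z => explicitSolution V D n P R z i c * normInv D n z c -
      (1 : Matrix (Fin (D + 2)) (Fin (D + 2)) ℂ) i c) =O[farOff D] fun z => z⁻¹ := by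
  by_cases hi : n = 0 ∧ (i : ℕ) = 1
  · have hE : ∀ z, explicitSolution V D n P R z i c = if (c : ℕ) = 1 then 1 else 0 :=
      fun z => if_pos hi
    simp only [hE, Matrix.one_apply, Fin.ext_iff, hi.2]
    -- For `n = 0` the second diagonal factor is `z^0 = 1`, so the special row matches the identity
    -- with no error term.
    by_cases hc : (c : ℕ) = 1
    · simp [hc, hi.1, normInv, Asymptotics.isBigO_zero]
    · simp [hc, Ne.symm hc, Asymptotics.isBigO_zero]
  simp only [explicitSolution, Matrix.of_apply, if_neg hi]
  have hγ : (V.leadingCoeff : ℂ) ≠ 0 := by exact_mod_cast hl.ne'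
  have hDC : (D : ℂ) ≠ 0 := by exact_mod_cast (by omega : D ≠ 0)
  refine isBigO_cauchyRow_normInv hV hD he hl i c ?_ ?_ ?_ ?_ <;> rw [firstCol]
  · split_ifs with h0 h1
    · rw [natDegree_le_iff_coeff_eq_zero]
      intro j hj
      rw [coeff_sub, coeff_C_mul, coeff_X_pow, one_mul]
      split_ifs with hj'
      · have := coeff_Psi hV hD h.toIsSkewOrthogonal (2 * n + 1)
        rw [show 2 * n + 1 + D - 1 = 2 * n + D by omega] at this
        rw [hj', this, sub_self]
      · rw [coeff_eq_zero_of_natDegree_lt, sub_zero]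
        rw [natDegree_Psi hV hD h.toIsSkewOrthogonal]
        omega
    · rw [C_0, zero_mul, sub_zero]
      refine (natDegree_C_mul_le _ _).trans ?_
      rw [natDegree_Psi hV hD h.toIsSkewOrthogonal]
      omega
    · rw [C_0, zero_mul, sub_zero]
      exact (hR _ (Finset.mem_Icc.2 (by omega))).1
  · intro h1 j hj
    rw [if_neg h1]
    split_ifs with h0
    · exact alpha_Psi_odd hV hD he hl h.toIsSkewOrthogonal hj
    · exact (hR _ (Finset.mem_Icc.2 (by omega))).2.1 j hj
  · intro h1
    rw [if_neg (by omega), if_pos h1]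
    obtain ⟨m, rfl⟩ : ∃ m, n = m + 1 := ⟨n - 1, by omega⟩
    rw [show 2 * (m + 1) - 2 = 2 * m by omega, show 2 * (m + 1) - 1 = 2 * m + 1 by omega,
      Nat.add_sub_cancel]
    have hh : (skewNorm V P m : ℂ) ≠ 0 := by
      exact_mod_cast h.skewNorm_ne_zero hV hD he hl m
    refine ⟨by omega, fun j hj => ?_, ?_⟩
    · rw [alpha_C_mul, alpha_Psi_even hV hD he hl h.toIsSkewOrthogonal hj, mul_zero]
    -- The prefactor turns `h_{n-1} / (γD)` into `-2πi`, which cancels the `-1/(2πi)` in the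
    -- expansion of the column of `ℝ`.
    · rw [alpha_C_mul, alpha_Psi_top hV hD he hl h.toIsSkewOrthogonal]
      push_cast
      field_simp
  · intro k hk
    have hk' := Finset.mem_Icc.1 hk
    split_ifs with h0 h1 h2 h3 h4
    · omega
    · by_cases hkD : k = D
      -- The normalization of the odd polynomials is precisely the condition `β_D(Ψ_{2n+1}) = 0`.
      · have h1 := h.coeff_dual hV hD n
        rw [hkD, beta_top n V (by omega), Psi, coeff_map, h1, map_zero, neg_zero]
      · rw [Psi_eq, beta_gdual hV hD hl n hkD]
    · omega
    · rw [beta_C_mul hD]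
      by_cases hkD : k = D
      · rw [hkD, beta_top n V (by omega), coeff_eq_zero_of_natDegree_lt, neg_zero, mul_zero]
        rw [natDegree_Psi hV hD h.toIsSkewOrthogonal]
        omega
      · rw [Psi_eq, beta_gdual hV hD hl n hkD, mul_zero]
    · rw [(hR _ (Finset.mem_Icc.2 (by omega))).2.2 k hk, if_pos (by omega)]
    · rw [(hR _ (Finset.mem_Icc.2 (by omega))).2.2 k hk, if_neg (by omega)]

include hV hD he hl in
theorem isSolution_explicitSolution {P : ℕ → ℝ[X]} (h : IsNormalizedSkewOrthogonal V P)
    {R : ℕ → ℂ[X]} (hR : ∀ j ∈ Finset.Icc 1 D, IsAux V D n j (R j)) :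
    IsSolution V D n (explicitSolution V D n P R) where
  analytic i c := by
    refine DifferentiableOn.analyticOnNhd (fun z hz => ?_) (isClosed_Sig hD).isOpen_compl
    simp only [explicitSolution, Matrix.of_apply]
    split_ifs with hi hc
    · exact differentiableWithinAt_const _
    · exact differentiableWithinAt_const _
    · exact (differentiableAt_cauchyRow hV hD he hl n _ c hz).differentiableWithinAt
  jump := by
    refine exists_jump_of_hasJump (q := fun i z => if n = 0 ∧ (i : ℕ) = 1 then 0 else
      (firstCol V D n P R i).eval z) (fun i => ?_) (fun i c z hc => ?_) fun i c hc => ?_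
    · by_cases hi : n = 0 ∧ (i : ℕ) = 1
      · simp only [if_pos hi]; fun_prop
      · simp only [if_neg hi]; fun_prop
    · simp only [explicitSolution, Matrix.of_apply, cauchyRow_zero V D n _ z hc]
      simp [hc]
    · by_cases hi : n = 0 ∧ (i : ℕ) = 1
      · simp only [explicitSolution, Matrix.of_apply, if_pos hi, zero_mul]
        exact Continuous.hasJump continuous_const D
      · simp only [explicitSolution, Matrix.of_apply, if_neg hi]
        exact hasJump_cauchyRow hV hD he hl n _ hc
  bounded s hs := by
    have key : ∀ i c, BoundedNear D fun z => explicitSolution V D n P R z i c := fun i c => by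
      simp only [explicitSolution, Matrix.of_apply]
      split_ifs with hi hc
      · exact Continuous.boundedNear continuous_const D
      · exact Continuous.boundedNear continuous_const D
      · exact boundedNear_cauchyRow hV hD he hl n _ c
    choose M hM using fun i c => key i c s hs
    obtain ⟨K, hK⟩ := (Set.finite_range fun p : Fin (D + 2) × Fin (D + 2) => M p.1 p.2).bddAbove
    refine ⟨K, ?_⟩
    filter_upwards [eventually_all.2 fun i => eventually_all.2 (hM i)] with z hz i c
    exact (hz i c).trans (hK ⟨(i, c), rfl⟩)
  normalization := by
    refine ⟨fun z => Matrix.of fun i c => explicitSolution V D n P R z i c * normInv D n z c -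
      (1 : Matrix (Fin (D + 2)) (Fin (D + 2)) ℂ) i c, fun z hz => ?_,
      isBigO_explicitSolution hV hD he hl h hR⟩
    have hz0 : z ≠ 0 := fun h => hz (h ▸ zero_mem_Sig hD)
    ext i c
    rw [mul_normMatrix_apply, Matrix.add_apply]
    simp only [Matrix.of_apply]
    rw [add_sub_cancel, mul_inv_cancel_right₀ (normInv_ne_zero D n hz0 c)]

/-! ### Uniqueness -/

theorem neBot_of_ray {s : Set ℂ} {D : ℕ} (hD : 2 ≤ D) (hs : IsOpen s) {x v : ℂ}
    (h : ∀ t : ℝ, 0 < t → x + t * v ∈ s) : (𝓝[(Sig D)ᶜ ∩ s] x).NeBot := by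
  rw [← mem_closure_iff_nhdsWithin_neBot, inter_comm]
  refine closure_minimal ((dense_compl_Sig hD).open_subset_closure_inter hs) isClosed_closure ?_
  have h1 : Tendsto (fun t : ℝ => x + t * v) (𝓝[>] 0) (𝓝 x) := by
    have : Continuous fun t : ℝ => x + t * v := by fun_prop
    simpa using (this.tendsto 0).mono_left nhdsWithin_le_nhds
  refine mem_closure_of_tendsto h1 ?_
  filter_upwards [self_mem_nhdsWithin] with t ht using h t ht

/-- Limits from the right side are unique only if that side accumulates at `x`; the witness
direction is radial on the circle and normal on a ray. -/
theorem rightSide_neBot {D : ℕ} (hD : 2 ≤ D) {x : ℂ} (hx : x ∈ Sig D \ selfInt D) :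
    (𝓝[(Sig D)ᶜ ∩ rightSide D x] x).NeBot := by
  rcases (mem_Sig_iff hD).1 hx.1 with h | ⟨k, hk, h⟩
  · rw [(leftSide_of_mem_torus h hx.2 hD).2]
    refine neBot_of_ray hD (isOpen_lt continuous_const continuous_norm) (v := x) fun t ht => ?_
    have h1 : ‖x‖ = 1 := h
    have h2 : x + t * x = ((1 + t : ℝ) : ℂ) * x := by push_cast; ring
    rw [mem_ofPred_eq, h2, norm_mul, h1, mul_one, Complex.norm_of_nonneg (by positivity)]
    linarith
  · obtain ⟨-, him⟩ := mem_ray_iff.1 h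
    have h0 := omega_pow_ne_zero D k
    rcases Nat.eq_zero_or_pos k with rfl | hk0
    · rw [(leftSide_of_mem_ray_zero h hx.2 hD).2]
      rw [pow_zero, div_one] at him
      refine neBot_of_ray hD (isOpen_lt Complex.continuous_im continuous_const)
        (v := -Complex.I) fun t ht => ?_
      simpa [him] using ht
    · rw [(leftSide_of_mem_ray h hx.2 hk0.ne' hk).2]
      refine neBot_of_ray hD (isOpen_lt continuous_const (by fun_prop))
        (v := omega D ^ k * Complex.I) fun t ht => ?_
      have h1 : (x + t * (omega D ^ k * Complex.I)) / omega D ^ k =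
          x / omega D ^ k + t * Complex.I := by field_simp
      rw [mem_ofPred_eq, h1]
      simpa [him] using ht

include hV hD he hl in
-- The homogeneous problem for one row, to be applied to the difference of two solutions; no inverse
-- matrix is needed. The first entry is a polynomial of degree below `2n + D`, the others are its
-- Cauchy transforms, and the improved decay annihilates all the functionals of unisolvence.
theorem eq_zero_of_row {f : Fin (D + 2) → ℂ → ℂ} {f₀ : ℂ → ℂ}
    (hd : ∀ c z, z ∉ Sig D → DifferentiableAt ℂ (f c) z) (hj₀ : HasJump D (f 0) fun _ => 0)
    (hlim : ∀ x ∈ Sig D \ selfInt D,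
      Tendsto (f 0) (𝓝[(Sig D)ᶜ ∩ rightSide D x] x) (𝓝 (f₀ x)))
    (hj : ∀ c : Fin (D + 2), (c : ℕ) ≠ 0 → HasJump D (f c) fun x => f₀ x * jumpRow V D n x c)
    (hb : ∀ c, BoundedNear D (f c))
    (hinf : ∀ c, (fun z => f c z * normInv D n z c) =O[farOff D] fun z => z⁻¹) :
    ∀ c z, z ∉ Sig D → f c z = 0 := by
  obtain ⟨g, hg, hgf⟩ := exists_entire_extension hD (hd 0) hj₀ (hb 0)
  have hfar : ∀ᶠ z in farOff D, z ≠ 0 := by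
    filter_upwards [eventually_farOff_norm D 1] with z hz
    exact norm_pos_iff.1 (zero_lt_one.trans_le hz)
  have hO : g =O[farOff D] fun z => z ^ (2 * n + D - 1) := by
    refine ((hinf 0).mul (Asymptotics.isBigO_refl (fun z : ℂ => z ^ (2 * n + D)) _)).congr' ?_ ?_
    · filter_upwards [eventually_farOff_notMem D, hfar] with z hz hz0
      rw [hgf hz]
      simp only [normInv, Fin.val_zero, if_true]
      field_simp
    · filter_upwards [hfar] with z hz0
      obtain ⟨k, hk⟩ : ∃ k, 2 * n + D = k + 1 := ⟨2 * n + D - 1, by omega⟩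
      rw [hk, Nat.add_sub_cancel, pow_succ]
      field_simp
  obtain ⟨q, hq, hqe⟩ := eq_polynomial_of_isBigO hD hg hO
  have hf0 : ∀ z, z ∉ Sig D → f 0 z = q.eval z := fun z hz => by rw [← hqe, hgf hz]
  have hval : ∀ x ∈ Sig D \ selfInt D, f₀ x = q.eval x := fun x hx => by
    have := rightSide_neBot hD hx
    refine tendsto_nhds_unique (hlim x hx) ?_
    refine Tendsto.congr' ?_ (q.continuous.continuousAt.mono_left nhdsWithin_le_nhds)
    filter_upwards [self_mem_nhdsWithin] with z hz using (hf0 z hz.1).symm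
  have hrow : ∀ c z, z ∉ Sig D → f c z = cauchyRow V D n q z c := by
    intro c
    by_cases hc : (c : ℕ) = 0
    · obtain rfl : c = 0 := Fin.ext hc
      exact fun z hz => by rw [hf0 z hz, cauchyRow_zero V D n q z hc]
    · have hjump : HasJump D (fun z => f c z - cauchyRow V D n q z c) fun _ => 0 :=
        ((hj c hc).sub (hasJump_cauchyRow hV hD he hl n q hc)).congr (fun z _ => rfl)
          fun x hx => by simp only [hval x hx, sub_self]
      obtain ⟨G, hG, hGf⟩ := exists_entire_extension hD
        (fun z hz => (hd c z hz).fun_sub (differentiableAt_cauchyRow hV hD he hl n q c hz)) hjump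
        ((hb c).sub (boundedNear_cauchyRow hV hD he hl n q c))
      have hfO : f c =O[farOff D] fun z => z⁻¹ := by
        refine (Asymptotics.IsBigO.trans ?_ (hinf c))
        refine Asymptotics.IsBigO.of_bound 1 ?_
        filter_upwards [eventually_farOff_norm D 1] with z hz
        rw [one_mul, norm_mul]
        refine le_mul_of_one_le_right (norm_nonneg _) ?_
        rw [normInv, if_neg hc]
        split_ifs
        · rw [norm_pow]; exact one_le_pow₀ hz
        · exact hz
      have hGO : G =O[farOff D] fun z => z⁻¹ := by
        refine (hfO.sub (isBigO_cauchyRow hV hD he hl n q hc)).congr' ?_ EventuallyEq.rfl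
        filter_upwards [eventually_farOff_notMem D] with z hz using (hGf hz).symm
      intro z hz
      rw [← sub_eq_zero]
      exact (hGf hz).symm.trans (eq_zero_of_isBigO_inv_farOff hD hG hGO z)
  have hinf' : ∀ c : Fin (D + 2), (fun z => cauchyRow V D n q z c * normInv D n z c)
      =O[farOff D] fun z => z⁻¹ := fun c => by
    refine (hinf c).congr' ?_ EventuallyEq.rfl
    filter_upwards [eventually_farOff_notMem D] with z hz
    rw [hrow c z hz]
  have hq0 : q = 0 := by
    refine eq_zero_of_alpha_beta hV hD he hl n hq ?_ fun k hk => ?_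
    · refine alpha_eq_zero_of_isBigO hV hD he hl n q (c := ⟨1, by omega⟩) rfl (2 * n) ?_
      refine (hinf' ⟨1, by omega⟩).congr_left fun z => ?_
      simp [normInv, mul_comm]
    · rw [Finset.mem_Icc] at hk
      have := beta_eq_zero_of_isBigO hV hD hl n q (c := ⟨k + 1, by omega⟩) (by simp only; omega)
        ((hinf' ⟨k + 1, by omega⟩).congr_left fun z => by
          simp [normInv, mul_comm, show k ≠ 0 by omega])
      simpa using this
  intro c z hz
  rw [hrow c z hz, hq0]
  by_cases hc : (c : ℕ) = 0
  · rw [cauchyRow_zero V D n _ z hc, eval_zero]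
  · simp [cauchyRow, cauchy, integralReal, integralGam, integralTorus, circleIntegral, hc]

theorem IsSolution.differentiableAt {B : ℂ → Matrix (Fin (D + 2)) (Fin (D + 2)) ℂ}
    (hB : IsSolution V D n B) (i c : Fin (D + 2)) {z : ℂ} (hz : z ∉ Sig D) :
    DifferentiableAt ℂ (fun z => B z i c) z :=
  (hB.analytic i c z hz).differentiableAt

theorem IsSolution.boundedNear {B : ℂ → Matrix (Fin (D + 2)) (Fin (D + 2)) ℂ}
    (hB : IsSolution V D n B) (i c : Fin (D + 2)) : BoundedNear D fun z => B z i c := fun s hs => by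
  obtain ⟨M, hM⟩ := hB.bounded s hs
  exact ⟨M, hM.mono fun z hz => hz i c⟩

theorem IsSolution.isBigO (hD : 2 ≤ D) {B : ℂ → Matrix (Fin (D + 2)) (Fin (D + 2)) ℂ}
    (hB : IsSolution V D n B) (i c : Fin (D + 2)) :
    (fun z => B z i c * normInv D n z c - (1 : Matrix (Fin (D + 2)) (Fin (D + 2)) ℂ) i c)
      =O[farOff D] fun z => z⁻¹ := by
  obtain ⟨E, hE, hO⟩ := hB.normalization
  refine (hO i c).congr' ?_ EventuallyEq.rfl
  filter_upwards [eventually_farOff_notMem D] with z hz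
  have hz0 : z ≠ 0 := fun h => hz (h ▸ zero_mem_Sig hD)
  rw [hE z hz, mul_normMatrix_apply, inv_mul_cancel_right₀ (normInv_ne_zero D n hz0 c),
    Matrix.add_apply, add_sub_cancel_left]

include hV hD he hl in
theorem IsSolution.eqOn {B B' : ℂ → Matrix (Fin (D + 2)) (Fin (D + 2)) ℂ}
    (hB : IsSolution V D n B) (hB' : IsSolution V D n B') : EqOn B B' (Sig D)ᶜ := by
  obtain ⟨Bp, Bm, h1, h2, h3⟩ := hB.jump
  obtain ⟨Bp', Bm', h1', h2', h3'⟩ := hB'.jump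
  have hentry : ∀ {F : ℂ → Matrix (Fin (D + 2)) (Fin (D + 2)) ℂ} {s : Set ℂ},
      ContinuousOn F s → ∀ i c, ContinuousOn (fun x => F x i c) s := fun hF i c =>
    continuousOn_pi.1 (continuousOn_pi.1 hF i) c
  have hlim : ∀ {F : ℂ → Matrix (Fin (D + 2)) (Fin (D + 2)) ℂ} {l : Filter ℂ}
      {A : Matrix (Fin (D + 2)) (Fin (D + 2)) ℂ}, Tendsto F l (𝓝 A) → ∀ i c,
      Tendsto (fun z => F z i c) l (𝓝 (A i c)) := fun hF i c =>
    tendsto_pi_nhds.1 (tendsto_pi_nhds.1 hF i) c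
  have hjump : ∀ i c, HasJump D (fun z => B z i c - B' z i c) fun x =>
      if (c : ℕ) = 0 then 0 else (Bm x i 0 - Bm' x i 0) * jumpRow V D n x c := fun i c => by
    refine ⟨fun x => Bp x i c - Bp' x i c, fun x => Bm x i c - Bm' x i c,
      (hentry h1 i c).sub (hentry h1' i c), (hentry h2 i c).sub (hentry h2' i c), fun x hx => ?_⟩
    obtain ⟨h4, h5, h6⟩ := h3 x hx
    obtain ⟨h4', h5', h6'⟩ := h3' x hx
    refine ⟨(hlim h4 i c).sub (hlim h4' i c), (hlim h5 i c).sub (hlim h5' i c), ?_⟩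
    simp only [h6, h6', mul_jumpMatrix_apply]
    split_ifs with hc
    · obtain rfl : c = 0 := Fin.ext hc
      ring
    · ring
  intro z hz
  ext i c
  rw [← sub_eq_zero]
  refine eq_zero_of_row hV hD he hl (n := n) (f := fun c z => B z i c - B' z i c)
    (f₀ := fun x => Bm x i 0 - Bm' x i 0)
    (fun c z hz => (hB.differentiableAt i c hz).fun_sub (hB'.differentiableAt i c hz))
    (by simpa using hjump i 0) (fun x hx => (hlim (h3 x hx).2.1 i 0).sub
      (hlim (h3' x hx).2.1 i 0)) (fun c hc => by simpa [hc] using hjump i c)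
    (fun c => (hB.boundedNear i c).sub (hB'.boundedNear i c)) (fun c => ?_) c z hz
  refine ((hB.isBigO hD i c).sub (hB'.isBigO hD i c)).congr_left fun z => ?_
  ring

end Rows

end OddRHP

end

/-! ### Assembly of the theorem. -/

theorem mainTheorem4 (V : ℝ[X]) (D : ℕ) (hdeg : V.natDegree = D) (hpos : 0 < D)
    (heven : Even D) (hlead : 0 < V.leadingCoeff) :
    (∃! P : ℕ → ℝ[X], OddRHP.IsNormalizedSkewOrthogonal V P) ∧
    ∀ P : ℕ → ℝ[X], OddRHP.IsNormalizedSkewOrthogonal V P → ∀ n : ℕ,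
      (∀ j ∈ Finset.Icc 1 D, ∃! Q : ℂ[X], OddRHP.IsAux V D n j Q) ∧
      ∀ R : ℕ → ℂ[X], (∀ j ∈ Finset.Icc 1 D, OddRHP.IsAux V D n j (R j)) →
        (∀ j ∈ Finset.Icc 1 (D - 1), OddRHP.IsEvenAux V D n j (R j) ∧
          ∀ Q : ℂ[X], OddRHP.IsEvenAux V D n j Q → Q = R j) ∧
        R D = -OddRHP.Psi V P (2 * n) ∧
        OddRHP.IsSolution V D n (OddRHP.explicitSolution V D n P R) ∧
        ∀ B : ℂ → Matrix (Fin (D + 2)) (Fin (D + 2)) ℂ, OddRHP.IsSolution V D n B →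
          Set.EqOn B (OddRHP.explicitSolution V D n P R) (OddRHP.Sig D)ᶜ := by
  have hD : 2 ≤ D := by
    obtain ⟨m, rfl⟩ := heven
    omega
  obtain ⟨P₀, hP₀⟩ := OddRHP.exists_isNormalizedSkewOrthogonal hdeg hD heven hlead
  refine ⟨⟨P₀, hP₀, fun P hP => hP.unique hdeg hD heven hlead hP₀⟩, fun P hP n =>
    ⟨fun j _ => OddRHP.existsUnique_isAux hdeg hD heven hlead n j, fun R hR => ?_⟩⟩
  have hsol := OddRHP.isSolution_explicitSolution hdeg hD heven hlead hP hR
  refine ⟨fun j hj => ?_, ?_, hsol, fun B hB => hB.eqOn hdeg hD heven hlead hsol⟩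
  · have hj' : j ∈ Finset.Icc 1 D :=
      Finset.mem_Icc.2 ⟨(Finset.mem_Icc.1 hj).1, (Finset.mem_Icc.1 hj).2.trans (D.sub_le 1)⟩
    exact ⟨(hR j hj').isEvenAux hD hj, fun Q hQ => (hQ.isAux hD hj).eq hdeg hD heven hlead
      (hR j hj')⟩
  · exact (hR D (Finset.mem_Icc.2 ⟨hpos, le_rfl⟩)).eq hdeg hD heven hlead
      (OddRHP.isAux_neg_Psi hdeg hD heven hlead hP.toIsSkewOrthogonal n)
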